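/- Let $d\ge 1$, let $U\in C^2(\mathbb{R}^d)$, let $\lambda_r>0$, let $\Sigma$ be a symmetric positive definite $d\times d$ matrix and $\mu_v=N(0,\Sigma)$. The bouncy particle sampler (BPS) started at $(x,y)\in\mathbb{R}^d\times\mathbb{R}^d$ is defined as follows. Let $(E_i,F_i,G_i)_{i\ge1}$ be i.i.d., with $E_i,F_i,G_i$ independent, $E_i,F_i$ exponential with parameter $1$ and $G_i\sim\mu_v$. Set $S_0=0$, $(X_0,Y_0)=(x,y)$ and, recursively, $$T_{n+1}^{(1)}=E_{n+1}/\lambda_r,\qquad T_{n+1}^{(2)}=\inf\Big\{t\ge0:\int_0^t\langle Y_{S_n},\nabla U(X_{S_n}+sY_{S_n})\rangle_+\,ds\ge F_{n+1}\Big\},$$ $T_{n+1}=T^{(1)}_{n+1}\wedge T^{(2)}_{n+1}$, $S_{n+1}=S_n+T_{n+1}$, $(X_t,Y_t)=(X_{S_n}+(t-S_n)Y_{S_n},Y_{S_n})$ for $t\in[S_n,S_{n+1})$, $X_{S_{n+1}}=X_{S_n}+T_{n+1}Y_{S_n}$, and $Y_{S_{n+1}}=G_{n+1}$ if $T_{n+1}=T_{n+1}^{(1)}$,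 $Y_{S_{n+1}}=R(X_{S_{n+1}},Y_{S_n})$ otherwise, where $R(x,y)=y-2\langle y,n(\nabla U(x))\rangle n(\nabla U(x))$ with $n(z)=z/\|z\|$ for $z\neq0$ and $n(0)=0$; for $t\ge\sup_nS_n$ the process is sent to a cemetery point. Let $P_t((x,y),A)=\mathbb{P}((X_t,Y_t)\in A)$ for Borel $A\subset\mathbb{R}^d\times\mathbb{R}^d$. For probability measures $\mu,\nu$, let $\|\mu-\nu\|_{TV}$ be twice the infimum of $\xi(\{(a,b):a\ne b\})$ over all couplings $\xi$ of $\mu$ and $\nu$. Let $t>0$, $R_K\ge0$, and let $K\subset\{(z,w)\in\mathbb{R}^d\times\mathbb{R}^d:\|z\|+\|w\|\le R_K\}$ be compact. Then for all $(x,y),(\tilde x,\tilde y)\in K$ and all $M\ge0$, $$\tfrac12\|P_t((x,y),\cdot)-P_t((\tilde x,\tilde y),\cdot)\|_{TV}\le 1-\mathbb{E}\Big[\mathbb{1}_{[0,\lambda_rt]}(E_1+E_2)\,\tilde\alpha\Big(\frac{2(\lambda_r+E_1)R_K\|\Sigma^{-1/2}\|}{E_2},M\Big)\,g(E_2/\lambda_r)\Big],$$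 where $\|\cdot\|$ is the Euclidean norm, and the associated operator norm for matrices, $$\tilde\alpha(r,M)=\frac{r}{2(2\pi)^{(d+1)/2}}\int_0^1 s^{-3/2}e^{-r^2/(8s)}\int_{\mathbb{R}^d}\mathbb{1}_{[0,M]}\Big(\big((1-s)w_1^2+w_2^2+\dots+w_d^2\big)^{1/2}\Big)e^{-\|w\|^2/2}\,dw\,ds$$ for $r\ge 0$ (with the convention $0\cdot\infty=0$), and, for $r>0$, $$g(r)=\mathbb{P}\Big(r\tilde M\sup_{\|z\|\le(1+E_1/\lambda_r)R_K+r\tilde M}\|\nabla U(z)\|\le E_3\Big),\qquad \tilde M=\|\Sigma^{1/2}\|M+\frac{(1+E_1/\lambda_r)R_K}{r},$$ and $E_1,E_2,E_3$ are independent exponential random variables with parameter $1$ (so $g$ is a deterministic function). -/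

import Mathlib

open MeasureTheory ProbabilityTheory
open scoped ENNReal NNReal RealInnerProductSpace Gradient MatrixOrder

noncomputable section

/-- Total variation norm of the difference of two probability measures, through couplings:
twice the infimum over all transference plans `ξ` between `μ` and `ν` of `ξ {(a, b) | a ≠ b}`. -/
def tvNorm {α : Type*} [MeasurableSpace α] (μ ν : Measure α) : ℝ≥0∞ :=
  2 * ⨅ ξ ∈ {ξ : Measure (α × α) | ξ.map Prod.fst = μ ∧ ξ.map Prod.snd = ν},
    ξ {p : α × α | p.1 ≠ p.2}

/-! ### The bouncy particle sampler -/

namespace BPS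

variable {d : ℕ}

/-- The unit vector `n(z) = z / ‖z‖`, with `n(0) = 0`. -/
def unitVec (z : EuclideanSpace ℝ (Fin d)) : EuclideanSpace ℝ (Fin d) :=
  if z = 0 then 0 else ‖z‖⁻¹ • z

/-- The bounce `R(x, y) = y - 2 ⟨y, n(∇U(x))⟩ n(∇U(x))`. -/
def bounce (U : EuclideanSpace ℝ (Fin d) → ℝ) (x y : EuclideanSpace ℝ (Fin d)) :
    EuclideanSpace ℝ (Fin d) :=
  y - (2 * ⟪y, unitVec (∇ U x)⟫) • unitVec (∇ U x)

/-- The waiting time `inf {t ≥ 0 : ∫₀ᵗ ⟨y, ∇U(x + s y)⟩₊ ds ≥ f}`, with `inf ∅ = ∞`. -/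
def bounceTime (U : EuclideanSpace ℝ (Fin d) → ℝ) (x y : EuclideanSpace ℝ (Fin d)) (f : ℝ) :
    ℝ≥0∞ :=
  ⨅ t ∈ {t : ℝ≥0 | f ≤ ∫ s in (0 : ℝ)..t, max ⟪y, ∇ U (x + s • y)⟫ 0}, (t : ℝ≥0∞)

/-- The waiting time `e / lam` until a refreshment is proposed. -/
def refreshTime (lam e : ℝ) : ℝ≥0∞ := ENNReal.ofReal (e / lam)

/-- One step of the recursion. The argument `q = (Sₙ, X_{Sₙ}, Y_{Sₙ})` holds the last jump time,
and the position and velocity right after it; `w = (e, f, γ)` holds the two exponential clocks and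
the proposed new velocity. The result is `(Sₙ₊₁, X_{Sₙ₊₁}, Y_{Sₙ₊₁})`. -/
def step (U : EuclideanSpace ℝ (Fin d) → ℝ) (lam : ℝ)
    (q : ℝ × EuclideanSpace ℝ (Fin d) × EuclideanSpace ℝ (Fin d))
    (w : ℝ × ℝ × EuclideanSpace ℝ (Fin d)) :
    ℝ × EuclideanSpace ℝ (Fin d) × EuclideanSpace ℝ (Fin d) :=
  let T₁ := refreshTime lam w.1
  let T₂ := bounceTime U q.2.1 q.2.2 w.2.1
  let T : ℝ := (min T₁ T₂).toReal
  let x' := q.2.1 + T • q.2.2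
  (q.1 + T, x', if T₁ ≤ T₂ then w.2.2 else bounce U x' q.2.2)

/-- The embedded chain `(Sₙ, X_{Sₙ}, Y_{Sₙ})`, started at `(0, x, y)` for `z = (x, y)`;
the `n`-th entry of `ω` is `(E_{n+1}, F_{n+1}, G_{n+1})`. -/
def skeleton (U : EuclideanSpace ℝ (Fin d) → ℝ) (lam : ℝ)
    (z : EuclideanSpace ℝ (Fin d) × EuclideanSpace ℝ (Fin d))
    (ω : ℕ → ℝ × ℝ × EuclideanSpace ℝ (Fin d)) :
    ℕ → ℝ × EuclideanSpace ℝ (Fin d) × EuclideanSpace ℝ (Fin d)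
  | 0 => (0, z)
  | n + 1 => step U lam (skeleton U lam z ω n) (ω n)

/-- The event `t < sup Sₙ` that the process has not reached the cemetery point at time `t`. -/
def alive (U : EuclideanSpace ℝ (Fin d) → ℝ) (lam t : ℝ)
    (z : EuclideanSpace ℝ (Fin d) × EuclideanSpace ℝ (Fin d)) :
    Set (ℕ → ℝ × ℝ × EuclideanSpace ℝ (Fin d)) :=
  {ω | ∃ n, t < (skeleton U lam z ω n).1}

/-- `(X_t, Y_t)`, for `t ≥ 0` and `t < sup Sₙ`: with `n` the number such that `Sₙ ≤ t < Sₙ₊₁`,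
it is `(X_{Sₙ} + (t - Sₙ) Y_{Sₙ}, Y_{Sₙ})`. The value elsewhere is irrelevant. -/
def state (U : EuclideanSpace ℝ (Fin d) → ℝ) (lam t : ℝ)
    (z : EuclideanSpace ℝ (Fin d) × EuclideanSpace ℝ (Fin d))
    (ω : ℕ → ℝ × ℝ × EuclideanSpace ℝ (Fin d)) :
    EuclideanSpace ℝ (Fin d) × EuclideanSpace ℝ (Fin d) :=
  let n := sInf {n : ℕ | t < (skeleton U lam z ω (n + 1)).1}
  let q := skeleton U lam z ω n
  (q.2.1 + (t - q.1) • q.2.2, q.2.2)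

/-- The law of an i.i.d. sequence `(E_i, F_i, G_i)`, where `E_i`, `F_i`, `G_i` are independent,
`E_i` and `F_i` are exponential with parameter `1`, and `G_i` has law `ν`. -/
def noise (ν : Measure (EuclideanSpace ℝ (Fin d))) :
    Measure (ℕ → ℝ × ℝ × EuclideanSpace ℝ (Fin d)) :=
  Measure.infinitePi fun _ => (expMeasure 1).prod ((expMeasure 1).prod ν)

/-- The transition kernel `P_t(z, A) = ℙ((X_t, Y_t) ∈ A)` of the bouncy particle sampler with
potential `U`, refreshment rate `lam` and refreshment distribution `ν`, started at `z = (x, y)`. -/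
def transition (U : EuclideanSpace ℝ (Fin d) → ℝ) (lam : ℝ)
    (ν : Measure (EuclideanSpace ℝ (Fin d))) (t : ℝ)
    (z : EuclideanSpace ℝ (Fin d) × EuclideanSpace ℝ (Fin d)) :
    Measure (EuclideanSpace ℝ (Fin d) × EuclideanSpace ℝ (Fin d)) :=
  ((noise ν).restrict (alive U lam t z)).map (state U lam t z)

/-! ### The explicit bound -/

/-- Operator norm of a matrix for the Euclidean norm. -/
def matNorm (A : Matrix (Fin d) (Fin d) ℝ) : ℝ :=
  ‖Matrix.toEuclideanCLM (n := Fin d) (𝕜 := ℝ) A‖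

/-- The function `α̃(r, M)` in dimension `d ≥ 1`. -/
def alphaTilde (d : ℕ) [NeZero d] (r M : ℝ) : ℝ≥0∞ :=
  ENNReal.ofReal (r / (2 * (2 * Real.pi) ^ (((d : ℝ) + 1) / 2))) *
    ∫⁻ s in Set.Ioc (0 : ℝ) 1,
      ENNReal.ofReal (s ^ (-(3 / 2) : ℝ) * Real.exp (-r ^ 2 / (8 * s))) *
        ∫⁻ w : EuclideanSpace ℝ (Fin d),
          Set.indicator
            {w : EuclideanSpace ℝ (Fin d) |
              Real.sqrt ((1 - s) * w 0 ^ 2 + ∑ i ∈ Finset.univ.erase 0, w i ^ 2) ≤ M}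
            (fun w => ENNReal.ofReal (Real.exp (-‖w‖ ^ 2 / 2))) w

/-- The bound `M̃ = ‖S^{1/2}‖ M + (1 + e / lam) RK / r` on the two velocities during a time `r`
which follows a refreshment at time `e / lam`. -/
def velBound (S : Matrix (Fin d) (Fin d) ℝ) (lam RK M r e : ℝ) : ℝ :=
  matNorm (CFC.sqrt S) * M + (1 + e / lam) * RK / r

/-- `g(r) = ℙ(r M̃ sup {‖∇U(z)‖ : z ∈ B(0, (1 + E₁ / lam) RK + r M̃)} ≤ E₃)`, where `E₁`, `E₃` are
independent exponential random variables with parameter `1`. -/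
def noBounceProb (U : EuclideanSpace ℝ (Fin d) → ℝ) (S : Matrix (Fin d) (Fin d) ℝ)
    (lam RK M r : ℝ) : ℝ≥0∞ :=
  ((expMeasure 1).prod (expMeasure 1))
    {p : ℝ × ℝ | r * velBound S lam RK M r p.1 *
      sSup ((fun z => ‖∇ U z‖) '' Metric.closedBall (0 : EuclideanSpace ℝ (Fin d))
        ((1 + p.1 / lam) * RK + r * velBound S lam RK M r p.1)) ≤ p.2}

/-- The expectation
`𝔼[1_{[0, lam t]}(E₁ + E₂) α̃(2 (lam + E₁) RK ‖S^{-1/2}‖ / E₂, M) g(E₂ / lam)]`, where `E₁`, `E₂`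
are independent exponential random variables with parameter `1`. -/
def couplingMass [NeZero d] (U : EuclideanSpace ℝ (Fin d) → ℝ) (S : Matrix (Fin d) (Fin d) ℝ)
    (lam RK M t : ℝ) : ℝ≥0∞ :=
  ∫⁻ p : ℝ × ℝ,
    Set.indicator {p : ℝ × ℝ | p.1 + p.2 ∈ Set.Icc 0 (lam * t)}
      (fun p =>
        alphaTilde d (2 * (lam + p.1) * RK * matNorm ((CFC.sqrt S)⁻¹) / p.2) M *
          noBounceProb U S lam RK M (p.2 / lam)) p
    ∂((expMeasure 1).prod (expMeasure 1))

end BPS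

end

/-! The bound comes from making two copies of the process merge at their second refreshment. By
`half_tvNorm_le_of_common_minorant` it suffices to find a measure below both transition laws whose
mass is at least `couplingMass`.

The refreshment clock is memoryless, so the first refreshment time has the law of `E₁ / lam`
whatever bounces precede it (`firstRefresh_fst`). Bounces preserve speed, so at that time `s` the
position has norm at most `(1 + s) * RK` (`ae_norm_firstRefresh_le`). The two laws at the first
refreshment can therefore be joined with a common time (`exists_joint_firstRefresh`).

Let `x`, `x'` be the two positions and `r` the time to the second refreshment. Velocities `Σ^{1/2}(m
+ h)` and `Σ^{1/2}(m - h)` with `2 r Σ^{1/2} h = x' - x` lead to the same point at time `r`,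
provided neither copy bounces; a common refreshment then gives both the same future. The minimum of
the two Gaussian densities, integrated over `‖m‖ ≤ M`, is `gaussOverlap` at distance `2‖h‖`. It
dominates `α̃` (`alphaTilde_le_gaussOverlap`): the overlap is computed by the reflection principle,
and `α̃` is the same quantity written through the first passage of a Brownian motion at half the
distance. On `‖m‖ ≤ M` both speeds are at most `M̃`, so a bounce clock above `r M̃ sup ‖∇U‖`
excludes bounces; this is `noBounceWeight`. Hence `lintegral_meetWeight_le`, whose left side is
unchanged when the two positions are exchanged.

In the mass obtained this way the no-bounce probability involves the same `E₁` as the overlap,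
whereas `g` averages over an independent copy. For fixed `E₂` both factors are decreasing in `E₁`,
so Chebyshev's association inequality allows the decoupling (`couplingMass_le`).

The passage from the recursive construction to these estimates uses a renewal argument: sub- and
supersolutions of the one-step equation are compared with integrals against the law of the first
refreshment. Non-explosion (`explosionProb_eq_zero`) ensures that the transition laws are
probability measures. -/

/-! ### Coupling by a common minorant, and association -/

/-- Two probability measures with a common minorant `κ` can be coupled so that they agree with
probability at least `κ univ`. -/
theorem half_tvNorm_le_of_common_minorant {α : Type*} [MeasurableSpace α] [MeasurableEq α]
    (μ ν κ : Measure α) [IsProbabilityMeasure μ] [IsProbabilityMeasure ν]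
    (hμ : κ ≤ μ) (hν : κ ≤ ν) : 1 / 2 * tvNorm μ ν ≤ 1 - κ Set.univ := by
  have hκ1 : κ Set.univ ≤ 1 := (hμ _).trans prob_le_one
  have : IsFiniteMeasure κ := ⟨hκ1.trans_lt ENNReal.one_lt_top⟩
  set c : ℝ≥0∞ := 1 - κ Set.univ with hc
  have hctop : c ≠ ∞ := ne_top_of_le_ne_top ENNReal.one_ne_top tsub_le_self
  have hμu : (μ - κ) Set.univ = c := by
    rw [Measure.sub_apply MeasurableSet.univ hμ, measure_univ]
  have hνu : (ν - κ) Set.univ = c := by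
    rw [Measure.sub_apply MeasurableSet.univ hν, measure_univ]
  have : IsFiniteMeasure (μ - κ) := isFiniteMeasure_of_le μ Measure.sub_le
  have : IsFiniteMeasure (ν - κ) := isFiniteMeasure_of_le ν Measure.sub_le
  -- The common part sits on the diagonal, and the residuals are independent, normalised by their
  -- common mass `c`.
  set ξ : Measure (α × α) := κ.map (fun x => (x, x)) + c⁻¹ • (μ - κ).prod (ν - κ) with hξ
  have hdiag : Measurable (fun x : α => (x, x)) := measurable_id.prodMk measurable_id
  -- If `c = 0` then `c⁻¹ * c = ∞ * 0 = 0`, which is harmless because the residual measures vanish.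
  have hcancel : ∀ m : Measure α, m Set.univ = c → (c⁻¹ * c) • m = m := by
    intro m hm
    by_cases h0 : c = 0
    · have : m = 0 := Measure.measure_univ_eq_zero.1 (hm.trans h0)
      simp [this]
    · rw [ENNReal.inv_mul_cancel h0 hctop, one_smul]
  have hfst : ξ.map Prod.fst = μ := by
    rw [hξ, Measure.map_add _ _ measurable_fst, Measure.map_map measurable_fst hdiag,
      Measure.map_smul, Measure.map_fst_prod, hνu, smul_smul, hcancel _ hμu]
    change κ.map id + _ = _
    rw [Measure.map_id, add_comm, Measure.sub_add_cancel_of_le hμ]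
  have hsnd : ξ.map Prod.snd = ν := by
    rw [hξ, Measure.map_add _ _ measurable_snd, Measure.map_map measurable_snd hdiag,
      Measure.map_smul, Measure.map_snd_prod, hμu, smul_smul, hcancel _ hνu]
    change κ.map id + _ = _
    rw [Measure.map_id, add_comm, Measure.sub_add_cancel_of_le hν]
  have hne : MeasurableSet {p : α × α | p.1 ≠ p.2} :=
    (measurableSet_eq_fun measurable_fst measurable_snd).compl
  have hval : ξ {p : α × α | p.1 ≠ p.2} ≤ c := by
    rw [hξ, Measure.add_apply, Measure.map_apply hdiag hne]
    have h1 : (fun x : α => (x, x)) ⁻¹' {p : α × α | p.1 ≠ p.2} = ∅ := by ext; simp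
    rw [h1, measure_empty, zero_add, Measure.smul_apply, smul_eq_mul]
    calc c⁻¹ * ((μ - κ).prod (ν - κ)) {p : α × α | p.1 ≠ p.2}
        ≤ c⁻¹ * ((μ - κ).prod (ν - κ)) Set.univ := by gcongr; exact Set.subset_univ _
      _ = (c⁻¹ * c) * c := by
        rw [← Set.univ_prod_univ, Measure.prod_prod, hμu, hνu, mul_assoc]
      _ ≤ 1 * c := by gcongr; exact ENNReal.inv_mul_le_one c
      _ = c := one_mul c
  unfold tvNorm
  rw [← mul_assoc, ENNReal.div_mul_cancel (by norm_num) (by norm_num), one_mul]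
  exact (iInf₂_le ξ ⟨hfst, hsnd⟩).trans hval

/-- Chebyshev's association inequality for two functions which are antitone on a set of full
measure. -/
theorem lintegral_mul_lintegral_le_of_antitoneOn {α : Type*} [LinearOrder α] [MeasurableSpace α]
    (μ : Measure α) [IsProbabilityMeasure μ] {f g : α → ℝ≥0∞} (hf : Measurable f)
    (hg : Measurable g) {s : Set α} (hs : ∀ᵐ x ∂μ, x ∈ s) (hfs : AntitoneOn f s)
    (hgs : AntitoneOn g s) :
    (∫⁻ x, f x ∂μ) * ∫⁻ x, g x ∂μ ≤ ∫⁻ x, f x * g x ∂μ := by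
  -- This is `(f x - f y) * (g x - g y) ≥ 0` written without subtraction; integrating it over two
  -- independent copies gives the claim.
  have key : ∀ x ∈ s, ∀ y ∈ s, f x * g y + f y * g x ≤ f x * g x + f y * g y := by
    have aux : ∀ a b c d : ℝ≥0∞, a ≤ b → c ≤ d → b * c + a * d ≤ b * d + a * c := by
      intro a b c d hab hcd
      obtain ⟨u, rfl⟩ := exists_add_of_le hab
      obtain ⟨v, rfl⟩ := exists_add_of_le hcd
      have : (a + u) * (c + v) + a * c = (a + u) * c + a * (c + v) + u * v := by ring
      rw [this]; exact le_self_add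
    intro x hx y hy
    rcases le_total x y with h | h
    · have := aux _ _ _ _ (hfs hx hy h) (hgs hx hy h)
      exact this
    · have := aux _ _ _ _ (hfs hy hx h) (hgs hy hx h)
      rw [add_comm, add_comm (f x * g x)]; exact this
  have hint : ∫⁻ x, ∫⁻ y, (f x * g y + f y * g x) ∂μ ∂μ ≤
      ∫⁻ x, ∫⁻ y, (f x * g x + f y * g y) ∂μ ∂μ := by
    refine lintegral_mono_ae ?_
    filter_upwards [hs] with x hx
    refine lintegral_mono_ae ?_
    filter_upwards [hs] with y hy
    exact key x hx y hy
  have e1 : ∫⁻ x, ∫⁻ y, (f x * g y + f y * g x) ∂μ ∂μ =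
      2 * ((∫⁻ x, f x ∂μ) * ∫⁻ x, g x ∂μ) := by
    have : ∀ x, ∫⁻ y, (f x * g y + f y * g x) ∂μ =
        f x * (∫⁻ y, g y ∂μ) + (∫⁻ y, f y ∂μ) * g x := by
      intro x
      rw [lintegral_add_left (hg.const_mul _), lintegral_const_mul _ hg,
        lintegral_mul_const _ hf]
    simp_rw [this]
    rw [lintegral_add_left (hf.mul_const _), lintegral_mul_const _ hf, lintegral_const_mul _ hg]
    ring
  have e2 : ∫⁻ x, ∫⁻ y, (f x * g x + f y * g y) ∂μ ∂μ = 2 * ∫⁻ x, f x * g x ∂μ := by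
    have : ∀ x, ∫⁻ y, (f x * g x + f y * g y) ∂μ = f x * g x + ∫⁻ y, f y * g y ∂μ := by
      intro x
      rw [lintegral_add_left measurable_const, lintegral_const, measure_univ, mul_one]
    simp_rw [this]
    rw [lintegral_add_right _ measurable_const, lintegral_const, measure_univ, mul_one]
    ring
  rw [e1, e2] at hint
  exact (ENNReal.mul_le_mul_iff_right (by norm_num) (by norm_num)).1 hint

/-! ### The exponential law -/

instance : IsProbabilityMeasure (expMeasure 1) := isProbabilityMeasure_expMeasure one_pos

theorem lintegral_expMeasure_one (f : ℝ → ℝ≥0∞) (hf : Measurable f) :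
    ∫⁻ x, f x ∂(expMeasure 1) =
      ∫⁻ x in Set.Ici 0, ENNReal.ofReal (Real.exp (-x)) * f x := by
  have h : expMeasure 1 = volume.withDensity (exponentialPDF 1) := rfl
  have hm : Measurable (exponentialPDF 1) := (measurable_exponentialPDFReal 1).ennreal_ofReal
  rw [h, lintegral_withDensity_eq_lintegral_mul _ hm hf, ← lintegral_indicator measurableSet_Ici]
  refine lintegral_congr fun x => ?_
  by_cases hx : 0 ≤ x
  · simp [exponentialPDF_of_nonneg hx, Set.indicator_of_mem, hx]
  · simp [exponentialPDF_of_neg (not_le.1 hx), hx]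

theorem ae_pos_expMeasure_one : ∀ᵐ x ∂(expMeasure 1), 0 < x := by
  rw [ae_iff]
  have hs : MeasurableSet {x : ℝ | ¬ 0 < x} := by
    simp only [not_lt]; exact measurableSet_Iic
  rw [← lintegral_indicator_one hs,
    lintegral_expMeasure_one _ (measurable_one.indicator hs)]
  rw [setLIntegral_congr Ioi_ae_eq_Ici.symm]
  refine (setLIntegral_congr_fun (g := 0) measurableSet_Ioi ?_).trans (by simp)
  intro x hx
  have hx0 : 0 < x := hx
  simp [hx0]

/-- Memorylessness: the exponential law splits at any time `c ≥ 0`. -/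
theorem lintegral_expMeasure_one_split (f : ℝ → ℝ≥0∞) (hf : Measurable f) {c : ℝ} (hc : 0 ≤ c) :
    ∫⁻ x, f x ∂(expMeasure 1) = ∫⁻ x, (Set.Iio c).indicator f x ∂(expMeasure 1) +
      ENNReal.ofReal (Real.exp (-c)) * ∫⁻ x, f (c + x) ∂(expMeasure 1) := by
  rw [lintegral_expMeasure_one f hf,
    lintegral_expMeasure_one _ (hf.indicator measurableSet_Iio),
    lintegral_expMeasure_one (fun x => f (c + x)) (by fun_prop)]
  have h1 : Set.Ici (0 : ℝ) = Set.Ico 0 c ∪ Set.Ici c := (Set.Ico_union_Ici_eq_Ici hc).symm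
  have hd : Disjoint (Set.Ico 0 c) (Set.Ici c) := by
    rw [Set.disjoint_left]; intro x hx hx'; exact absurd hx.2 (not_lt.2 hx')
  conv_lhs => rw [h1, lintegral_union measurableSet_Ici hd]
  congr 1
  · rw [← lintegral_indicator measurableSet_Ico, ← lintegral_indicator measurableSet_Ici]
    refine lintegral_congr fun x => ?_
    by_cases h0 : 0 ≤ x <;> by_cases h2 : x < c <;> simp [h0, h2, Set.indicator]
  · rw [← lintegral_const_mul _ (by fun_prop), ← lintegral_indicator measurableSet_Ici,
      ← lintegral_indicator measurableSet_Ici,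
      ← lintegral_add_left_eq_self (μ := volume) _ c]
    refine lintegral_congr fun x => ?_
    by_cases h0 : 0 ≤ x
    · simp only [Set.indicator, Set.mem_Ici, le_add_iff_nonneg_right, h0, if_true]
      rw [← mul_assoc, ← ENNReal.ofReal_mul (Real.exp_nonneg _), ← Real.exp_add]
      congr 3; ring
    · simp [Set.indicator, h0]

theorem expMeasure_one_Ici {c : ℝ} (hc : 0 ≤ c) :
    expMeasure 1 (Set.Ici c) = ENNReal.ofReal (Real.exp (-c)) := by
  have h := lintegral_expMeasure_one_split ((Set.Ici c).indicator 1)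
    (measurable_one.indicator measurableSet_Ici) hc
  rw [lintegral_indicator_one measurableSet_Ici] at h
  rw [h]
  have h1 : ∀ x, (Set.Iio c).indicator ((Set.Ici c).indicator (1 : ℝ → ℝ≥0∞)) x = 0 := by
    intro x; by_cases hx : x < c <;> simp [hx, not_le.2]
  have h2 : ∫⁻ x, (Set.Ici c).indicator (1 : ℝ → ℝ≥0∞) (c + x) ∂(expMeasure 1) = 1 := by
    rw [← measure_univ (μ := expMeasure 1), ← lintegral_one]
    refine lintegral_congr_ae ?_
    filter_upwards [ae_pos_expMeasure_one] with x hx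
    simp [hx.le]
  simp [h1, h2]

instance : NullSingletonClass (expMeasure 1) := by
  have h : expMeasure 1 = volume.withDensity (exponentialPDF 1) := rfl
  rw [h]; infer_instance

theorem expMeasure_one_Ioi {c : ℝ} (hc : 0 ≤ c) :
    expMeasure 1 (Set.Ioi c) = ENNReal.ofReal (Real.exp (-c)) := by
  rw [measure_congr Ioi_ae_eq_Ici, expMeasure_one_Ici hc]

/-! ### First passage density and heat kernel -/

/-- The integral of a nonnegative derivative over an open interval is at most the increment of
the primitive between its limits at the end points. -/
theorem setLIntegral_Ioo_le_of_hasDerivAt {F f : ℝ → ℝ} {a b A B : ℝ} (hab : a < b)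
    (hF : ∀ x ∈ Set.Ioo a b, HasDerivAt F (f x) x) (hf : ContinuousOn f (Set.Ioo a b))
    (hf0 : ∀ x ∈ Set.Ioo a b, 0 ≤ f x)
    (hA : Filter.Tendsto F (nhdsWithin a (Set.Ioo a b)) (nhds A))
    (hB : Filter.Tendsto F (nhdsWithin b (Set.Ioo a b)) (nhds B)) :
    ∫⁻ x in Set.Ioo a b, ENNReal.ofReal (f x) ≤ ENNReal.ofReal (B - A) := by
  -- The integrand may blow up at the end points, so the fundamental theorem of calculus is applied
  -- on inner intervals that exhaust the open one.
  obtain ⟨u, -, hu, hut⟩ := exists_seq_strictAnti_tendsto' hab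
  obtain ⟨v, -, hv, hvt⟩ := exists_seq_strictMono_tendsto' hab
  have hcov : AECover (volume.restrict (Set.Ioo a b)) Filter.atTop
      (fun n => Set.Ioo (u n) (v n)) :=
    aecover_Ioo_of_Ioo hut hvt
  have hmeas : AEMeasurable (fun x => ENNReal.ofReal (f x)) (volume.restrict (Set.Ioo a b)) :=
    (hf.aemeasurable measurableSet_Ioo).ennreal_ofReal
  have hlim : Filter.Tendsto (fun n => ENNReal.ofReal (F (v n) - F (u n))) Filter.atTop
      (nhds (ENNReal.ofReal (B - A))) := by
    refine ENNReal.tendsto_ofReal (Filter.Tendsto.sub (hB.comp ?_) (hA.comp ?_))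
    · exact tendsto_nhdsWithin_iff.2 ⟨hvt, Filter.Eventually.of_forall hv⟩
    · exact tendsto_nhdsWithin_iff.2 ⟨hut, Filter.Eventually.of_forall hu⟩
  refine le_of_tendsto_of_tendsto' (hcov.lintegral_tendsto_of_countably_generated hmeas) hlim
    fun n => ?_
  rcases lt_or_ge (u n) (v n) with h | h
  swap
  · simp [Set.Ioo_eq_empty (not_lt.2 h)]
  have hsub : Set.Icc (u n) (v n) ⊆ Set.Ioo a b := fun x hx =>
    ⟨(hu n).1.trans_le hx.1, hx.2.trans_lt (hv n).2⟩
  rw [Measure.restrict_restrict measurableSet_Ioo,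
    Set.inter_eq_left.2 (Set.Ioo_subset_Icc_self.trans hsub)]
  have hI : IntervalIntegrable f volume (u n) (v n) :=
    (hf.mono (by rwa [Set.uIcc_of_le h.le])).intervalIntegrable
  have hint : IntegrableOn f (Set.Ioo (u n) (v n)) :=
    ((intervalIntegrable_iff_integrableOn_Icc_of_le h.le).1 hI).mono_set Set.Ioo_subset_Icc_self
  rw [← ofReal_integral_eq_lintegral_ofReal hint]
  · rw [← integral_Ioc_eq_integral_Ioo, ← intervalIntegral.integral_of_le h.le,
      intervalIntegral.integral_eq_sub_of_hasDerivAt _ hI]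
    intro x hx
    rw [Set.uIcc_of_le h.le] at hx
    exact hF x (hsub hx)
  · filter_upwards [ae_restrict_mem measurableSet_Ioo] with x hx
    exact hf0 x (hsub (Set.Ioo_subset_Icc_self hx))

noncomputable section

/-- The centred primitive of `exp (-y² / 2)`. -/
def gaussPrim (x : ℝ) : ℝ := ∫ y in (0 : ℝ)..x, Real.exp (-y ^ 2 / 2)

theorem hasDerivAt_gaussPrim (x : ℝ) : HasDerivAt gaussPrim (Real.exp (-x ^ 2 / 2)) x := by
  have hc : Continuous fun y : ℝ => Real.exp (-y ^ 2 / 2) := by fun_prop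
  exact intervalIntegral.integral_hasDerivAt_right (hc.intervalIntegrable _ _)
    (hc.stronglyMeasurableAtFilter _ _) hc.continuousAt

theorem gaussPrim_neg (x : ℝ) : gaussPrim (-x) = -gaussPrim x := by
  have h := intervalIntegral.integral_comp_neg (a := 0) (b := x)
    (fun y : ℝ => Real.exp (-y ^ 2 / 2))
  simp only [neg_zero, neg_sq] at h
  rw [gaussPrim, gaussPrim, intervalIntegral.integral_symm, h]

theorem tendsto_gaussPrim_atTop :
    Filter.Tendsto gaussPrim Filter.atTop (nhds (Real.sqrt (2 * Real.pi) / 2)) := by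
  have he : (fun y : ℝ => Real.exp (-y ^ 2 / 2)) = fun y => Real.exp (-(1 / 2) * y ^ 2) := by
    funext y; congr 1; ring
  have h := intervalIntegral_tendsto_integral_Ioi (f := fun y : ℝ => Real.exp (-y ^ 2 / 2))
    (μ := volume) 0 (by rw [he]; exact (integrable_exp_neg_mul_sq (by norm_num)).integrableOn)
    Filter.tendsto_id
  have h2 := integral_gaussian_Ioi (1 / 2)
  rw [show Real.pi / (1 / 2) = 2 * Real.pi by ring] at h2
  rw [← h2, ← he]
  exact h

theorem tendsto_gaussPrim_atBot :
    Filter.Tendsto gaussPrim Filter.atBot (nhds (-(Real.sqrt (2 * Real.pi) / 2))) := by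
  have h := (tendsto_gaussPrim_atTop.comp Filter.tendsto_neg_atBot_atTop).neg
  refine h.congr fun x => ?_
  simp [gaussPrim_neg]

/-- Convolution of the first passage density of Brownian motion at level `a` with the heat
kernel. -/
theorem lintegral_passage_heat_le {a b : ℝ} (ha : 0 < a) (hb : 0 ≤ b) :
    ∫⁻ s in Set.Ioo (0 : ℝ) 1, ENNReal.ofReal (s ^ (-(3 / 2) : ℝ) * (Real.sqrt (1 - s))⁻¹ *
      Real.exp (-a ^ 2 / (2 * s) - b ^ 2 / (2 * (1 - s)))) ≤
      ENNReal.ofReal (Real.sqrt (2 * Real.pi) / a * Real.exp (-(a + b) ^ 2 / 2)) := by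
  set p : ℝ → ℝ := fun s => Real.sqrt (1 - s) / Real.sqrt s with hp
  set C : ℝ := Real.exp (-(a ^ 2 + b ^ 2) / 2) / a with hC
  set L : ℝ := Real.sqrt (2 * Real.pi) / 2 with hL
  -- An explicit primitive. Since `(a p ∓ b / p)² = a² p² + b² / p² ∓ 2 a b`, the prefactors `exp (∓
  -- a b)` give both terms the same Gaussian factor in the derivative; the contributions of `b / p²`
  -- then cancel. As `p² = (1 - s) / s`, the constant `C` completes the exponent to the required
  -- one.
  set F : ℝ → ℝ := fun s => -C * (Real.exp (-(a * b)) * gaussPrim (a * p s - b / p s) +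
    Real.exp (a * b) * gaussPrim (a * p s + b / p s)) with hF
  have hrpow : ∀ s : ℝ, 0 < s → s ^ (-(3 / 2) : ℝ) = (s * Real.sqrt s)⁻¹ := by
    intro s hs
    rw [Real.rpow_neg hs.le, Real.sqrt_eq_rpow, show (3 / 2 : ℝ) = 1 + 1 / 2 by norm_num,
      Real.rpow_add hs, Real.rpow_one]
  have hderiv : ∀ s ∈ Set.Ioo (0 : ℝ) 1, HasDerivAt F (s ^ (-(3 / 2) : ℝ) *
      (Real.sqrt (1 - s))⁻¹ * Real.exp (-a ^ 2 / (2 * s) - b ^ 2 / (2 * (1 - s)))) s := by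
    rintro s ⟨hs0, hs1⟩
    have hs1' : 0 < 1 - s := by linarith
    have hq : 0 < Real.sqrt s := Real.sqrt_pos.2 hs0
    have hq1 : 0 < Real.sqrt (1 - s) := Real.sqrt_pos.2 hs1'
    have hqs : Real.sqrt s ^ 2 = s := Real.sq_sqrt hs0.le
    have hqs1 : Real.sqrt (1 - s) ^ 2 = 1 - s := Real.sq_sqrt hs1'.le
    have hp0 : 0 < p s := div_pos hq1 hq
    have hpd : HasDerivAt p (-(1 / (2 * s * Real.sqrt s * Real.sqrt (1 - s)))) s := by
      have h1 : HasDerivAt (fun s : ℝ => Real.sqrt (1 - s)) (-1 / (2 * Real.sqrt (1 - s))) s :=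
        ((hasDerivAt_id s).const_sub 1).sqrt hs1'.ne'
      have h2 : HasDerivAt (fun s : ℝ => Real.sqrt s) (1 / (2 * Real.sqrt s)) s :=
        (hasDerivAt_id s).sqrt hs0.ne'
      refine (h1.div h2 hq.ne').congr_deriv ?_
      rw [hqs]
      field_simp
      nlinarith [hqs, hqs1]
    have hm : HasDerivAt (fun s => a * p s - b / p s)
        ((a + b / p s ^ 2) * -(1 / (2 * s * Real.sqrt s * Real.sqrt (1 - s)))) s := by
      refine ((hpd.const_mul a).sub ((hasDerivAt_const s b).div hpd hp0.ne')).congr_deriv ?_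
      field_simp; ring
    have hpl : HasDerivAt (fun s => a * p s + b / p s)
        ((a - b / p s ^ 2) * -(1 / (2 * s * Real.sqrt s * Real.sqrt (1 - s)))) s := by
      refine ((hpd.const_mul a).add ((hasDerivAt_const s b).div hpd hp0.ne')).congr_deriv ?_
      field_simp; ring
    have hd := ((((hasDerivAt_gaussPrim _).comp s hm).const_mul (Real.exp (-(a * b)))).add
      (((hasDerivAt_gaussPrim _).comp s hpl).const_mul (Real.exp (a * b)))).const_mul (-C)
    refine hd.congr_deriv ?_
    set E : ℝ := Real.exp (-(a ^ 2 * p s ^ 2 + b ^ 2 / p s ^ 2) / 2) with hE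
    have e1 : Real.exp (-(a * b)) * Real.exp (-(a * p s - b / p s) ^ 2 / 2) = E := by
      rw [← Real.exp_add]; congr 1; field_simp; ring
    have e2 : Real.exp (a * b) * Real.exp (-(a * p s + b / p s) ^ 2 / 2) = E := by
      rw [← Real.exp_add]; congr 1; field_simp; ring
    have hp2 : p s ^ 2 = (1 - s) / s := by rw [hp]; simp only [div_pow, hqs, hqs1]
    have e3 : C * E = Real.exp (-a ^ 2 / (2 * s) - b ^ 2 / (2 * (1 - s))) / a := by
      rw [hC, div_mul_eq_mul_div, hE, ← Real.exp_add, hp2]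
      congr 2; field_simp; ring
    rw [← mul_assoc (Real.exp (-(a * b))), ← mul_assoc (Real.exp (a * b)), e1, e2, hrpow s hs0]
    have e4 : Real.exp (-a ^ 2 / (2 * s) - b ^ 2 / (2 * (1 - s))) = C * E * a := by
      rw [e3]; field_simp
    rw [e4]
    field_simp
    ring
  have hcont : ContinuousOn (fun s : ℝ => s ^ (-(3 / 2) : ℝ) * (Real.sqrt (1 - s))⁻¹ *
      Real.exp (-a ^ 2 / (2 * s) - b ^ 2 / (2 * (1 - s)))) (Set.Ioo 0 1) := by
    intro s hs
    have hs0 : s ≠ 0 := hs.1.ne'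
    have hs1 : 0 < 1 - s := by linarith [hs.2]
    have hs2 : Real.sqrt (1 - s) ≠ 0 := (Real.sqrt_pos.2 hs1).ne'
    refine ContinuousAt.continuousWithinAt ?_
    refine ContinuousAt.mul (ContinuousAt.mul ?_ (ContinuousAt.inv₀ (by fun_prop) hs2)) ?_
    · exact Real.continuousAt_rpow_const _ _ (Or.inl hs0)
    · refine ContinuousAt.rexp (ContinuousAt.sub ?_ ?_)
      · exact ContinuousAt.div (by fun_prop) (by fun_prop) (by simpa using hs0)
      · exact ContinuousAt.div (by fun_prop) (by fun_prop) (by simpa using hs1.ne')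
  have hnn : ∀ s ∈ Set.Ioo (0 : ℝ) 1, 0 ≤ s ^ (-(3 / 2) : ℝ) * (Real.sqrt (1 - s))⁻¹ *
      Real.exp (-a ^ 2 / (2 * s) - b ^ 2 / (2 * (1 - s))) := by
    intro s hs
    have := Real.rpow_nonneg hs.1.le (-(3 / 2) : ℝ)
    positivity
  have hppos : ∀ s ∈ Set.Ioo (0 : ℝ) 1, 0 < p s := fun s hs =>
    div_pos (Real.sqrt_pos.2 (by linarith [hs.2])) (Real.sqrt_pos.2 hs.1)
  have hp0 : Filter.Tendsto p (nhdsWithin 0 (Set.Ioo 0 1)) Filter.atTop := by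
    have h1 : Filter.Tendsto (fun s : ℝ => Real.sqrt (1 - s)) (nhdsWithin 0 (Set.Ioo 0 1))
        (nhds 1) := by
      have : Continuous fun s : ℝ => Real.sqrt (1 - s) := by fun_prop
      simpa using (this.tendsto 0).mono_left nhdsWithin_le_nhds
    have h2 : Filter.Tendsto (fun s : ℝ => (Real.sqrt s)⁻¹) (nhdsWithin 0 (Set.Ioo 0 1))
        Filter.atTop := by
      refine Filter.Tendsto.inv_tendsto_nhdsGT_zero ?_
      refine tendsto_nhdsWithin_iff.2 ⟨?_, ?_⟩
      · simpa using (Real.continuous_sqrt.tendsto 0).mono_left nhdsWithin_le_nhds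
      · filter_upwards [self_mem_nhdsWithin] with s hs using Real.sqrt_pos.2 hs.1
    exact h1.pos_mul_atTop one_pos h2
  have hp1 : Filter.Tendsto p (nhdsWithin 1 (Set.Ioo 0 1)) (nhdsWithin 0 (Set.Ioi 0)) := by
    refine tendsto_nhdsWithin_iff.2 ⟨?_, ?_⟩
    · have : ContinuousAt p 1 := by
        refine ContinuousAt.div (by fun_prop) (by fun_prop) (by simp)
      have h := this.tendsto.mono_left (nhdsWithin_le_nhds (s := Set.Ioo (0 : ℝ) 1))
      simpa [hp] using h
    · filter_upwards [self_mem_nhdsWithin] with s hs using hppos s hs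
  have hbp : Filter.Tendsto (fun s => b / p s) (nhdsWithin 0 (Set.Ioo 0 1)) (nhds 0) :=
    hp0.const_div_atTop b
  have hap : Filter.Tendsto (fun s => a * p s) (nhdsWithin 0 (Set.Ioo 0 1)) Filter.atTop :=
    hp0.const_mul_atTop ha
  have hA : Filter.Tendsto F (nhdsWithin 0 (Set.Ioo 0 1))
      (nhds (-C * (Real.exp (-(a * b)) * L + Real.exp (a * b) * L))) := by
    refine (((tendsto_gaussPrim_atTop.comp ?_).const_mul _).add
      ((tendsto_gaussPrim_atTop.comp ?_).const_mul _)).const_mul _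
    · simpa [sub_eq_add_neg] using hap.atTop_add hbp.neg
    · exact hap.atTop_add hbp
  -- Only the argument `a p - b / p` changes its limit, from `+∞` at `0` to `-∞` at `1`, so the
  -- increment of `F` is `2 C L exp (-(a b))`. For `b = 0` both arguments tend to `0` instead, but
  -- the stated limit is then `0` as well.
  have hB : Filter.Tendsto F (nhdsWithin 1 (Set.Ioo 0 1))
      (nhds (-C * (Real.exp (-(a * b)) * (-L) + Real.exp (a * b) * L))) := by
    have hap1 : Filter.Tendsto (fun s => a * p s) (nhdsWithin 1 (Set.Ioo 0 1)) (nhds 0) := by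
      simpa using (hp1.mono_right nhdsWithin_le_nhds).const_mul a
    rcases hb.eq_or_lt with rfl | hb
    · have h0 : gaussPrim 0 = 0 := by simp [gaussPrim]
      have h1 : Filter.Tendsto (fun s => gaussPrim (a * p s)) (nhdsWithin 1 (Set.Ioo 0 1))
          (nhds 0) := by
        have := (hasDerivAt_gaussPrim 0).continuousAt.tendsto.comp hap1
        rwa [h0] at this
      have h2 := ((h1.const_mul (Real.exp (-(a * 0)))).add
        (h1.const_mul (Real.exp (a * 0)))).const_mul (-C)
      simp only [hF]
      simp only [zero_div, sub_zero, add_zero]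
      convert h2 using 2
      simp
    · have hbp1 : Filter.Tendsto (fun s => b / p s) (nhdsWithin 1 (Set.Ioo 0 1))
          Filter.atTop := by
        simp only [div_eq_mul_inv]
        exact (Filter.Tendsto.inv_tendsto_nhdsGT_zero hp1).const_mul_atTop hb
      refine (((tendsto_gaussPrim_atBot.comp ?_).const_mul _).add
        ((tendsto_gaussPrim_atTop.comp ?_).const_mul _)).const_mul _
      · simp only [sub_eq_add_neg]
        exact hap1.add_atBot (Filter.tendsto_neg_atTop_atBot.comp hbp1)
      · exact hap1.add_atTop hbp1
  refine (setLIntegral_Ioo_le_of_hasDerivAt one_pos hderiv hcont hnn hA hB).trans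
    (ENNReal.ofReal_le_ofReal (le_of_eq ?_))
  have e1 : Real.exp (-(a + b) ^ 2 / 2) =
      Real.exp (-(a ^ 2 + b ^ 2) / 2) * Real.exp (-(a * b)) := by
    rw [← Real.exp_add]; congr 1; ring
  rw [e1, hC, hL]
  ring

end

/-! ### Overlap of two Gaussian densities -/

noncomputable section

namespace BPS
variable {d : ℕ}

/-- The density of the standard Gaussian measure. -/
def gaussDensity (w : EuclideanSpace ℝ (Fin d)) : ℝ :=
  ((2 * Real.pi) ^ ((d : ℝ) / 2))⁻¹ * Real.exp (-‖w‖ ^ 2 / 2)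

theorem gaussDensity_pos (w : EuclideanSpace ℝ (Fin d)) : 0 < gaussDensity w := by
  unfold gaussDensity; positivity

@[fun_prop]
theorem continuous_gaussDensity : Continuous (gaussDensity (d := d)) := by
  unfold gaussDensity; fun_prop

theorem integral_exp_neg_norm_sq :
    ∫ w : EuclideanSpace ℝ (Fin d), Real.exp (-‖w‖ ^ 2 / 2) = (2 * Real.pi) ^ ((d : ℝ) / 2) := by
  have h := GaussianFourier.integral_rexp_neg_mul_sq_norm (V := EuclideanSpace ℝ (Fin d))
    (b := 1 / 2) (by norm_num)
  rw [finrank_euclideanSpace_fin, show Real.pi / (1 / 2) = 2 * Real.pi by ring] at h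
  rw [← h]
  congr 1; funext w; congr 1; ring

theorem integral_gaussDensity :
    ∫ w : EuclideanSpace ℝ (Fin d), gaussDensity w = 1 := by
  unfold gaussDensity
  rw [integral_const_mul, integral_exp_neg_norm_sq, inv_mul_cancel₀ (by positivity)]

theorem integrable_gaussDensity : Integrable (gaussDensity (d := d)) :=
  Integrable.of_integral_ne_zero (by rw [integral_gaussDensity]; norm_num)

/-- Both measures are finite with characteristic function `exp (-‖t‖² / 2)`. -/
theorem stdGaussian_eq_withDensity :
    stdGaussian (EuclideanSpace ℝ (Fin d)) =
      volume.withDensity fun w => ENNReal.ofReal (gaussDensity w) := by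
  have hfin : IsFiniteMeasure ((volume : Measure (EuclideanSpace ℝ (Fin d))).withDensity
      fun w => ENNReal.ofReal (gaussDensity w)) :=
    isFiniteMeasure_withDensity_ofReal integrable_gaussDensity.2
  refine Measure.ext_of_charFun ?_
  funext t
  rw [charFun_stdGaussian, charFun_apply, integral_withDensity_eq_integral_toReal_smul
    (by fun_prop) (by simp)]
  have h := GaussianFourier.integral_cexp_neg_mul_sq_norm_add (V := EuclideanSpace ℝ (Fin d))
    (b := 1 / 2) (by norm_num) Complex.I t
  have h2 : ∀ w : EuclideanSpace ℝ (Fin d), (ENNReal.ofReal (gaussDensity w)).toReal •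
      Complex.exp (⟪w, t⟫ * Complex.I) = (((2 * Real.pi) ^ ((d : ℝ) / 2))⁻¹ : ℝ) *
        Complex.exp (-(1 / 2) * ‖w‖ ^ 2 + Complex.I * ⟪t, w⟫) := by
    intro w
    rw [ENNReal.toReal_ofReal (gaussDensity_pos w).le, gaussDensity, Complex.real_smul,
      Complex.ofReal_mul, Complex.ofReal_exp, mul_assoc, ← Complex.exp_add, real_inner_comm]
    congr 2; push_cast; ring
  simp_rw [h2]
  rw [integral_const_mul, h, finrank_euclideanSpace_fin, ← mul_assoc]
  have h3 : (Real.pi / (1 / 2) : ℂ) ^ ((d : ℂ) / 2) =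
      (((2 * Real.pi) ^ ((d : ℝ) / 2) : ℝ) : ℂ) := by
    rw [Complex.ofReal_cpow (by positivity)]
    push_cast
    congr 1; ring
  rw [h3, ← Complex.ofReal_mul, inv_mul_cancel₀ (by positivity), Complex.ofReal_one, one_mul,
    Complex.I_sq]
  congr 1; ring

/-- The overlap on the ball of radius `M` of two standard Gaussian densities whose centres are at
distance `r`, and have the origin as midpoint. -/
def gaussOverlap (d : ℕ) [NeZero d] (r M : ℝ) : ℝ≥0∞ :=
  ∫⁻ v in Metric.closedBall (0 : EuclideanSpace ℝ (Fin d)) M,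
    ENNReal.ofReal (((2 * Real.pi) ^ ((d : ℝ) / 2))⁻¹ *
      Real.exp (-(‖v‖ ^ 2 + r * |v 0| + r ^ 2 / 4) / 2))

/-- Used to replace the actual distance between the centres by its upper bound, and to supply
monotonicity for the association inequality. -/
theorem gaussOverlap_antitoneOn [NeZero d] (M : ℝ) :
    AntitoneOn (fun r => gaussOverlap d r M) (Set.Ici 0) := by
  intro r hr r' _ hrr'
  refine lintegral_mono fun v => ENNReal.ofReal_le_ofReal ?_
  have hr0 : 0 ≤ r := hr
  have : r ^ 2 ≤ r' ^ 2 := by gcongr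
  have h2 : r * |v 0| ≤ r' * |v 0| := by gcongr
  gcongr

/-- The two exponents differ only in the sign of `⟪m, h⟫`, and the smaller density takes the
unfavourable sign. -/
theorem min_gaussDensity (h m : EuclideanSpace ℝ (Fin d)) :
    min (gaussDensity (m + h)) (gaussDensity (m - h)) =
      ((2 * Real.pi) ^ ((d : ℝ) / 2))⁻¹ *
        Real.exp (-(‖m‖ ^ 2 + 2 * |⟪m, h⟫| + ‖h‖ ^ 2) / 2) := by
  unfold gaussDensity
  rw [← mul_min_of_nonneg _ _ (by positivity), norm_add_sq_real, norm_sub_sq_real,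
    ← Real.exp_monotone.map_min]
  congr 2
  rcases le_total 0 ⟪m, h⟫ with h0 | h0
  · rw [abs_of_nonneg h0, min_eq_left (by linarith)]
  · rw [abs_of_nonpos h0, min_eq_right (by linarith)]; ring

theorem exists_isometry_single [NeZero d] (h : EuclideanSpace ℝ (Fin d)) :
    ∃ e : EuclideanSpace ℝ (Fin d) ≃ₗᵢ[ℝ] EuclideanSpace ℝ (Fin d),
      e (EuclideanSpace.single 0 ‖h‖) = h := by
  have hn : ‖EuclideanSpace.single (0 : Fin d) ‖h‖‖ = ‖h‖ := by simp
  exact ⟨Submodule.reflection (ℝ ∙ (EuclideanSpace.single (0 : Fin d) ‖h‖ - h))ᗮ,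
    Submodule.reflection_sub hn⟩

/-- Rotation invariance of the overlap. -/
theorem lintegral_min_gaussDensity [NeZero d] (h : EuclideanSpace ℝ (Fin d)) (M : ℝ) :
    ∫⁻ m in Metric.closedBall (0 : EuclideanSpace ℝ (Fin d)) M,
      ENNReal.ofReal (min (gaussDensity (m + h)) (gaussDensity (m - h))) =
      gaussOverlap d (2 * ‖h‖) M := by
  obtain ⟨e, he⟩ := exists_isometry_single h
  have hmp := e.measurePreserving
  have hpre : e ⁻¹' Metric.closedBall 0 M = Metric.closedBall 0 M := by
    ext x; simp
  have hmp' := hmp.restrict_preimage (Metric.isClosed_closedBall (x := (0 : EuclideanSpace ℝ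
    (Fin d))) (ε := M)).measurableSet
  rw [hpre] at hmp'
  rw [gaussOverlap, ← hmp'.lintegral_comp (by fun_prop)]
  refine lintegral_congr fun m => ?_
  rw [min_gaussDensity]
  congr 4
  have h1 : ⟪e m, h⟫ = ‖h‖ * m 0 := by
    conv_lhs => rw [← he]
    rw [LinearIsometryEquiv.inner_map_map, EuclideanSpace.inner_single_right]
    simp
  rw [h1, abs_mul, abs_norm, LinearIsometryEquiv.norm_map]
  ring

end BPS
end

/-! ### Comparison of `alphaTilde` with the overlap -/

noncomputable section

namespace BPS
variable {d : ℕ}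

/-- Multiplication of the first coordinate by `c`. -/
def scaleFirst [NeZero d] (c : ℝ) (w : EuclideanSpace ℝ (Fin d)) : EuclideanSpace ℝ (Fin d) :=
  WithLp.toLp 2 fun i => (Function.update 1 0 c : Fin d → ℝ) i * w i

theorem scaleFirst_zero [NeZero d] (c : ℝ) (w : EuclideanSpace ℝ (Fin d)) :
    scaleFirst c w 0 = c * w 0 := by
  simp [scaleFirst]

theorem scaleFirst_of_ne [NeZero d] (c : ℝ) (w : EuclideanSpace ℝ (Fin d)) {i : Fin d}
    (hi : i ≠ 0) : scaleFirst c w i = w i := by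
  simp [scaleFirst, Function.update_of_ne hi]

theorem norm_sq_eq_add_erase [NeZero d] (w : EuclideanSpace ℝ (Fin d)) :
    ‖w‖ ^ 2 = w 0 ^ 2 + ∑ i ∈ Finset.univ.erase 0, w i ^ 2 := by
  rw [EuclideanSpace.real_norm_sq_eq, Finset.add_sum_erase _ (fun i => w i ^ 2) (Finset.mem_univ _)]

theorem norm_sq_scaleFirst [NeZero d] (c : ℝ) (w : EuclideanSpace ℝ (Fin d)) :
    ‖scaleFirst c w‖ ^ 2 = c ^ 2 * w 0 ^ 2 + ∑ i ∈ Finset.univ.erase 0, w i ^ 2 := by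
  rw [norm_sq_eq_add_erase, scaleFirst_zero, mul_pow]
  congr 1
  refine Finset.sum_congr rfl fun i hi => ?_
  rw [scaleFirst_of_ne c w (Finset.ne_of_mem_erase hi)]

theorem lintegral_scaleFirst [NeZero d] {c : ℝ} (hc : 0 < c)
    (F : EuclideanSpace ℝ (Fin d) → ℝ≥0∞) (hF : Measurable F) :
    ∫⁻ w, F (scaleFirst c w) = ENNReal.ofReal c⁻¹ * ∫⁻ v, F v := by
  have hv := PiLp.volume_preserving_toLp (Fin d)
  set D : Fin d → ℝ := Function.update 1 0 c with hD
  have hdet : (Matrix.diagonal D).det = c := by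
    rw [Matrix.det_diagonal, hD, Finset.prod_update_of_mem (Finset.mem_univ _)]
    simp
  have hmap := Real.smul_map_diagonal_volume_pi (D := D) (by rw [hdet]; exact hc.ne')
  rw [hdet, abs_of_pos hc] at hmap
  have hL : Measurable (Matrix.toLin' (Matrix.diagonal D)) :=
    (LinearMap.continuous_of_finiteDimensional _).measurable
  have hF1 : Measurable fun x : Fin d → ℝ => F (WithLp.toLp 2 x) := hF.comp hv.measurable
  have h1 : ∫⁻ v, F v = ENNReal.ofReal c *
      ∫⁻ x : Fin d → ℝ, F (WithLp.toLp 2 (Matrix.toLin' (Matrix.diagonal D) x)) := by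
    rw [← hv.lintegral_comp hF]
    conv_lhs => rw [← hmap]
    rw [lintegral_smul_measure, lintegral_map hF1 hL, smul_eq_mul]
  have hs : Measurable fun w : EuclideanSpace ℝ (Fin d) => scaleFirst c w := by
    unfold scaleFirst; fun_prop
  have hFs : Measurable fun w : EuclideanSpace ℝ (Fin d) => F (scaleFirst c w) := hF.comp hs
  rw [h1, ← mul_assoc, ← ENNReal.ofReal_mul (by positivity), inv_mul_cancel₀ hc.ne',
    ENNReal.ofReal_one, one_mul, ← hv.lintegral_comp hFs]
  refine lintegral_congr fun x => ?_
  congr 1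
  ext i
  simp [scaleFirst, hD, Matrix.mulVec_diagonal]

theorem measurable_indicator_exp_norm [NeZero d] (M : ℝ) :
    Measurable fun q : ℝ × EuclideanSpace ℝ (Fin d) =>
      (Metric.closedBall (0 : EuclideanSpace ℝ (Fin d)) M).indicator
        (fun v => ENNReal.ofReal (Real.exp (-(‖v‖ ^ 2 - v 0 ^ 2 + v 0 ^ 2 / (1 - q.1)) / 2)))
        q.2 := by
  have h : Measurable fun q : ℝ × EuclideanSpace ℝ (Fin d) => ENNReal.ofReal
      (Real.exp (-(‖q.2‖ ^ 2 - q.2 0 ^ 2 + q.2 0 ^ 2 / (1 - q.1)) / 2)) := by fun_prop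
  exact h.indicator (measurable_snd Metric.isClosed_closedBall.measurableSet)

/-- The substitution `v = scaleFirst (√(1 - s)) w` turns the ellipsoid into a ball. The Jacobian and
the new exponent in `v 0` form, up to a constant, the heat kernel at time `1 - s`. -/
theorem lintegral_scaled_ball [NeZero d] (M : ℝ) {s : ℝ} (hs : s ∈ Set.Ioo (0 : ℝ) 1) :
    ∫⁻ w : EuclideanSpace ℝ (Fin d), Set.indicator
      {w : EuclideanSpace ℝ (Fin d) |
        Real.sqrt ((1 - s) * w 0 ^ 2 + ∑ i ∈ Finset.univ.erase 0, w i ^ 2) ≤ M}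
      (fun w => ENNReal.ofReal (Real.exp (-‖w‖ ^ 2 / 2))) w =
    ENNReal.ofReal (Real.sqrt (1 - s))⁻¹ *
      ∫⁻ v, (Metric.closedBall (0 : EuclideanSpace ℝ (Fin d)) M).indicator
        (fun v => ENNReal.ofReal (Real.exp (-(‖v‖ ^ 2 - v 0 ^ 2 + v 0 ^ 2 / (1 - s)) / 2))) v := by
  have hs1 : 0 < 1 - s := by linarith [hs.2]
  have hc : 0 < Real.sqrt (1 - s) := Real.sqrt_pos.2 hs1
  have hsq : Real.sqrt (1 - s) ^ 2 = 1 - s := Real.sq_sqrt hs1.le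
  have hm : Measurable ((Metric.closedBall (0 : EuclideanSpace ℝ (Fin d)) M).indicator
      (fun v => ENNReal.ofReal (Real.exp (-(‖v‖ ^ 2 - v 0 ^ 2 + v 0 ^ 2 / (1 - s)) / 2)))) :=
    Measurable.indicator (by fun_prop) Metric.isClosed_closedBall.measurableSet
  rw [← lintegral_scaleFirst hc _ hm]
  refine lintegral_congr fun w => ?_
  have hn := norm_sq_scaleFirst (Real.sqrt (1 - s)) w
  rw [hsq] at hn
  have hmem : (scaleFirst (Real.sqrt (1 - s)) w ∈ Metric.closedBall 0 M) ↔
      w ∈ {w : EuclideanSpace ℝ (Fin d) |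
        Real.sqrt ((1 - s) * w 0 ^ 2 + ∑ i ∈ Finset.univ.erase 0, w i ^ 2) ≤ M} := by
    rw [mem_closedBall_zero_iff, Set.mem_ofPred_eq, ← hn, Real.sqrt_sq (norm_nonneg _)]
  by_cases h : w ∈ {w : EuclideanSpace ℝ (Fin d) |
        Real.sqrt ((1 - s) * w 0 ^ 2 + ∑ i ∈ Finset.univ.erase 0, w i ^ 2) ≤ M}
  · rw [Set.indicator_of_mem h, Set.indicator_of_mem (hmem.2 h), hn, scaleFirst_zero, mul_pow,
      hsq, norm_sq_eq_add_erase]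
    congr 3
    field_simp
    ring
  · rw [Set.indicator_of_notMem h, Set.indicator_of_notMem (fun h' => h (hmem.1 h'))]

/-- For fixed `v` the integral over `s` convolves the passage density at level `r / 2` with the heat
kernel at `|v 0|`. The result is a multiple of `exp (-(r / 2 + |v 0|)² / 2)`, which with the other
coordinates is the integrand of the overlap. -/
theorem alphaTilde_le_gaussOverlap [NeZero d] {r : ℝ} (hr : 0 ≤ r) (M : ℝ) :
    alphaTilde d r M ≤ gaussOverlap d r M := by
  -- At `r = 0` the prefactor is `0`, and `0 * ∞ = 0` makes the left side vanish.
  rcases hr.eq_or_lt with rfl | hr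
  · simp [alphaTilde]
  have hπ : 0 < 2 * Real.pi := by positivity
  set c : ℝ := r / (2 * (2 * Real.pi) ^ (((d : ℝ) + 1) / 2)) with hc
  have hc0 : 0 ≤ c := by positivity
  set B := Metric.closedBall (0 : EuclideanSpace ℝ (Fin d)) M with hB
  set G : ℝ → EuclideanSpace ℝ (Fin d) → ℝ≥0∞ := fun s => B.indicator
    (fun v => ENNReal.ofReal (Real.exp (-(‖v‖ ^ 2 - v 0 ^ 2 + v 0 ^ 2 / (1 - s)) / 2))) with hG
  have hGm : Measurable fun q : ℝ × EuclideanSpace ℝ (Fin d) => G q.1 q.2 :=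
    measurable_indicator_exp_norm M
  have hGs : ∀ s, Measurable (G s) := fun s =>
    Measurable.indicator (by fun_prop) Metric.isClosed_closedBall.measurableSet
  set H : ℝ → ℝ≥0∞ := fun s => ENNReal.ofReal (s ^ (-(3 / 2) : ℝ) * Real.exp (-r ^ 2 / (8 * s))) *
    ENNReal.ofReal (Real.sqrt (1 - s))⁻¹ with hH
  have hHm : Measurable H := by
    have : Measurable fun s : ℝ => s ^ (-(3 / 2) : ℝ) := measurable_id.pow_const _
    fun_prop
  have e1 : alphaTilde d r M = ENNReal.ofReal c *
      ∫⁻ v, ∫⁻ s in Set.Ioo (0 : ℝ) 1, H s * G s v := by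
    rw [alphaTilde, lintegral_lintegral_swap]
    swap
    · exact ((hHm.comp measurable_snd).mul (hGm.comp measurable_swap)).aemeasurable
    congr 1
    rw [setLIntegral_congr Ioo_ae_eq_Ioc.symm]
    refine setLIntegral_congr_fun measurableSet_Ioo fun s hs => ?_
    simp only
    rw [lintegral_scaled_ball M hs, ← mul_assoc]
    exact (lintegral_const_mul _ (hGs s)).symm
  rw [e1, gaussOverlap, ← lintegral_indicator Metric.isClosed_closedBall.measurableSet,
    ← lintegral_const_mul']
  swap
  · exact ENNReal.ofReal_ne_top
  refine lintegral_mono fun v => ?_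
  by_cases hv : v ∈ B
  swap
  · simp [hG, Set.indicator_of_notMem hv]
  rw [Set.indicator_of_mem hv]
  set K : ℝ := Real.exp (-(‖v‖ ^ 2 - v 0 ^ 2) / 2) with hK
  have e2 : ∫⁻ s in Set.Ioo (0 : ℝ) 1, H s * G s v = ENNReal.ofReal K *
      ∫⁻ s in Set.Ioo (0 : ℝ) 1, ENNReal.ofReal (s ^ (-(3 / 2) : ℝ) * (Real.sqrt (1 - s))⁻¹ *
        Real.exp (-(r / 2) ^ 2 / (2 * s) - |v 0| ^ 2 / (2 * (1 - s)))) := by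
    rw [← lintegral_const_mul' _ _ ENNReal.ofReal_ne_top]
    refine setLIntegral_congr_fun measurableSet_Ioo fun s hs => ?_
    have hs0 : 0 ≤ s := hs.1.le
    have hs1 : 0 < 1 - s := by linarith [hs.2]
    have := Real.rpow_nonneg hs0 (-(3 / 2) : ℝ)
    have hs0' : s ≠ 0 := hs.1.ne'
    simp only [hH, hG, Set.indicator_of_mem hv]
    rw [← ENNReal.ofReal_mul (by positivity), ← ENNReal.ofReal_mul (by positivity),
      ← ENNReal.ofReal_mul (by positivity)]
    congr 1
    have : Real.exp (-r ^ 2 / (8 * s)) *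
        Real.exp (-(‖v‖ ^ 2 - v 0 ^ 2 + v 0 ^ 2 / (1 - s)) / 2) =
        K * Real.exp (-(r / 2) ^ 2 / (2 * s) - |v 0| ^ 2 / (2 * (1 - s))) := by
      rw [hK, ← Real.exp_add, ← Real.exp_add, sq_abs]
      congr 1
      field_simp
      ring
    linear_combination (s ^ (-(3 / 2) : ℝ) * (Real.sqrt (1 - s))⁻¹) * this
  rw [e2]
  refine (mul_le_mul_right (mul_le_mul_right
    (lintegral_passage_heat_le (half_pos hr) (abs_nonneg (v 0))) _) _).trans (le_of_eq ?_)
  rw [← ENNReal.ofReal_mul (by positivity), ← ENNReal.ofReal_mul (by positivity)]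
  congr 1
  have h1 : K * Real.exp (-(r / 2 + |v 0|) ^ 2 / 2) =
      Real.exp (-(‖v‖ ^ 2 + r * |v 0| + r ^ 2 / 4) / 2) := by
    rw [hK, ← Real.exp_add]
    congr 1
    linear_combination (-(1 / 2) : ℝ) * (sq_abs (v 0))
  have h2 : c * (Real.sqrt (2 * Real.pi) / (r / 2)) = ((2 * Real.pi) ^ ((d : ℝ) / 2))⁻¹ := by
    rw [hc, add_div, Real.rpow_add hπ, Real.sqrt_eq_rpow]
    have := Real.rpow_pos_of_pos hπ (1 / 2)
    have := Real.rpow_pos_of_pos hπ ((d : ℝ) / 2)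
    field_simp
  rw [← h1, ← h2]
  ring

end BPS
end

/-! ### Bounce times and single steps -/

noncomputable section

namespace BPS
variable {d : ℕ}

/-- The velocity and position space. -/
abbrev Vec (d : ℕ) := EuclideanSpace ℝ (Fin d)

/-- The two clocks and the proposed velocity which drive one step. -/
abbrev Mark (d : ℕ) := ℝ × ℝ × Vec d

theorem continuous_gradient {U : Vec d → ℝ} (hU : ContDiff ℝ 2 U) : Continuous (∇ U) := by
  have h : Continuous (fderiv ℝ U) := hU.continuous_fderiv (by norm_num)
  exact (InnerProductSpace.toDual ℝ (Vec d)).symm.continuous.comp h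

/-- The integrated bounce rate along a straight line. -/
def bounceIntegral (U : Vec d → ℝ) (x y : Vec d) (t : ℝ) : ℝ :=
  ∫ s in (0 : ℝ)..t, max ⟪y, ∇ U (x + s • y)⟫ 0

theorem continuous_bounceIntegral {U : Vec d → ℝ} (hU : Continuous (∇ U)) :
    Continuous fun p : (Vec d × Vec d) × ℝ => bounceIntegral U p.1.1 p.1.2 p.2 := by
  refine intervalIntegral.continuous_parametric_intervalIntegral_of_continuous
    (f := fun (p : (Vec d × Vec d) × ℝ) (s : ℝ) => max ⟪p.1.2, ∇ U (p.1.1 + s • p.1.2)⟫ 0)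
    ?_ continuous_snd
  simp only [Function.uncurry_def]
  fun_prop

theorem intervalIntegrable_bounceRate {U : Vec d → ℝ} (hU : Continuous (∇ U)) (x y : Vec d)
    (a b : ℝ) :
    IntervalIntegrable (fun s : ℝ => max ⟪y, ∇ U (x + s • y)⟫ 0) volume a b :=
  Continuous.intervalIntegrable (by fun_prop) _ _

theorem monotone_bounceIntegral {U : Vec d → ℝ} (hU : Continuous (∇ U)) (x y : Vec d) :
    Monotone (bounceIntegral U x y) := by
  intro a b hab
  have h := intervalIntegral.integral_interval_sub_left
    (intervalIntegrable_bounceRate hU x y 0 b) (intervalIntegrable_bounceRate hU x y 0 a)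
  have h0 : 0 ≤ ∫ s in a..b, max ⟪y, ∇ U (x + s • y)⟫ 0 :=
    intervalIntegral.integral_nonneg hab fun s _ => le_max_right _ _
  unfold bounceIntegral
  linarith

/-- The integrated rate is monotone in time, so it suffices to test the infimum at rational times.
-/
theorem measurable_bounceTime {U : Vec d → ℝ} (hU : Continuous (∇ U)) :
    Measurable fun p : (Vec d × Vec d) × ℝ => bounceTime U p.1.1 p.1.2 p.2 := by
  refine measurable_of_Iio fun c => ?_
  have h : (fun p : (Vec d × Vec d) × ℝ => bounceTime U p.1.1 p.1.2 p.2) ⁻¹' Set.Iio c =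
      ⋃ q : ℚ, {p | (Real.toNNReal q : ℝ≥0∞) < c ∧
        p.2 ≤ bounceIntegral U p.1.1 p.1.2 (Real.toNNReal q)} := by
    ext p
    simp only [Set.mem_preimage, Set.mem_Iio, Set.mem_iUnion, Set.mem_ofPred_eq]
    constructor
    · intro hp
      unfold bounceTime at hp
      simp only [iInf_lt_iff] at hp
      obtain ⟨t, ht, htc⟩ := hp
      obtain ⟨q, -, htq, hqc⟩ := ENNReal.lt_iff_exists_rat_btwn.1 htc
      refine ⟨q, hqc, (show p.2 ≤ bounceIntegral U p.1.1 p.1.2 t from ht).trans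
        (monotone_bounceIntegral hU _ _ ?_)⟩
      exact_mod_cast htq.le
    · rintro ⟨q, hqc, hq⟩
      exact (iInf₂_le (Real.toNNReal q) hq).trans_lt hqc
  rw [h]
  refine MeasurableSet.iUnion fun q => ?_
  refine (MeasurableSet.const _).inter (measurableSet_le measurable_snd ?_)
  exact ((continuous_bounceIntegral hU).comp
    (by fun_prop : Continuous fun p : (Vec d × Vec d) × ℝ => (p.1, ((Real.toNNReal q : ℝ≥0) : ℝ)))
    ).measurable

theorem le_bounceTime {U : Vec d → ℝ} {x y : Vec d} {f r : ℝ}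
    (h : ∀ t, 0 ≤ t → t < r → bounceIntegral U x y t < f) :
    ENNReal.ofReal r ≤ bounceTime U x y f := by
  refine le_iInf₂ fun t ht => ?_
  by_contra hlt
  have hlt' : (t : ℝ) < r := by
    rw [not_le] at hlt
    by_contra hc
    exact absurd (ENNReal.ofReal_le_of_le_toReal (by simpa using hc)) (not_le.2 hlt)
  exact absurd (h t t.2 hlt') (not_lt.2 ht)

theorem measurable_unitVec : Measurable (unitVec (d := d)) := by
  unfold unitVec
  exact Measurable.ite (measurableSet_singleton 0) measurable_const (by fun_prop)

theorem norm_unitVec {z : Vec d} (hz : z ≠ 0) : ‖unitVec z‖ = 1 := by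
  rw [unitVec, if_neg hz, norm_smul, norm_inv, norm_norm, inv_mul_cancel₀ (norm_ne_zero_iff.2 hz)]

theorem norm_bounce (U : Vec d → ℝ) (x y : Vec d) : ‖bounce U x y‖ = ‖y‖ := by
  unfold bounce
  by_cases h : ∇ U x = 0
  · simp [h, unitVec]
  have hn := norm_unitVec h
  rw [← sq_eq_sq₀ (norm_nonneg _) (norm_nonneg _), norm_sub_sq_real, norm_smul, hn,
    real_inner_smul_right, Real.norm_eq_abs, mul_one, sq_abs]
  ring

theorem measurable_bounce {U : Vec d → ℝ} (hU : Continuous (∇ U)) :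
    Measurable fun p : Vec d × Vec d => bounce U p.1 p.2 := by
  unfold bounce
  have h : Measurable fun p : Vec d × Vec d => unitVec (∇ U p.1) :=
    measurable_unitVec.comp (hU.measurable.comp measurable_fst)
  fun_prop

/-- The duration of a step. -/
def stepTime (U : Vec d → ℝ) (lam : ℝ) (z : Vec d × Vec d) (w : Mark d) : ℝ :=
  (min (refreshTime lam w.1) (bounceTime U z.1 z.2 w.2.1)).toReal

/-- The marks for which a step ends with a refreshment. -/
def refreshSet (U : Vec d → ℝ) (lam : ℝ) : Set ((Vec d × Vec d) × Mark d) :=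
  {p | refreshTime lam p.2.1 ≤ bounceTime U p.1.1 p.1.2 p.2.2.1}

open Classical in
theorem step_eq (U : Vec d → ℝ) (lam : ℝ) (q : ℝ × Vec d × Vec d) (w : Mark d) :
    step U lam q w = (q.1 + stepTime U lam q.2 w, q.2.1 + stepTime U lam q.2 w • q.2.2,
      if (q.2, w) ∈ refreshSet U lam then w.2.2
      else bounce U (q.2.1 + stepTime U lam q.2 w • q.2.2) q.2.2) := by
  simp only [step, stepTime, refreshSet, Set.mem_ofPred_eq]
  congr

theorem stepTime_nonneg (U : Vec d → ℝ) (lam : ℝ) (z : Vec d × Vec d) (w : Mark d) :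
    0 ≤ stepTime U lam z w := ENNReal.toReal_nonneg

theorem stepTime_of_mem {U : Vec d → ℝ} {lam : ℝ} {z : Vec d × Vec d} {w : Mark d}
    (h : (z, w) ∈ refreshSet U lam) (hw : 0 ≤ w.1 / lam) : stepTime U lam z w = w.1 / lam := by
  have h' : refreshTime lam w.1 ≤ bounceTime U z.1 z.2 w.2.1 := h
  rw [stepTime, min_eq_left h', refreshTime, ENNReal.toReal_ofReal hw]

theorem measurable_refreshTime (lam : ℝ) : Measurable (refreshTime lam) := by
  unfold refreshTime; fun_prop

end BPS
end

/-! ### Measurability of the process and its restart after one step -/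

noncomputable section

namespace BPS
variable {d : ℕ}

theorem measurable_bounceTime_mark {U : Vec d → ℝ} (hU : Continuous (∇ U)) :
    Measurable fun p : (Vec d × Vec d) × Mark d => bounceTime U p.1.1 p.1.2 p.2.2.1 := by
  have h : Measurable fun p : (Vec d × Vec d) × Mark d => (p.1, p.2.2.1) := by fun_prop
  exact ((measurable_bounceTime hU).comp h :)

theorem measurable_refreshTime_mark (lam : ℝ) :
    Measurable fun p : (Vec d × Vec d) × Mark d => refreshTime lam p.2.1 :=
  (measurable_refreshTime lam).comp (by fun_prop)

theorem measurable_stepTime {U : Vec d → ℝ} (hU : Continuous (∇ U)) (lam : ℝ) :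
    Measurable fun p : (Vec d × Vec d) × Mark d => stepTime U lam p.1 p.2 :=
  ((measurable_refreshTime_mark lam).min (measurable_bounceTime_mark hU)).ennreal_toReal

theorem measurableSet_refreshSet {U : Vec d → ℝ} (hU : Continuous (∇ U)) (lam : ℝ) :
    MeasurableSet (refreshSet U lam) :=
  measurableSet_le (measurable_refreshTime_mark lam) (measurable_bounceTime_mark hU)

theorem measurable_step {U : Vec d → ℝ} (hU : Continuous (∇ U)) (lam : ℝ) :
    Measurable fun p : (ℝ × Vec d × Vec d) × Mark d => step U lam p.1 p.2 := by
  classical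
  simp only [step_eq]
  have hr : Measurable fun p : (ℝ × Vec d × Vec d) × Mark d => ((p.1.2, p.2) :
      (Vec d × Vec d) × Mark d) := by fun_prop
  have hT : Measurable fun p : (ℝ × Vec d × Vec d) × Mark d => stepTime U lam p.1.2 p.2 :=
    ((measurable_stepTime hU lam).comp hr :)
  have hx : Measurable fun p : (ℝ × Vec d × Vec d) × Mark d =>
      p.1.2.1 + stepTime U lam p.1.2 p.2 • p.1.2.2 := by fun_prop
  have hb : Measurable fun p : (ℝ × Vec d × Vec d) × Mark d =>
      bounce U (p.1.2.1 + stepTime U lam p.1.2 p.2 • p.1.2.2) p.1.2.2 :=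
    ((measurable_bounce hU).comp
      (hx.prodMk (by fun_prop : Measurable fun p : (ℝ × Vec d × Vec d) × Mark d => p.1.2.2)) :)
  refine (by fun_prop : Measurable fun p : (ℝ × Vec d × Vec d) × Mark d =>
    p.1.1 + stepTime U lam p.1.2 p.2).prodMk (hx.prodMk ?_)
  exact Measurable.ite (hr (measurableSet_refreshSet hU lam)) (by fun_prop) hb

theorem measurable_skeleton {U : Vec d → ℝ} (hU : Continuous (∇ U)) (lam : ℝ) (n : ℕ) :
    Measurable fun p : (Vec d × Vec d) × (ℕ → Mark d) => skeleton U lam p.1 p.2 n := by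
  induction n with
  | zero => exact measurable_const.prodMk measurable_fst
  | succ n ih =>
    exact ((measurable_step hU lam).comp
      (ih.prodMk ((measurable_pi_apply n).comp measurable_snd)) :)

theorem measurableSet_alive {U : Vec d → ℝ} (hU : Continuous (∇ U)) (lam : ℝ) :
    MeasurableSet {p : ℝ × (Vec d × Vec d) × (ℕ → Mark d) | p.2.2 ∈ alive U lam p.1 p.2.1} := by
  have h : {p : ℝ × (Vec d × Vec d) × (ℕ → Mark d) | p.2.2 ∈ alive U lam p.1 p.2.1} =
      ⋃ n, {p | p.1 < (skeleton U lam p.2.1 p.2.2 n).1} := by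
    ext p; simp [alive]
  rw [h]
  exact MeasurableSet.iUnion fun n => measurableSet_lt measurable_fst
    (measurable_fst.comp ((measurable_skeleton hU lam n).comp measurable_snd))

theorem measurable_sInf_nat {α : Type*} [MeasurableSpace α] {s : ℕ → Set α}
    (hs : ∀ n, MeasurableSet (s n)) : Measurable fun a => sInf {n | a ∈ s n} := by
  -- The intersection accounts for the empty index set, whose `sInf` is `0`.
  have h : ∀ k : ℕ, {a | sInf {n | a ∈ s n} ≤ k} = (⋂ n, (s n)ᶜ) ∪ ⋃ n ≤ k, s n := by
    intro k
    ext a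
    simp only [Set.mem_ofPred_eq, Set.mem_union, Set.mem_iInter, Set.mem_compl_iff, Set.mem_iUnion,
      exists_prop]
    constructor
    · intro hk
      by_cases hne : {n | a ∈ s n}.Nonempty
      · exact Or.inr ⟨_, hk, Nat.sInf_mem hne⟩
      · exact Or.inl fun n hn => hne ⟨n, hn⟩
    · rintro (h0 | ⟨n, hnk, hn⟩)
      · have : {n | a ∈ s n} = ∅ := Set.eq_empty_of_forall_notMem h0
        simp [this]
      · exact (Nat.sInf_le hn).trans hnk
  refine measurable_of_Iic fun k => ?_
  change MeasurableSet {a | sInf {n | a ∈ s n} ≤ k}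
  rw [h]
  exact (MeasurableSet.iInter fun n => (hs n).compl).union
    (MeasurableSet.iUnion fun n => MeasurableSet.iUnion fun _ => hs n)

/-- Joint measurability in time, starting point and marks is needed because the process is restarted
with a random remaining time from a random state. -/
theorem measurable_state {U : Vec d → ℝ} (hU : Continuous (∇ U)) (lam : ℝ) :
    Measurable fun p : ℝ × (Vec d × Vec d) × (ℕ → Mark d) => state U lam p.1 p.2.1 p.2.2 := by
  have hsk : ∀ n, Measurable fun p : ℝ × (Vec d × Vec d) × (ℕ → Mark d) =>
      skeleton U lam p.2.1 p.2.2 n := fun n => (measurable_skeleton hU lam n).comp measurable_snd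
  have hN : Measurable fun p : ℝ × (Vec d × Vec d) × (ℕ → Mark d) =>
      sInf {n : ℕ | p.1 < (skeleton U lam p.2.1 p.2.2 (n + 1)).1} :=
    measurable_sInf_nat (s := fun n => {p : ℝ × (Vec d × Vec d) × (ℕ → Mark d) |
      p.1 < (skeleton U lam p.2.1 p.2.2 (n + 1)).1})
      fun n => measurableSet_lt measurable_fst (measurable_fst.comp (hsk _))
  have hq : Measurable fun p : ℕ × ℝ × (Vec d × Vec d) × (ℕ → Mark d) =>
      skeleton U lam p.2.2.1 p.2.2.2 p.1 := measurable_from_prod_countable_right hsk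
  have hq' : Measurable fun p : ℝ × (Vec d × Vec d) × (ℕ → Mark d) =>
      skeleton U lam p.2.1 p.2.2 (sInf {n : ℕ | p.1 < (skeleton U lam p.2.1 p.2.2 (n + 1)).1}) :=
    (hq.comp (hN.prodMk measurable_id) :)
  exact (by fun_prop : Measurable fun p : ℝ × (Vec d × Vec d) × (ℕ → Mark d) =>
    ((skeleton U lam p.2.1 p.2.2
      (sInf {n : ℕ | p.1 < (skeleton U lam p.2.1 p.2.2 (n + 1)).1})).2.1 +
      (p.1 - (skeleton U lam p.2.1 p.2.2
        (sInf {n : ℕ | p.1 < (skeleton U lam p.2.1 p.2.2 (n + 1)).1})).1) •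
        (skeleton U lam p.2.1 p.2.2
          (sInf {n : ℕ | p.1 < (skeleton U lam p.2.1 p.2.2 (n + 1)).1})).2.2,
      (skeleton U lam p.2.1 p.2.2
        (sInf {n : ℕ | p.1 < (skeleton U lam p.2.1 p.2.2 (n + 1)).1})).2.2))

/-- Prepending a mark to a sequence of marks. -/
def consMark (p : Mark d × (ℕ → Mark d)) : ℕ → Mark d
  | 0 => p.1
  | n + 1 => p.2 n

theorem measurable_consMark : Measurable (consMark (d := d)) := by
  refine measurable_pi_iff.2 fun n => ?_
  cases n with
  | zero => exact measurable_fst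
  | succ n => exact (measurable_pi_apply n).comp measurable_snd

/-- The law of the marks of one step. -/
def markLaw (ν : Measure (Vec d)) : Measure (Mark d) :=
  (expMeasure 1).prod ((expMeasure 1).prod ν)

instance (ν : Measure (Vec d)) [IsProbabilityMeasure ν] : IsProbabilityMeasure (markLaw ν) := by
  unfold markLaw; infer_instance

instance (ν : Measure (Vec d)) [IsProbabilityMeasure ν] : IsProbabilityMeasure (noise ν) :=
  inferInstanceAs (IsProbabilityMeasure (Measure.infinitePi fun _ => markLaw ν))

/-- The probabilistic half of the Markov property at the first step: an independent mark put before
an i.i.d. sequence gives an i.i.d. sequence. It is checked on finite cylinders, with coordinate `0`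
factored out. -/
theorem map_consMark (ν : Measure (Vec d)) [IsProbabilityMeasure ν] :
    ((markLaw ν).prod (noise ν)).map consMark = noise ν := by
  refine Measure.eq_infinitePi (μ := fun _ : ℕ => markLaw ν) fun s t ht => ?_
  classical
  set s' : Finset ℕ := (s.erase 0).image Nat.pred with hs'
  have hmem : ∀ n, n ∈ s' ↔ n + 1 ∈ s := by
    intro n
    simp only [hs', Finset.mem_image, Finset.mem_erase]
    constructor
    · rintro ⟨m, ⟨hm0, hm⟩, rfl⟩
      rwa [Nat.pred_eq_sub_one, Nat.sub_add_cancel (Nat.one_le_iff_ne_zero.2 hm0)]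
    · intro h; exact ⟨n + 1, ⟨Nat.succ_ne_zero _, h⟩, rfl⟩
  have hpre : consMark ⁻¹' (Set.pi s t) =
      (if 0 ∈ s then t 0 else Set.univ) ×ˢ Set.pi s' (fun n => t (n + 1)) := by
    ext ⟨w, ω⟩
    simp only [Set.mem_preimage, Set.mem_pi, Set.mem_prod, Finset.mem_coe]
    constructor
    · intro h
      refine ⟨?_, fun n hn => h (n + 1) ((hmem n).1 hn)⟩
      split_ifs with h0
      · exact h 0 h0
      · trivial
    · rintro ⟨h0, h1⟩ n hn
      cases n with
      | zero => rwa [if_pos hn] at h0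
      | succ n => exact h1 n ((hmem n).2 hn)
  have hms : MeasurableSet (Set.pi (s : Set ℕ) t) :=
    MeasurableSet.pi s.countable_toSet fun i _ => ht i
  rw [Measure.map_apply measurable_consMark hms, hpre, Measure.prod_prod]
  have h1 : noise ν (Set.pi s' (fun n => t (n + 1))) = ∏ n ∈ s', markLaw ν (t (n + 1)) :=
    Measure.infinitePi_pi (μ := fun _ : ℕ => markLaw ν) fun i _ => ht _
  have h2 : ∏ n ∈ s', markLaw ν (t (n + 1)) = ∏ n ∈ s.erase 0, markLaw ν (t n) := by
    rw [hs', Finset.prod_image]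
    · refine Finset.prod_congr rfl fun n hn => ?_
      rw [Nat.pred_eq_sub_one,
        Nat.sub_add_cancel (Nat.one_le_iff_ne_zero.2 (Finset.ne_of_mem_erase hn))]
    · intro a ha b hb hab
      have ha0 := Finset.ne_of_mem_erase (Finset.mem_coe.1 ha)
      have hb0 := Finset.ne_of_mem_erase (Finset.mem_coe.1 hb)
      simp only [Nat.pred_eq_sub_one] at hab
      omega
  rw [h1, h2]
  by_cases h0 : 0 ∈ s
  · rw [if_pos h0, Finset.mul_prod_erase s (fun n => markLaw ν (t n)) h0]
  · rw [if_neg h0, measure_univ, one_mul, Finset.erase_eq_of_notMem h0]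

theorem lintegral_noise (ν : Measure (Vec d)) [IsProbabilityMeasure ν]
    {F : (ℕ → Mark d) → ℝ≥0∞} (hF : Measurable F) :
    ∫⁻ ω, F ω ∂(noise ν) = ∫⁻ w, ∫⁻ ω, F (consMark (w, ω)) ∂(noise ν) ∂(markLaw ν) := by
  conv_lhs => rw [← map_consMark ν]
  rw [lintegral_map hF measurable_consMark]
  exact lintegral_prod _ (hF.comp measurable_consMark).aemeasurable

theorem step_shift (U : Vec d → ℝ) (lam a : ℝ) (q : ℝ × Vec d × Vec d) (w : Mark d) :
    step U lam (a + q.1, q.2) w = (a + (step U lam q w).1, (step U lam q w).2) := by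
  simp [step, add_assoc]

/-- The pathwise half of the Markov property: the recursion sees the clock only through an additive
shift, so after one step the chain restarts from the new state with a delay. -/
theorem skeleton_consMark (U : Vec d → ℝ) (lam : ℝ) (z : Vec d × Vec d) (w : Mark d)
    (ω : ℕ → Mark d) (n : ℕ) :
    skeleton U lam z (consMark (w, ω)) (n + 1) =
      (stepTime U lam z w + (skeleton U lam (step U lam (0, z) w).2 ω n).1,
        (skeleton U lam (step U lam (0, z) w).2 ω n).2) := by
  induction n with
  | zero =>
    simp only [skeleton, consMark, add_zero]
    exact Prod.ext (zero_add _) rfl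
  | succ n ih =>
    rw [skeleton, ih]
    exact step_shift U lam (stepTime U lam z w) _ (ω n)

/-- The process is dead at time `t` if it exploded before. -/
theorem consMark_notMem_alive {U : Vec d → ℝ} {lam t : ℝ} (ht : 0 ≤ t) (z : Vec d × Vec d)
    (w : Mark d) (ω : ℕ → Mark d) :
    consMark (w, ω) ∉ alive U lam t z ↔ stepTime U lam z w ≤ t ∧
      ω ∉ alive U lam (t - stepTime U lam z w) (step U lam (0, z) w).2 := by
  simp only [alive, Set.mem_ofPred_eq, not_exists, not_lt]
  constructor
  · intro h
    have h' : ∀ n, (skeleton U lam (step U lam (0, z) w).2 ω n).1 ≤ t - stepTime U lam z w := by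
      intro n
      have := h (n + 1)
      rw [skeleton_consMark] at this
      simp only at this
      linarith
    have h0 := h' 0
    simp only [skeleton] at h0
    exact ⟨by linarith, h'⟩
  · rintro ⟨-, h'⟩ n
    cases n with
    | zero => exact ht
    | succ n =>
      rw [skeleton_consMark]
      have := h' n
      simp only
      linarith

theorem state_consMark {U : Vec d → ℝ} {lam t : ℝ} {z : Vec d × Vec d} {w : Mark d}
    {ω : ℕ → Mark d} (hT : stepTime U lam z w ≤ t)
    (hω : ω ∈ alive U lam (t - stepTime U lam z w) (step U lam (0, z) w).2) :
    state U lam t z (consMark (w, ω)) =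
      state U lam (t - stepTime U lam z w) (step U lam (0, z) w).2 ω := by
  set T := stepTime U lam z w with hTdef
  set z' := (step U lam (0, z) w).2 with hz'
  set A := {n : ℕ | t < (skeleton U lam z (consMark (w, ω)) (n + 1)).1} with hA
  set B := {n : ℕ | t - T < (skeleton U lam z' ω (n + 1)).1} with hB
  -- Survival makes `sInf B` a true minimum rather than the default `0`. The witness cannot be the
  -- initial time, since `t - T` is nonnegative.
  have hBne : B.Nonempty := by
    obtain ⟨n, hn⟩ := hω
    cases n with
    | zero =>
      simp only [skeleton] at hn
      linarith
    | succ n => exact ⟨n, hn⟩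
  have hAB : ∀ n, n + 1 ∈ A ↔ n ∈ B := by
    intro n
    simp only [hA, hB, Set.mem_ofPred_eq]
    rw [skeleton_consMark]
    simp only
    constructor <;> intro h <;> linarith
  have h0 : 0 ∉ A := by
    simp only [hA, Set.mem_ofPred_eq, not_lt]
    rw [skeleton_consMark]
    simpa [skeleton] using hT
  have hinf : sInf A = sInf B + 1 := by
    have hmem : sInf B + 1 ∈ A := (hAB _).2 (Nat.sInf_mem hBne)
    refine le_antisymm (Nat.sInf_le hmem) ?_
    have hm := Nat.sInf_mem ⟨_, hmem⟩
    obtain ⟨k, hk⟩ : ∃ k, sInf A = k + 1 :=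
      Nat.exists_eq_succ_of_ne_zero fun h => h0 (h ▸ hm)
    rw [hk] at hm ⊢
    exact Nat.succ_le_succ (Nat.sInf_le ((hAB k).1 hm))
  simp only [state]
  change ((skeleton U lam z (consMark (w, ω)) (sInf A)).2.1 + _, _) =
    ((skeleton U lam z' ω (sInf B)).2.1 + (t - T - (skeleton U lam z' ω (sInf B)).1) •
      (skeleton U lam z' ω (sInf B)).2.2, (skeleton U lam z' ω (sInf B)).2.2)
  rw [hinf, skeleton_consMark, ← hz', ← hTdef]
  simp only [sub_sub]

end BPS
end

/-! ### Law of the first refreshment and its renewal equation -/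

noncomputable section

namespace BPS
variable {d : ℕ}

/-- The law after one more step which ends with a bounce. -/
def bouncePart (U : Vec d → ℝ) (lam : ℝ) (ν : Measure (Vec d)) (β : Measure (ℝ × Vec d × Vec d)) :
    Measure (ℝ × Vec d × Vec d) :=
  ((β.prod (markLaw ν)).restrict {p | (p.1.2, p.2) ∉ refreshSet U lam}).map
    fun p => step U lam p.1 p.2

/-- The law of the time and position after one more step which ends with a refreshment. -/
def refreshPart (U : Vec d → ℝ) (lam : ℝ) (ν : Measure (Vec d)) (β : Measure (ℝ × Vec d × Vec d)) :
    Measure (ℝ × Vec d) :=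
  ((β.prod (markLaw ν)).restrict {p | (p.1.2, p.2) ∈ refreshSet U lam}).map
    fun p => ((step U lam p.1 p.2).1, (step U lam p.1 p.2).2.1)

/-- The law of the embedded chain after `n` steps which all end with a bounce. -/
def bounceChain (U : Vec d → ℝ) (lam : ℝ) (ν : Measure (Vec d)) (z : Vec d × Vec d) :
    ℕ → Measure (ℝ × Vec d × Vec d)
  | 0 => Measure.dirac (0, z)
  | n + 1 => bouncePart U lam ν (bounceChain U lam ν z n)

/-- The law of the time and position of the first refreshment. -/
def firstRefresh (U : Vec d → ℝ) (lam : ℝ) (ν : Measure (Vec d)) (z : Vec d × Vec d) :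
    Measure (ℝ × Vec d) :=
  Measure.sum fun n => refreshPart U lam ν (bounceChain U lam ν z n)

open Classical in
/-- The expectation, over one step from `q`, of `a` at a refreshment and of `F` at a bounce. -/
def oneStep (U : Vec d → ℝ) (lam : ℝ) (ν : Measure (Vec d)) (a : ℝ × Vec d → ℝ≥0∞)
    (F : ℝ × Vec d × Vec d → ℝ≥0∞) (q : ℝ × Vec d × Vec d) : ℝ≥0∞ :=
  ∫⁻ w, (if (q.2, w) ∈ refreshSet U lam then a ((step U lam q w).1, (step U lam q w).2.1)
    else F (step U lam q w)) ∂(markLaw ν)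

variable {U : Vec d → ℝ} (lam : ℝ) (ν : Measure (Vec d))

theorem measurableSet_refreshSet' (hU : Continuous (∇ U)) (lam : ℝ) :
    MeasurableSet {p : (ℝ × Vec d × Vec d) × Mark d | (p.1.2, p.2) ∈ refreshSet U lam} :=
  (by fun_prop : Measurable fun p : (ℝ × Vec d × Vec d) × Mark d =>
    ((p.1.2, p.2) : (Vec d × Vec d) × Mark d)) (measurableSet_refreshSet hU lam)

theorem measurable_step_fst (hU : Continuous (∇ U)) (lam : ℝ) :
    Measurable fun p : (ℝ × Vec d × Vec d) × Mark d =>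
      ((step U lam p.1 p.2).1, (step U lam p.1 p.2).2.1) :=
  ((measurable_fst.comp (measurable_step hU lam)).prodMk
    (measurable_fst.comp (measurable_snd.comp (measurable_step hU lam))) :)

instance (β : Measure (ℝ × Vec d × Vec d)) [IsFiniteMeasure β] [IsProbabilityMeasure ν] :
    IsFiniteMeasure (bouncePart U lam ν β) := by
  unfold bouncePart; infer_instance

instance (z : Vec d × Vec d) (n : ℕ) [IsProbabilityMeasure ν] :
    IsFiniteMeasure (bounceChain U lam ν z n) := by
  induction n with
  | zero => exact inferInstanceAs (IsFiniteMeasure (Measure.dirac _))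
  | succ n ih => exact inferInstanceAs (IsFiniteMeasure (bouncePart U lam ν _))

theorem measurable_oneStep_integrand (hU : Continuous (∇ U)) {a : ℝ × Vec d → ℝ≥0∞}
    {F : ℝ × Vec d × Vec d → ℝ≥0∞} (ha : Measurable a) (hF : Measurable F)
    [∀ p : (Vec d × Vec d) × Mark d, Decidable (p ∈ refreshSet U lam)] :
    Measurable fun p : (ℝ × Vec d × Vec d) × Mark d =>
      if (p.1.2, p.2) ∈ refreshSet U lam then
        a ((step U lam p.1 p.2).1, (step U lam p.1 p.2).2.1) else F (step U lam p.1 p.2) :=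
  Measurable.ite (measurableSet_refreshSet' hU lam)
    (ha.comp (measurable_step_fst hU lam) :) (hF.comp (measurable_step hU lam) :)

/-- Conservation over one step: what does not refresh is carried on by the bounce part. Iterating it
makes the comparisons below telescope. -/
theorem lintegral_refreshPart_add_bouncePart (hU : Continuous (∇ U)) [IsProbabilityMeasure ν]
    (β : Measure (ℝ × Vec d × Vec d)) [IsFiniteMeasure β] {a : ℝ × Vec d → ℝ≥0∞}
    {F : ℝ × Vec d × Vec d → ℝ≥0∞} (ha : Measurable a) (hF : Measurable F) :
    ∫⁻ p, a p ∂(refreshPart U lam ν β) + ∫⁻ q, F q ∂(bouncePart U lam ν β) =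
      ∫⁻ q, oneStep U lam ν a F q ∂β := by
  classical
  have hm := measurable_oneStep_integrand lam hU ha hF
  unfold oneStep
  rw [lintegral_lintegral hm.aemeasurable, refreshPart, bouncePart,
    lintegral_map ha (measurable_step_fst hU lam), lintegral_map hF (measurable_step hU lam)]
  refine Eq.trans ?_ (lintegral_add_compl _ (measurableSet_refreshSet' hU lam))
  congr 1
  · refine setLIntegral_congr_fun (measurableSet_refreshSet' hU lam) fun p hp => ?_
    exact (if_pos hp).symm
  · refine setLIntegral_congr_fun (measurableSet_refreshSet' hU lam).compl fun p hp => ?_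
    exact (if_neg hp).symm

/-- A supersolution of the renewal equation dominates the expectation at the first
refreshment. -/
theorem lintegral_firstRefresh_le (hU : Continuous (∇ U)) [IsProbabilityMeasure ν]
    {a : ℝ × Vec d → ℝ≥0∞} {F : ℝ × Vec d × Vec d → ℝ≥0∞} (ha : Measurable a)
    (hF : Measurable F) (h : ∀ q, oneStep U lam ν a F q ≤ F q) (z : Vec d × Vec d) :
    ∫⁻ p, a p ∂(firstRefresh U lam ν z) ≤ F (0, z) := by
  have hN : ∀ N : ℕ, ∑ n ∈ Finset.range N, ∫⁻ p, a p ∂(refreshPart U lam ν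
      (bounceChain U lam ν z n)) + ∫⁻ q, F q ∂(bounceChain U lam ν z N) ≤ F (0, z) := by
    intro N
    induction N with
    | zero => simp [bounceChain, lintegral_dirac' _ hF]
    | succ N ih =>
      refine le_trans ?_ ih
      rw [Finset.sum_range_succ, add_assoc]
      gcongr
      change _ + ∫⁻ q, F q ∂(bouncePart U lam ν _) ≤ _
      rw [lintegral_refreshPart_add_bouncePart lam ν hU _ ha hF]
      exact lintegral_mono h
  rw [firstRefresh, lintegral_sum_measure, ENNReal.tsum_eq_iSup_nat]
  exact iSup_le fun N => le_self_add.trans (hN N)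

/-- The counterpart for subsolutions. Here the mass still without refreshment after `N` steps cannot
be dropped; `tendsto_bounceChain_le` removes it later for bounded `F` that vanish after a fixed
time. -/
theorem le_lintegral_firstRefresh_add (hU : Continuous (∇ U)) [IsProbabilityMeasure ν]
    {a : ℝ × Vec d → ℝ≥0∞} {F : ℝ × Vec d × Vec d → ℝ≥0∞} (ha : Measurable a)
    (hF : Measurable F) (h : ∀ q, F q ≤ oneStep U lam ν a F q) (z : Vec d × Vec d) (N : ℕ) :
    F (0, z) ≤ ∫⁻ p, a p ∂(firstRefresh U lam ν z) + ∫⁻ q, F q ∂(bounceChain U lam ν z N) := by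
  have hN : F (0, z) ≤ ∑ n ∈ Finset.range N, ∫⁻ p, a p ∂(refreshPart U lam ν
      (bounceChain U lam ν z n)) + ∫⁻ q, F q ∂(bounceChain U lam ν z N) := by
    induction N with
    | zero => simp [bounceChain, lintegral_dirac' _ hF]
    | succ N ih =>
      refine ih.trans ?_
      rw [Finset.sum_range_succ, add_assoc]
      gcongr
      change _ ≤ _ + ∫⁻ q, F q ∂(bouncePart U lam ν _)
      rw [lintegral_refreshPart_add_bouncePart lam ν hU _ ha hF]
      exact lintegral_mono h
  refine hN.trans ?_
  gcongr
  rw [firstRefresh, lintegral_sum_measure]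
  exact ENNReal.sum_le_tsum _

/-- Between refreshments the speed is constant. -/
def speedBound (z : Vec d × Vec d) : Set (ℝ × Vec d × Vec d) :=
  {q | 0 ≤ q.1 ∧ ‖q.2.2‖ = ‖z.2‖ ∧ ‖q.2.1‖ ≤ ‖z.1‖ + q.1 * ‖z.2‖}

theorem measurableSet_speedBound (z : Vec d × Vec d) : MeasurableSet (speedBound z) :=
  MeasurableSet.inter (s₁ := {q : ℝ × Vec d × Vec d | 0 ≤ q.1})
    (measurableSet_le measurable_const measurable_fst)
    (MeasurableSet.inter (s₁ := {q : ℝ × Vec d × Vec d | ‖q.2.2‖ = ‖z.2‖})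
      (measurableSet_eq_fun (by fun_prop) measurable_const)
      (measurableSet_le (f := fun q : ℝ × Vec d × Vec d => ‖q.2.1‖)
        (g := fun q : ℝ × Vec d × Vec d => ‖z.1‖ + q.1 * ‖z.2‖) (by fun_prop) (by fun_prop)))

/-- Valid also for a step that ends with a refreshment, because the motion precedes the change of
velocity. -/
theorem norm_step_position_le {z : Vec d × Vec d} {q : ℝ × Vec d × Vec d}
    (hq : q ∈ speedBound z) (w : Mark d) :
    0 ≤ (step U lam q w).1 ∧ ‖(step U lam q w).2.1‖ ≤ ‖z.1‖ + (step U lam q w).1 * ‖z.2‖ := by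
  classical
  obtain ⟨h0, h1, h2⟩ := hq
  have hT := stepTime_nonneg U lam q.2 w
  rw [step_eq]
  refine ⟨add_nonneg h0 hT, (norm_add_le _ _).trans ?_⟩
  simp only
  rw [norm_smul, h1, Real.norm_of_nonneg hT]
  linarith

theorem step_mem_speedBound {z : Vec d × Vec d} {q : ℝ × Vec d × Vec d}
    (hq : q ∈ speedBound z) {w : Mark d} (hw : (q.2, w) ∉ refreshSet U lam) :
    step U lam q w ∈ speedBound z := by
  classical
  obtain ⟨h0, h2⟩ := norm_step_position_le (U := U) lam hq w
  refine ⟨h0, ?_, h2⟩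
  rw [step_eq, if_neg hw]
  simp only
  rw [norm_bounce, hq.2.1]

theorem ae_bounceChain (hU : Continuous (∇ U)) [IsProbabilityMeasure ν] (z : Vec d × Vec d)
    (n : ℕ) : ∀ᵐ q ∂(bounceChain U lam ν z n), q ∈ speedBound z := by
  induction n with
  | zero =>
    refine (ae_dirac_iff (measurableSet_speedBound z)).2 ?_
    exact ⟨le_rfl, rfl, by simp⟩
  | succ n ih =>
    change ∀ᵐ q ∂(bouncePart U lam ν _), _
    rw [bouncePart]
    refine (ae_map_iff (measurable_step hU lam).aemeasurable (measurableSet_speedBound z)).2 ?_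
    filter_upwards [ae_restrict_mem (measurableSet_refreshSet' hU lam).compl,
      ae_restrict_of_ae (Measure.quasiMeasurePreserving_fst.ae ih)] with p hp hq
    exact step_mem_speedBound lam hq hp

theorem ae_firstRefresh (hU : Continuous (∇ U)) [IsProbabilityMeasure ν] (z : Vec d × Vec d) :
    ∀ᵐ p ∂(firstRefresh U lam ν z), ‖p.2‖ ≤ ‖z.1‖ + p.1 * ‖z.2‖ := by
  have hms : MeasurableSet {p : ℝ × Vec d | ‖p.2‖ ≤ ‖z.1‖ + p.1 * ‖z.2‖} :=
    measurableSet_le (by fun_prop) (by fun_prop)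
  rw [firstRefresh, Measure.ae_sum_iff' hms]
  intro n
  rw [refreshPart, ae_map_iff (measurable_step_fst hU lam).aemeasurable hms]
  filter_upwards [ae_restrict_of_ae (Measure.quasiMeasurePreserving_fst.ae
    (ae_bounceChain lam ν hU z n))] with p hq
  exact (norm_step_position_le lam hq p.2).2

end BPS
end

/-! ### Finitely many bounces in bounded time -/

noncomputable section

namespace BPS
variable {d : ℕ}
variable {U : Vec d → ℝ} (lam : ℝ) (ν : Measure (Vec d))

theorem stepTime_ge {U : Vec d → ℝ} {lam r : ℝ} {z : Vec d × Vec d} {w : Mark d}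
    (h1 : r ≤ w.1 / lam) (h2 : ENNReal.ofReal r ≤ bounceTime U z.1 z.2 w.2.1) :
    r ≤ stepTime U lam z w := by
  rw [stepTime]
  refine (ENNReal.ofReal_le_iff_le_toReal ?_).1 (le_min (ENNReal.ofReal_le_ofReal h1) h2)
  exact ne_top_of_le_ne_top ENNReal.ofReal_ne_top (min_le_left _ _)

/-- Up to time `t` the states lie in a compact set, on which the bounce rate integrated over unit
time is at most a constant `C`. Marks with both clocks large then force a long step, and they have
positive probability. -/
theorem stepTime_ge_one_of_speedBound (hU : Continuous (∇ U)) {lam : ℝ} (hlam : 0 < lam)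
    (z : Vec d × Vec d) (t : ℝ) :
    ∃ C : ℝ, 0 ≤ C ∧ ∀ q ∈ speedBound z, q.1 ≤ t → ∀ w : Mark d, lam ≤ w.1 → C < w.2.1 →
      1 ≤ stepTime U lam q.2 w := by
  have hcomp : IsCompact (Metric.closedBall (0 : Vec d) (‖z.1‖ + t * ‖z.2‖) ×ˢ
      Metric.closedBall (0 : Vec d) ‖z.2‖) :=
    (isCompact_closedBall _ _).prod (isCompact_closedBall _ _)
  have hcont : Continuous fun p : Vec d × Vec d => bounceIntegral U p.1 p.2 1 :=
    ((continuous_bounceIntegral hU).comp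
      (by fun_prop : Continuous fun p : Vec d × Vec d => (p, (1 : ℝ))) :)
  obtain ⟨C, hC⟩ := hcomp.bddAbove_image hcont.continuousOn
  refine ⟨max C 0, le_max_right _ _, fun q hq hqt w hw1 hw2 => ?_⟩
  refine stepTime_ge ((one_le_div hlam).2 hw1) (le_bounceTime fun s hs hs1 => ?_)
  have hmem : q.2 ∈ Metric.closedBall (0 : Vec d) (‖z.1‖ + t * ‖z.2‖) ×ˢ
      Metric.closedBall (0 : Vec d) ‖z.2‖ := by
    refine ⟨mem_closedBall_zero_iff.2 (hq.2.2.trans ?_), mem_closedBall_zero_iff.2 hq.2.1.le⟩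
    gcongr
  calc bounceIntegral U q.2.1 q.2.2 s ≤ bounceIntegral U q.2.1 q.2.2 1 :=
        monotone_bounceIntegral hU _ _ hs1.le
    _ ≤ C := hC ⟨q.2, hmem, rfl⟩
    _ ≤ max C 0 := le_max_left _ _
    _ < w.2.1 := hw2

theorem step_fst_eq (q : ℝ × Vec d × Vec d) (w : Mark d) :
    (step U lam q w).1 = q.1 + stepTime U lam q.2 w := rfl

theorem step_snd_fst_eq (q : ℝ × Vec d × Vec d) (w : Mark d) :
    (step U lam q w).2.1 = q.2.1 + stepTime U lam q.2 w • q.2.2 := rfl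

theorem step_snd_snd_eq_of_mem (q : ℝ × Vec d × Vec d) {w : Mark d}
    (h : (q.2, w) ∈ refreshSet U lam) : (step U lam q w).2.2 = w.2.2 := if_pos h

/-- Without refreshments, bounded time cannot hold infinitely many bounces. -/
theorem tendsto_bounceChain_le (hU : Continuous (∇ U)) {lam : ℝ} (hlam : 0 < lam)
    [IsProbabilityMeasure ν] (z : Vec d × Vec d) (t : ℝ) :
    Filter.Tendsto (fun n => bounceChain U lam ν z n {q | q.1 ≤ t}) Filter.atTop (nhds 0) := by
  classical
  obtain ⟨C, hC0, hC⟩ := stepTime_ge_one_of_speedBound hU hlam z t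
  set good : Set (Mark d) := Set.Ici lam ×ˢ (Set.Ioi C ×ˢ Set.univ) with hgood
  have hgm : MeasurableSet good :=
    measurableSet_Ici.prod (measurableSet_Ioi.prod MeasurableSet.univ)
  set c : ℝ≥0∞ := markLaw ν good with hc
  have hc0 : c ≠ 0 := by
    rw [hc, hgood, markLaw, Measure.prod_prod, Measure.prod_prod, expMeasure_one_Ici hlam.le,
      expMeasure_one_Ioi hC0, measure_univ, mul_one]
    exact mul_ne_zero (ENNReal.ofReal_pos.2 (Real.exp_pos _)).ne'
      (ENNReal.ofReal_pos.2 (Real.exp_pos _)).ne'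
  have hS : MeasurableSet {q : ℝ × Vec d × Vec d | q.1 ≤ t} :=
    measurableSet_le measurable_fst measurable_const
  -- A Lyapunov function. Starting from `t + 1` rather than `t` ensures a loss of at least `1` on
  -- every good step, also when the step jumps past `t`. Summing the expected losses gives `c * ∑
  -- ℙ(Sₙ ≤ t, only bounces) ≤ v (0, z) < ∞`.
  set v : ℝ × Vec d × Vec d → ℝ≥0∞ := {q : ℝ × Vec d × Vec d | q.1 ≤ t}.indicator
    fun q => ENNReal.ofReal (t + 1 - q.1) with hv
  have hvm : Measurable v := Measurable.indicator (by fun_prop) hS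
  have hvle : ∀ q q' : ℝ × Vec d × Vec d, q.1 ≤ q'.1 → v q' ≤ v q := by
    intro q q' h
    by_cases h' : q'.1 ≤ t
    · rw [hv, Set.indicator_of_mem (show q' ∈ {q : ℝ × Vec d × Vec d | q.1 ≤ t} from h'),
        Set.indicator_of_mem (show q ∈ {q : ℝ × Vec d × Vec d | q.1 ≤ t} from h.trans h')]
      exact ENNReal.ofReal_le_ofReal (by linarith)
    · rw [hv, Set.indicator_of_notMem (show q' ∉ {q : ℝ × Vec d × Vec d | q.1 ≤ t} from h')]
      exact zero_le
  have hpt : ∀ q ∈ speedBound z, {q : ℝ × Vec d × Vec d | q.1 ≤ t}.indicator (fun _ => c) q +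
      oneStep U lam ν 0 v q ≤ v q := by
    intro q hq
    have hstep : ∀ w, v (step U lam q w) ≤ v q := fun w =>
      hvle _ _ (by rw [step_fst_eq]; linarith [stepTime_nonneg U lam q.2 w])
    by_cases hqt : q.1 ≤ t
    swap
    · rw [Set.indicator_of_notMem (show q ∉ {q : ℝ × Vec d × Vec d | q.1 ≤ t} from hqt), zero_add]
      calc oneStep U lam ν 0 v q ≤ ∫⁻ _, v q ∂(markLaw ν) := by
            refine lintegral_mono fun w => ?_
            split_ifs
            · exact zero_le
            · exact hstep w
        _ = v q := by simp
    · rw [Set.indicator_of_mem (show q ∈ {q : ℝ × Vec d × Vec d | q.1 ≤ t} from hqt), oneStep, hc,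
        ← lintegral_indicator_one hgm, ← lintegral_add_left (measurable_one.indicator hgm)]
      calc _ ≤ ∫⁻ _, v q ∂(markLaw ν) := by
            refine lintegral_mono fun w => ?_
            by_cases hw : w ∈ good
            · rw [Set.indicator_of_mem hw]
              have hvq : v q = ENNReal.ofReal (t + 1 - q.1) :=
                Set.indicator_of_mem (show q ∈ {q : ℝ × Vec d × Vec d | q.1 ≤ t} from hqt) _
              have hT := hC q hq hqt w hw.1 hw.2.1
              have h1 : (1 : ℝ≥0∞) ≤ v q := by
                rw [hvq, ← ENNReal.ofReal_one]
                exact ENNReal.ofReal_le_ofReal (by linarith)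
              have h2 : 1 + v (step U lam q w) ≤ v q := by
                by_cases h' : (step U lam q w).1 ≤ t
                · have hvs : v (step U lam q w) = ENNReal.ofReal (t + 1 - (step U lam q w).1) :=
                    Set.indicator_of_mem
                      (show step U lam q w ∈ {q : ℝ × Vec d × Vec d | q.1 ≤ t} from h') _
                  rw [hvs, hvq, ← ENNReal.ofReal_one,
                    ← ENNReal.ofReal_add (by norm_num) (by linarith)]
                  rw [step_fst_eq]
                  exact ENNReal.ofReal_le_ofReal (by linarith)
                · have hvs : v (step U lam q w) = 0 := Set.indicator_of_notMem
                    (show step U lam q w ∉ {q : ℝ × Vec d × Vec d | q.1 ≤ t} from h') _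
                  rwa [hvs, add_zero]
              simp only [Pi.one_apply]
              split_ifs
              · simpa using h1
              · exact h2
            · rw [Set.indicator_of_notMem hw, zero_add]
              split_ifs
              · exact zero_le
              · exact hstep w
        _ = v q := by simp
  have hsucc : ∀ n, c * bounceChain U lam ν z n {q | q.1 ≤ t} +
      ∫⁻ q, v q ∂(bounceChain U lam ν z (n + 1)) ≤ ∫⁻ q, v q ∂(bounceChain U lam ν z n) := by
    intro n
    have h := lintegral_refreshPart_add_bouncePart lam ν hU (bounceChain U lam ν z n)
      (a := 0) (F := v) measurable_zero hvm
    simp only [Pi.zero_apply, lintegral_zero, zero_add] at h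
    change _ + ∫⁻ q, v q ∂(bouncePart U lam ν _) ≤ _
    rw [h, ← lintegral_indicator_const hS, ← lintegral_add_left (measurable_const.indicator hS)]
    refine lintegral_mono_ae ?_
    filter_upwards [ae_bounceChain lam ν hU z n] with q hq using hpt q hq
  have hsum : ∀ N, ∑ n ∈ Finset.range N, c * bounceChain U lam ν z n {q | q.1 ≤ t} +
      ∫⁻ q, v q ∂(bounceChain U lam ν z N) ≤ v (0, z) := by
    intro N
    induction N with
    | zero => simp [bounceChain, lintegral_dirac' _ hvm]
    | succ N ih =>
      refine le_trans ?_ ih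
      rw [Finset.sum_range_succ, add_assoc]
      gcongr
      exact hsucc N
  have htsum : c * ∑' n, bounceChain U lam ν z n {q | q.1 ≤ t} ≤ v (0, z) := by
    rw [← ENNReal.tsum_mul_left, ENNReal.tsum_eq_iSup_nat]
    exact iSup_le fun N => le_self_add.trans (hsum N)
  have hvtop : v (0, z) ≠ ∞ := by
    rw [hv]
    refine ne_top_of_le_ne_top ENNReal.ofReal_ne_top (Set.indicator_le_self' ?_ _)
    exact fun _ _ => zero_le
  refine ENNReal.tendsto_atTop_zero_of_tsum_ne_top fun htop => hvtop ?_
  rw [htop, ENNReal.mul_top hc0] at htsum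
  exact top_le_iff.1 htsum

end BPS
end

/-! ### The first refreshment time is exponential -/

noncomputable section

namespace BPS
variable {d : ℕ}
variable {U : Vec d → ℝ} (lam : ℝ) (ν : Measure (Vec d))

/-- The expectation of `F` under a refreshment of the velocity. -/
def refreshAvg (F : ℝ × Vec d × Vec d → ℝ≥0∞) (p : ℝ × Vec d) : ℝ≥0∞ :=
  ∫⁻ g, F (p.1, p.2, g) ∂ν

theorem measurable_refreshAvg [SFinite ν] {F : ℝ × Vec d × Vec d → ℝ≥0∞}
    (hF : Measurable F) : Measurable (refreshAvg ν F) := by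
  have h : Measurable fun p : (ℝ × Vec d) × Vec d => F (p.1.1, p.1.2, p.2) :=
    (hF.comp (by fun_prop : Measurable fun p : (ℝ × Vec d) × Vec d => (p.1.1, p.1.2, p.2)) :)
  exact h.lintegral_prod_right'

theorem lintegral_markLaw [SFinite ν] {F : Mark d → ℝ≥0∞} (hF : Measurable F) :
    ∫⁻ w, F w ∂(markLaw ν) =
      ∫⁻ e, ∫⁻ f, ∫⁻ g, F (e, f, g) ∂ν ∂(expMeasure 1) ∂(expMeasure 1) := by
  rw [markLaw, lintegral_prod _ hF.aemeasurable]
  refine lintegral_congr fun e => ?_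
  exact lintegral_prod _
    (hF.comp (measurable_prodMk_left : Measurable (Prod.mk e : ℝ × Vec d → Mark d)) :).aemeasurable

/-- Neither the type of a step nor its time and position depends on the proposed velocity, so the
latter can be averaged out separately. -/
theorem oneStep_refreshAvg (hU : Continuous (∇ U)) [IsProbabilityMeasure ν]
    {F : ℝ × Vec d × Vec d → ℝ≥0∞} (hF : Measurable F) (q : ℝ × Vec d × Vec d) :
    oneStep U lam ν (refreshAvg ν F) F q = ∫⁻ w, F (step U lam q w) ∂(markLaw ν) := by
  classical
  have hq : Measurable fun w : Mark d => ((q, w) : (ℝ × Vec d × Vec d) × Mark d) :=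
    measurable_prodMk_left
  have h1 := ((measurable_oneStep_integrand lam hU (measurable_refreshAvg ν hF) hF).comp hq :)
  have h2 := ((hF.comp (measurable_step hU lam)).comp hq :)
  simp only [Function.comp_def] at h1 h2
  unfold oneStep
  rw [lintegral_markLaw ν h1, lintegral_markLaw ν h2]
  refine lintegral_congr fun e => lintegral_congr fun f => ?_
  by_cases hR : refreshTime lam e ≤ bounceTime U q.2.1 q.2.2 f
  · have hmem : ∀ g : Vec d, (q.2, ((e, f, g) : Mark d)) ∈ refreshSet U lam := fun g => hR
    simp only [hmem, if_true]
    have : ∀ g, step U lam q (e, f, g) =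
        ((step U lam q (e, f, 0)).1, (step U lam q (e, f, 0)).2.1, g) := fun g =>
      Prod.ext rfl (Prod.ext rfl (step_snd_snd_eq_of_mem lam q (hmem g)))
    have e1 : ∀ g, refreshAvg ν F ((step U lam q (e, f, g)).1, (step U lam q (e, f, g)).2.1) =
        ∫⁻ g', F (step U lam q (e, f, g')) ∂ν := by
      intro g
      rw [refreshAvg]
      refine lintegral_congr fun g' => ?_
      rw [this g', this g]
    simp_rw [e1]
    rw [lintegral_const, measure_univ, mul_one]
  · have hmem : ∀ g : Vec d, (q.2, ((e, f, g) : Mark d)) ∉ refreshSet U lam := fun g => hR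
    simp only [hmem, if_false]

/-- The memoryless property along a step: the first refreshment is exponential. -/
theorem oneStep_exp (hU : Continuous (∇ U)) {lam : ℝ} (hlam : 0 < lam) [IsProbabilityMeasure ν]
    {ψ : ℝ → ℝ≥0∞} (hψ : Measurable ψ) (q : ℝ × Vec d × Vec d) :
    oneStep U lam ν (fun p => ψ p.1) (fun q => ∫⁻ e, ψ (q.1 + e / lam) ∂(expMeasure 1)) q =
      ∫⁻ e, ψ (q.1 + e / lam) ∂(expMeasure 1) := by
  classical
  set Ψ : ℝ → ℝ≥0∞ := fun s => ∫⁻ e, ψ (s + e / lam) ∂(expMeasure 1) with hΨ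
  have hΨm : Measurable Ψ := by
    have : Measurable fun p : ℝ × ℝ => ψ (p.1 + p.2 / lam) :=
      (hψ.comp (by fun_prop : Measurable fun p : ℝ × ℝ => p.1 + p.2 / lam) :)
    exact this.lintegral_prod_right'
  have hq : Measurable fun w : Mark d => ((q, w) : (ℝ × Vec d × Vec d) × Mark d) :=
    measurable_prodMk_left
  have h1 := ((measurable_oneStep_integrand (U := U) lam hU (hψ.comp measurable_fst :)
    (hΨm.comp measurable_fst :)).comp hq :)
  simp only [Function.comp_def] at h1
  unfold oneStep
  rw [lintegral_markLaw ν h1]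
  have hin : ∀ e f, ∫⁻ g, (if ((q, ((e, f, g) : Mark d)).1.2, (q, ((e, f, g) : Mark d)).2) ∈
      refreshSet U lam then ψ (step U lam q (e, f, g)).1 else Ψ (step U lam q (e, f, g)).1) ∂ν =
      if refreshTime lam e ≤ bounceTime U q.2.1 q.2.2 f then
        ψ (q.1 + (min (refreshTime lam e) (bounceTime U q.2.1 q.2.2 f)).toReal) else
        Ψ (q.1 + (min (refreshTime lam e) (bounceTime U q.2.1 q.2.2 f)).toReal) := by
    intro e f
    by_cases hR : refreshTime lam e ≤ bounceTime U q.2.1 q.2.2 f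
    · have hmem : ∀ g : Vec d, (q.2, ((e, f, g) : Mark d)) ∈ refreshSet U lam := fun g => hR
      simp only [hmem, hR, if_true]
      exact (lintegral_const (μ := ν)
        (ψ (q.1 + (min (refreshTime lam e) (bounceTime U q.2.1 q.2.2 f)).toReal))).trans
        (by rw [measure_univ, mul_one])
    · have hmem : ∀ g : Vec d, (q.2, ((e, f, g) : Mark d)) ∉ refreshSet U lam := fun g => hR
      simp only [hmem, hR, if_false]
      exact (lintegral_const (μ := ν)
        (Ψ (q.1 + (min (refreshTime lam e) (bounceTime U q.2.1 q.2.2 f)).toReal))).trans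
        (by rw [measure_univ, mul_one])
  simp only at hin
  have hm2 : Measurable fun p : ℝ × ℝ =>
      if refreshTime lam p.1 ≤ bounceTime U q.2.1 q.2.2 p.2 then
        ψ (q.1 + (min (refreshTime lam p.1) (bounceTime U q.2.1 q.2.2 p.2)).toReal) else
        Ψ (q.1 + (min (refreshTime lam p.1) (bounceTime U q.2.1 q.2.2 p.2)).toReal) := by
    have hr : Measurable fun p : ℝ × ℝ => refreshTime lam p.1 :=
      (measurable_refreshTime lam).comp measurable_fst
    have hb : Measurable fun p : ℝ × ℝ => bounceTime U q.2.1 q.2.2 p.2 :=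
      ((measurable_bounceTime hU).comp
        (by fun_prop : Measurable fun p : ℝ × ℝ => (q.2, p.2)) :)
    have ht : Measurable fun p : ℝ × ℝ =>
        q.1 + (min (refreshTime lam p.1) (bounceTime U q.2.1 q.2.2 p.2)).toReal :=
      (hr.min hb).ennreal_toReal.const_add _
    exact Measurable.ite (measurableSet_le hr hb) (hψ.comp ht :) (hΨm.comp ht :)
  simp_rw [hin]
  rw [lintegral_lintegral_swap hm2.aemeasurable]
  have hf : ∀ f, ∫⁻ e, (if refreshTime lam e ≤ bounceTime U q.2.1 q.2.2 f then
        ψ (q.1 + (min (refreshTime lam e) (bounceTime U q.2.1 q.2.2 f)).toReal) else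
        Ψ (q.1 + (min (refreshTime lam e) (bounceTime U q.2.1 q.2.2 f)).toReal))
        ∂(expMeasure 1) = Ψ q.1 := by
    intro f
    set τ := bounceTime U q.2.1 q.2.2 f with hτ
    have hψq : Measurable fun e : ℝ => ψ (q.1 + e / lam) := by fun_prop
    by_cases htop : τ = ∞
    · rw [hΨ]
      refine lintegral_congr_ae ?_
      filter_upwards [ae_pos_expMeasure_one] with e he
      rw [if_pos (by rw [htop]; exact le_top), htop, min_eq_left le_top, refreshTime,
        ENNReal.toReal_ofReal (by positivity)]
    -- Split the clock at `lam * τ`: below, the refreshment comes first; above, the bounce comes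
    -- first and the remaining clock is a fresh exponential. The tie counts as a refreshment but is
    -- a null event.
    · have hc : 0 ≤ lam * τ.toReal := by positivity
      have hsplit := lintegral_expMeasure_one_split _ hψq hc
      have hne : ∀ᵐ e ∂(expMeasure 1), e ≠ lam * τ.toReal := by
        rw [ae_iff]; simp
      have hL : ∫⁻ e, (if refreshTime lam e ≤ τ then ψ (q.1 + (min (refreshTime lam e) τ).toReal)
          else Ψ (q.1 + (min (refreshTime lam e) τ).toReal)) ∂(expMeasure 1) =
          ∫⁻ e, ((Set.Iio (lam * τ.toReal)).indicator (fun e => ψ (q.1 + e / lam)) e +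
            (Set.Ioi (lam * τ.toReal)).indicator (fun _ => Ψ (q.1 + τ.toReal)) e)
            ∂(expMeasure 1) := by
        refine lintegral_congr_ae ?_
        filter_upwards [ae_pos_expMeasure_one, hne] with e he hne
        have hiff : refreshTime lam e ≤ τ ↔ e ≤ lam * τ.toReal := by
          rw [refreshTime, ENNReal.ofReal_le_iff_le_toReal htop, div_le_iff₀' hlam]
        by_cases hle : refreshTime lam e ≤ τ
        · have hlt : e < lam * τ.toReal := lt_of_le_of_ne (hiff.1 hle) hne
          rw [if_pos hle, min_eq_left hle, Set.indicator_of_mem (Set.mem_Iio.2 hlt),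
            Set.indicator_of_notMem (by simpa using hlt.le), add_zero, refreshTime,
            ENNReal.toReal_ofReal (by positivity)]
        · have hlt : lam * τ.toReal < e := not_le.1 fun h => hle (hiff.2 h)
          rw [if_neg hle, min_eq_right (not_le.1 hle).le,
            Set.indicator_of_notMem (by simpa using hlt.le),
            Set.indicator_of_mem (Set.mem_Ioi.2 hlt), zero_add]
      rw [hL, lintegral_add_left (hψq.indicator measurableSet_Iio),
        lintegral_indicator_const measurableSet_Ioi, expMeasure_one_Ioi hc, hΨ]
      simp only
      rw [hsplit, mul_comm (∫⁻ e, ψ (q.1 + τ.toReal + e / lam) ∂(expMeasure 1))]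
      congr 2
      refine lintegral_congr fun e => ?_
      congr 1
      field_simp
      ring
  simp_rw [hf]
  rw [lintegral_const, measure_univ, mul_one]

theorem lintegral_time_firstRefresh_le (hU : Continuous (∇ U)) {lam : ℝ} (hlam : 0 < lam)
    [IsProbabilityMeasure ν] {ψ : ℝ → ℝ≥0∞} (hψ : Measurable ψ) (z : Vec d × Vec d) :
    ∫⁻ p, ψ p.1 ∂(firstRefresh U lam ν z) ≤ ∫⁻ e, ψ (e / lam) ∂(expMeasure 1) := by
  have hm : Measurable fun p : (ℝ × Vec d × Vec d) × ℝ => ψ (p.1.1 + p.2 / lam) := by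
    fun_prop
  have h := lintegral_firstRefresh_le lam ν hU (a := fun p => ψ p.1)
    (F := fun q => ∫⁻ e, ψ (q.1 + e / lam) ∂(expMeasure 1)) (by fun_prop)
    hm.lintegral_prod_right' (fun q => (oneStep_exp ν hU hlam hψ q).le) z
  simpa using h

/-- The cutoff `t` and the bound by `1` make the renewal remainder at most the probability of `N`
bounces before `t`, which tends to `0`. -/
theorem le_lintegral_time_firstRefresh (hU : Continuous (∇ U)) {lam : ℝ} (hlam : 0 < lam)
    [IsProbabilityMeasure ν] {ψ : ℝ → ℝ≥0∞} (hψ : Measurable ψ) (hψ1 : ∀ s, ψ s ≤ 1) {t : ℝ}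
    (hψt : ∀ s, t < s → ψ s = 0) (z : Vec d × Vec d) :
    ∫⁻ e, ψ (e / lam) ∂(expMeasure 1) ≤ ∫⁻ p, ψ p.1 ∂(firstRefresh U lam ν z) := by
  have hm : Measurable fun p : (ℝ × Vec d × Vec d) × ℝ => ψ (p.1.1 + p.2 / lam) := by
    fun_prop
  have hS : MeasurableSet {q : ℝ × Vec d × Vec d | q.1 ≤ t} :=
    measurableSet_le measurable_fst measurable_const
  have h := le_lintegral_firstRefresh_add lam ν hU (a := fun p => ψ p.1)
    (F := fun q => ∫⁻ e, ψ (q.1 + e / lam) ∂(expMeasure 1)) (by fun_prop)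
    hm.lintegral_prod_right' (fun q => (oneStep_exp ν hU hlam hψ q).ge) z
  have hF : ∀ q : ℝ × Vec d × Vec d, ∫⁻ e, ψ (q.1 + e / lam) ∂(expMeasure 1) ≤
      {q : ℝ × Vec d × Vec d | q.1 ≤ t}.indicator 1 q := by
    intro q
    by_cases hq : q.1 ≤ t
    · rw [Set.indicator_of_mem (show q ∈ {q : ℝ × Vec d × Vec d | q.1 ≤ t} from hq)]
      calc _ ≤ ∫⁻ _, 1 ∂(expMeasure 1) := lintegral_mono fun e => hψ1 _
        _ = 1 := by simp
    · refine le_of_eq_of_le ?_ zero_le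
      rw [← lintegral_zero (μ := expMeasure 1)]
      refine lintegral_congr_ae ?_
      filter_upwards [ae_pos_expMeasure_one] with e he
      have : 0 < e / lam := by positivity
      exact hψt _ (by linarith)
  have h2 : ∀ N, ∫⁻ e, ψ (e / lam) ∂(expMeasure 1) ≤ ∫⁻ p, ψ p.1 ∂(firstRefresh U lam ν z) +
      bounceChain U lam ν z N {q | q.1 ≤ t} := by
    intro N
    have hN := h N
    simp only [zero_add] at hN
    refine hN.trans ?_
    gcongr
    rw [← lintegral_indicator_one hS]
    exact lintegral_mono hF
  have hlim := (tendsto_bounceChain_le ν hU hlam z t).const_add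
    (∫⁻ p, ψ p.1 ∂(firstRefresh U lam ν z))
  rw [add_zero] at hlim
  exact ge_of_tendsto' hlim h2

/-- The first refreshment happens after an exponential time. -/
theorem firstRefresh_fst (hU : Continuous (∇ U)) {lam : ℝ} (hlam : 0 < lam)
    [IsProbabilityMeasure ν] (z : Vec d × Vec d) :
    (firstRefresh U lam ν z).fst = (expMeasure 1).map (fun e => e / lam) := by
  have hdiv : Measurable fun e : ℝ => e / lam := by fun_prop
  have key : ∀ ψ : ℝ → ℝ≥0∞, Measurable ψ → (∀ s, ψ s ≤ 1) →
      (∃ t : ℝ, ∀ s, t < s → ψ s = 0) →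
      ∫⁻ p, ψ p ∂(firstRefresh U lam ν z).fst =
        ∫⁻ s, ψ s ∂((expMeasure 1).map fun e => e / lam) := by
    rintro ψ hψ h1 ⟨t, ht⟩
    rw [Measure.fst, lintegral_map hψ measurable_fst, lintegral_map hψ hdiv]
    exact le_antisymm (lintegral_time_firstRefresh_le ν hU hlam hψ z)
      (le_lintegral_time_firstRefresh ν hU hlam hψ h1 ht z)
  ext A hA
  -- `key` applies only to functions that vanish after some time, hence the exhaustion.
  have hu : A = ⋃ n : ℕ, A ∩ Set.Iic (n : ℝ) := by
    rw [← Set.inter_iUnion]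
    have : ⋃ n : ℕ, Set.Iic (n : ℝ) = Set.univ := by
      refine Set.eq_univ_of_forall fun x => ?_
      obtain ⟨n, hn⟩ := exists_nat_ge x
      exact Set.mem_iUnion.2 ⟨n, hn⟩
    rw [this, Set.inter_univ]
  have hmono : Monotone fun n : ℕ => A ∩ Set.Iic (n : ℝ) := fun a b hab =>
    Set.inter_subset_inter_right _ (Set.Iic_subset_Iic.2 (by exact_mod_cast hab))
  rw [hu, hmono.measure_iUnion, hmono.measure_iUnion]
  congr 1
  funext n
  have hAn : MeasurableSet (A ∩ Set.Iic (n : ℝ)) := hA.inter measurableSet_Iic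
  rw [← lintegral_indicator_one hAn, ← lintegral_indicator_one hAn]
  refine key _ (measurable_one.indicator hAn) (fun s => ?_) ⟨n, fun s hs => ?_⟩
  · exact Set.indicator_le_self' (fun _ _ => zero_le) s
  · exact Set.indicator_of_notMem (fun h => absurd h.2 (not_le.2 hs)) _

end BPS
end

/-! ### Non-explosion and lower bounds of the semigroup -/

noncomputable section

namespace BPS
variable {d : ℕ}
variable {U : Vec d → ℝ} (lam : ℝ) (ν : Measure (Vec d))

/-- A function of the remaining time and of the state, as a function on the embedded chain. -/
def beforeTime (t : ℝ) (f : ℝ × Vec d × Vec d → ℝ≥0∞) : ℝ × Vec d × Vec d → ℝ≥0∞ :=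
  {q : ℝ × Vec d × Vec d | q.1 ≤ t}.indicator fun q => f (t - q.1, q.2)

theorem measurable_beforeTime (t : ℝ) {f : ℝ × Vec d × Vec d → ℝ≥0∞} (hf : Measurable f) :
    Measurable (beforeTime t f) :=
  Measurable.indicator
    (hf.comp (by fun_prop : Measurable fun q : ℝ × Vec d × Vec d => (t - q.1, q.2)) :)
    (measurableSet_le measurable_fst measurable_const)

theorem beforeTime_of_le {t : ℝ} {q : ℝ × Vec d × Vec d} (h : q.1 ≤ t)
    (f : ℝ × Vec d × Vec d → ℝ≥0∞) : beforeTime t f q = f (t - q.1, q.2) :=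
  Set.indicator_of_mem (show q ∈ {q : ℝ × Vec d × Vec d | q.1 ≤ t} from h) _

theorem beforeTime_of_lt {t : ℝ} {q : ℝ × Vec d × Vec d} (h : t < q.1)
    (f : ℝ × Vec d × Vec d → ℝ≥0∞) : beforeTime t f q = 0 :=
  Set.indicator_of_notMem (show q ∉ {q : ℝ × Vec d × Vec d | q.1 ≤ t} from not_le.2 h) _

theorem beforeTime_step (t : ℝ) (f : ℝ × Vec d × Vec d → ℝ≥0∞) (q : ℝ × Vec d × Vec d)
    (w : Mark d) :
    beforeTime t f (step U lam q w) = beforeTime (t - q.1) f (step U lam (0, q.2) w) := by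
  have h1 : (step U lam (0, q.2) w).1 = stepTime U lam q.2 w := by rw [step_fst_eq]; simp
  have h2 := step_fst_eq (U := U) lam q w
  have h3 : (step U lam q w).2 = (step U lam (0, q.2) w).2 := rfl
  by_cases h : (step U lam q w).1 ≤ t
  · rw [beforeTime_of_le h, beforeTime_of_le (by rw [h1]; linarith), h1, h2, h3]
    congr 2
    ring
  · rw [beforeTime_of_lt (not_le.1 h), beforeTime_of_lt (by rw [h1]; linarith)]

/-- The probability of an explosion before time `p.1` from the state `p.2`. -/
def explosionProb (U : Vec d → ℝ) (lam : ℝ) (ν : Measure (Vec d)) (p : ℝ × Vec d × Vec d) :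
    ℝ≥0∞ :=
  noise ν (alive U lam p.1 p.2)ᶜ

theorem measurableSet_notMem_alive (hU : Continuous (∇ U)) :
    MeasurableSet {p : (ℝ × Vec d × Vec d) × (ℕ → Mark d) | p.2 ∉ alive U lam p.1.1 p.1.2} :=
  (by fun_prop : Measurable fun p : (ℝ × Vec d × Vec d) × (ℕ → Mark d) =>
    (p.1.1, p.1.2, p.2)) (measurableSet_alive hU lam).compl

theorem measurable_explosionProb (hU : Continuous (∇ U)) [IsProbabilityMeasure ν] :
    Measurable (explosionProb U lam ν) :=
  measurable_measure_prodMk_left (measurableSet_notMem_alive lam hU)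

theorem measurableSet_alive_section (hU : Continuous (∇ U)) (t : ℝ) (z : Vec d × Vec d) :
    MeasurableSet (alive U lam t z) :=
  (by fun_prop : Measurable fun ω : ℕ → Mark d => ((t, z, ω) :
    ℝ × (Vec d × Vec d) × (ℕ → Mark d))) (measurableSet_alive hU lam)

theorem explosionProb_eq (hU : Continuous (∇ U)) [IsProbabilityMeasure ν] {u : ℝ} (hu : 0 ≤ u)
    (z : Vec d × Vec d) :
    explosionProb U lam ν (u, z) =
      ∫⁻ w, beforeTime u (explosionProb U lam ν) (step U lam (0, z) w) ∂(markLaw ν) := by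
  have hm := measurableSet_alive_section (U := U) lam hU u z
  rw [explosionProb, ← lintegral_indicator_one hm.compl,
    lintegral_noise ν (measurable_one.indicator hm.compl)]
  refine lintegral_congr fun w => ?_
  have h1 : (step U lam (0, z) w).1 = stepTime U lam z w := by rw [step_fst_eq]; simp
  by_cases hT : stepTime U lam z w ≤ u
  · rw [beforeTime_of_le (by rwa [h1]), explosionProb, h1]
    have hm' := measurableSet_alive_section (U := U) lam hU (u - stepTime U lam z w)
      (step U lam (0, z) w).2
    rw [← lintegral_indicator_one hm'.compl]
    refine lintegral_congr fun ω => ?_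
    have := consMark_notMem_alive (U := U) (lam := lam) hu z w ω
    by_cases hω : ω ∈ alive U lam (u - stepTime U lam z w) (step U lam (0, z) w).2
    · rw [Set.indicator_of_notMem (s := (alive U lam u z)ᶜ) fun h => (this.1 h).2 hω,
        Set.indicator_of_notMem (s := (alive U lam (u - stepTime U lam z w)
          (step U lam (0, z) w).2)ᶜ) fun h => h hω]
    · rw [Set.indicator_of_mem (s := (alive U lam u z)ᶜ) (this.2 ⟨hT, hω⟩),
        Set.indicator_of_mem (show ω ∈ (alive U lam _ _)ᶜ from hω)]
      rfl
  · rw [beforeTime_of_lt (by rw [h1]; exact not_le.1 hT), ← lintegral_zero (μ := noise ν)]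
    refine lintegral_congr fun ω => Set.indicator_of_notMem ?_ _
    exact fun h => hT ((consMark_notMem_alive hu z w ω).1 h).1

theorem explosionProb_mono {u t : ℝ} (hut : u ≤ t) (z : Vec d × Vec d) :
    explosionProb U lam ν (u, z) ≤ explosionProb U lam ν (t, z) := by
  refine measure_mono (Set.compl_subset_compl.2 ?_)
  rintro ω ⟨n, hn⟩
  exact ⟨n, hut.trans_lt hn⟩

theorem ae_time_firstRefresh (hU : Continuous (∇ U)) {lam : ℝ} (hlam : 0 < lam)
    [IsProbabilityMeasure ν] (z : Vec d × Vec d) :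
    ∀ᵐ p ∂(firstRefresh U lam ν z), 0 ≤ p.1 := by
  have h : ∀ᵐ s ∂(firstRefresh U lam ν z).fst, 0 ≤ s := by
    rw [firstRefresh_fst ν hU hlam, ae_map_iff (by fun_prop) measurableSet_Ici]
    filter_upwards [ae_pos_expMeasure_one] with e he
    positivity
  exact ae_of_ae_map measurable_fst.aemeasurable h

theorem firstRefresh_time_le (hU : Continuous (∇ U)) {lam : ℝ} (hlam : 0 < lam)
    [IsProbabilityMeasure ν] (z : Vec d × Vec d) {t : ℝ} (ht : 0 ≤ t) :
    firstRefresh U lam ν z {p | p.1 ≤ t} = 1 - ENNReal.ofReal (Real.exp (-(lam * t))) := by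
  have h1 : firstRefresh U lam ν z {p | p.1 ≤ t} = (firstRefresh U lam ν z).fst (Set.Iic t) :=
    (Measure.fst_apply measurableSet_Iic).symm
  rw [h1, firstRefresh_fst ν hU hlam, Measure.map_apply (by fun_prop) measurableSet_Iic]
  have h2 : (fun e : ℝ => e / lam) ⁻¹' Set.Iic t = (Set.Ioi (lam * t))ᶜ := by
    ext e
    simp [div_le_iff₀' hlam]
  rw [h2, prob_compl_eq_one_sub measurableSet_Ioi, expMeasure_one_Ioi (by positivity)]

/-- The bouncy particle sampler does not explode. -/
theorem explosionProb_eq_zero (hU : Continuous (∇ U)) {lam : ℝ} (hlam : 0 < lam)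
    [IsProbabilityMeasure ν] {t : ℝ} (ht : 0 ≤ t) (z : Vec d × Vec d) :
    explosionProb U lam ν (t, z) = 0 := by
  -- An explosion before `t` requires a refreshment before `t`, since bounces alone do not
  -- accumulate; the process then restarts with less time left. So `Q` is at most `Q` times the
  -- probability `1 - exp (-(lam * t)) < 1`, and being finite it vanishes.
  set Q : ℝ≥0∞ := ⨆ z, explosionProb U lam ν (t, z) with hQ
  have hQ1 : Q ≤ 1 := iSup_le fun z => prob_le_one
  have hle : ∀ z, explosionProb U lam ν (t, z) ≤ Q := fun z =>
    le_iSup (fun z => explosionProb U lam ν (t, z)) z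
  set F := beforeTime t (explosionProb U lam ν) with hF
  have hFm : Measurable F := measurable_beforeTime t (measurable_explosionProb lam ν hU)
  have hS : MeasurableSet {q : ℝ × Vec d × Vec d | q.1 ≤ t} :=
    measurableSet_le measurable_fst measurable_const
  have hS' : MeasurableSet {q : ℝ × Vec d | q.1 ≤ t} :=
    measurableSet_le measurable_fst measurable_const
  have hFQ : ∀ q : ℝ × Vec d × Vec d, 0 ≤ q.1 →
      F q ≤ {q : ℝ × Vec d × Vec d | q.1 ≤ t}.indicator (fun _ => Q) q := by
    intro q hq
    by_cases h : q.1 ≤ t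
    · rw [Set.indicator_of_mem (show q ∈ {q : ℝ × Vec d × Vec d | q.1 ≤ t} from h), hF,
        beforeTime_of_le h]
      exact (explosionProb_mono lam ν (by linarith) q.2).trans (hle _)
    · rw [hF, beforeTime_of_lt (not_le.1 h)]; exact zero_le
  have hren : ∀ q, F q ≤ oneStep U lam ν (refreshAvg ν F) F q := by
    intro q
    rw [oneStep_refreshAvg lam ν hU hFm, hF]
    by_cases h : q.1 ≤ t
    · rw [beforeTime_of_le h, explosionProb_eq lam ν hU (by linarith)]
      rw [lintegral_congr fun w => beforeTime_step lam t _ q w]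
    · rw [beforeTime_of_lt (not_le.1 h)]; exact zero_le
  have hbound : ∀ z N, explosionProb U lam ν (t, z) ≤
      Q * (1 - ENNReal.ofReal (Real.exp (-(lam * t)))) +
        Q * bounceChain U lam ν z N {q | q.1 ≤ t} := by
    intro z N
    have h := le_lintegral_firstRefresh_add lam ν hU (measurable_refreshAvg ν hFm) hFm hren z N
    have h0 : F (0, z) = explosionProb U lam ν (t, z) := by
      rw [hF, beforeTime_of_le ht, sub_zero]
    rw [h0] at h
    refine h.trans (add_le_add ?_ ?_)
    · rw [← firstRefresh_time_le ν hU hlam z ht, ← lintegral_indicator_const hS']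
      refine lintegral_mono_ae ?_
      filter_upwards [ae_time_firstRefresh ν hU hlam z] with p hp
      rw [refreshAvg]
      calc ∫⁻ g, F (p.1, p.2, g) ∂ν
          ≤ ∫⁻ _, {q : ℝ × Vec d | q.1 ≤ t}.indicator (fun _ => Q) p ∂ν :=
            lintegral_mono fun g => hFQ (p.1, p.2, g) hp
        _ = _ := by simp
    · rw [← lintegral_indicator_const hS]
      refine lintegral_mono_ae ?_
      filter_upwards [ae_bounceChain lam ν hU z N] with q hq using hFQ q hq.1
  have hle2 : Q ≤ Q * (1 - ENNReal.ofReal (Real.exp (-(lam * t)))) := by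
    refine iSup_le fun z => ?_
    have hlim := (ENNReal.Tendsto.const_mul (tendsto_bounceChain_le ν hU hlam z t)
      (Or.inr (ne_top_of_le_ne_top ENNReal.one_ne_top hQ1))).const_add
      (Q * (1 - ENNReal.ofReal (Real.exp (-(lam * t)))))
    rw [mul_zero, add_zero] at hlim
    exact ge_of_tendsto' hlim (hbound z)
  have hQ0 : Q = 0 := by
    by_contra hne
    have hlt : 1 - ENNReal.ofReal (Real.exp (-(lam * t))) < 1 :=
      ENNReal.sub_lt_self ENNReal.one_ne_top one_ne_zero
        (ENNReal.ofReal_pos.2 (Real.exp_pos _)).ne'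
    have := ENNReal.mul_lt_mul_right hne (ne_top_of_le_ne_top ENNReal.one_ne_top hQ1) hlt
    rw [mul_one] at this
    exact absurd hle2 (not_le.2 this)
  exact le_antisymm ((hle z).trans hQ0.le) zero_le

theorem ae_mem_alive (hU : Continuous (∇ U)) {lam : ℝ} (hlam : 0 < lam)
    [IsProbabilityMeasure ν] {t : ℝ} (ht : 0 ≤ t) (z : Vec d × Vec d) :
    ∀ᵐ ω ∂(noise ν), ω ∈ alive U lam t z :=
  mem_ae_iff.2 (explosionProb_eq_zero ν hU hlam ht z)

theorem measurable_state_section (hU : Continuous (∇ U)) (t : ℝ) (z : Vec d × Vec d) :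
    Measurable (state U lam t z) :=
  ((measurable_state hU lam).comp
    (by fun_prop : Measurable fun ω : ℕ → Mark d => ((t, z, ω) :
      ℝ × (Vec d × Vec d) × (ℕ → Mark d))) :)

theorem transition_eq (hU : Continuous (∇ U)) {lam : ℝ} (hlam : 0 < lam)
    [IsProbabilityMeasure ν] {t : ℝ} (ht : 0 ≤ t) (z : Vec d × Vec d) :
    transition U lam ν t z = (noise ν).map (state U lam t z) := by
  rw [transition, Measure.restrict_eq_self_of_ae_mem (ae_mem_alive ν hU hlam ht z)]

theorem isProbabilityMeasure_transition (hU : Continuous (∇ U)) {lam : ℝ} (hlam : 0 < lam)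
    [IsProbabilityMeasure ν] {t : ℝ} (ht : 0 ≤ t) (z : Vec d × Vec d) :
    IsProbabilityMeasure (transition U lam ν t z) := by
  rw [transition_eq ν hU hlam ht]
  exact Measure.isProbabilityMeasure_map (measurable_state_section lam hU t z).aemeasurable

/-- The action of the semigroup on a function. -/
def semigroup (U : Vec d → ℝ) (lam : ℝ) (ν : Measure (Vec d)) (f : Vec d × Vec d → ℝ≥0∞)
    (p : ℝ × Vec d × Vec d) : ℝ≥0∞ :=
  ∫⁻ ω, f (state U lam p.1 p.2 ω) ∂(noise ν)

theorem measurable_semigroup (hU : Continuous (∇ U)) [IsProbabilityMeasure ν]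
    {f : Vec d × Vec d → ℝ≥0∞} (hf : Measurable f) : Measurable (semigroup U lam ν f) := by
  have h : Measurable fun p : (ℝ × Vec d × Vec d) × (ℕ → Mark d) =>
      f (state U lam p.1.1 p.1.2 p.2) :=
    ((hf.comp (measurable_state hU lam)).comp
      (by fun_prop : Measurable fun p : (ℝ × Vec d × Vec d) × (ℕ → Mark d) =>
        (p.1.1, p.1.2, p.2)) :)
  exact h.lintegral_prod_right'

theorem semigroup_one [IsProbabilityMeasure ν] (p : ℝ × Vec d × Vec d) :
    semigroup U lam ν 1 p = 1 := by
  simp [semigroup]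

theorem transition_apply (hU : Continuous (∇ U)) {lam : ℝ} (hlam : 0 < lam)
    [IsProbabilityMeasure ν] {t : ℝ} (ht : 0 ≤ t) (z : Vec d × Vec d) {A : Set (Vec d × Vec d)}
    (hA : MeasurableSet A) :
    transition U lam ν t z A = semigroup U lam ν (A.indicator 1) (t, z) := by
  rw [transition_eq ν hU hlam ht, ← lintegral_indicator_one hA,
    lintegral_map (measurable_one.indicator hA) (measurable_state_section lam hU t z)]
  rfl

/-- Only an inequality, because paths whose first step ends after `u` contribute nothing to the left
side. Non-explosion of the restarted process permits `state_consMark`. -/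
theorem semigroup_ge (hU : Continuous (∇ U)) {lam : ℝ} (hlam : 0 < lam)
    [IsProbabilityMeasure ν] {f : Vec d × Vec d → ℝ≥0∞} (hf : Measurable f) (u : ℝ)
    (z : Vec d × Vec d) :
    ∫⁻ w, beforeTime u (semigroup U lam ν f) (step U lam (0, z) w) ∂(markLaw ν) ≤
      semigroup U lam ν f (u, z) := by
  have hfm : Measurable fun ω => f (state U lam u z ω) :=
    (hf.comp (measurable_state_section lam hU u z) :)
  rw [semigroup, lintegral_noise ν hfm]
  refine lintegral_mono fun w => ?_
  have h1 : (step U lam (0, z) w).1 = stepTime U lam z w := by rw [step_fst_eq]; simp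
  by_cases hT : stepTime U lam z w ≤ u
  · rw [beforeTime_of_le (by rwa [h1]), h1, semigroup]
    refine le_of_eq (lintegral_congr_ae ?_)
    filter_upwards [ae_mem_alive ν hU hlam (sub_nonneg.2 hT) (step U lam (0, z) w).2] with ω hω
    rw [state_consMark hT hω]
  · rw [beforeTime_of_lt (by rw [h1]; exact not_le.1 hT)]
    exact zero_le

theorem oneStep_semigroup_le (hU : Continuous (∇ U)) {lam : ℝ} (hlam : 0 < lam)
    [IsProbabilityMeasure ν] {f : Vec d × Vec d → ℝ≥0∞} (hf : Measurable f) (t : ℝ)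
    (q : ℝ × Vec d × Vec d) :
    oneStep U lam ν (refreshAvg ν (beforeTime t (semigroup U lam ν f)))
      (beforeTime t (semigroup U lam ν f)) q ≤ beforeTime t (semigroup U lam ν f) q := by
  rw [oneStep_refreshAvg lam ν hU (measurable_beforeTime t (measurable_semigroup lam ν hU hf))]
  by_cases h : q.1 ≤ t
  · rw [beforeTime_of_le h]
    rw [lintegral_congr fun w => beforeTime_step lam t _ q w]
    exact semigroup_ge ν hU hlam hf (t - q.1) q.2
  · refine le_of_eq_of_le ?_ zero_le
    rw [← lintegral_zero (μ := markLaw ν)]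
    refine lintegral_congr fun w => beforeTime_of_lt ?_ _
    rw [step_fst_eq]
    linarith [stepTime_nonneg U lam q.2 w, not_le.1 h]

/-- Lower bound of the semigroup by its restriction to the paths with a refreshment. -/
theorem lintegral_firstRefresh_le_semigroup (hU : Continuous (∇ U)) {lam : ℝ} (hlam : 0 < lam)
    [IsProbabilityMeasure ν] {f : Vec d × Vec d → ℝ≥0∞} (hf : Measurable f) {t : ℝ} (ht : 0 ≤ t)
    (z : Vec d × Vec d) :
    ∫⁻ p, refreshAvg ν (beforeTime t (semigroup U lam ν f)) p ∂(firstRefresh U lam ν z) ≤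
      semigroup U lam ν f (t, z) := by
  have hm := measurable_beforeTime t (measurable_semigroup lam ν hU hf)
  have h := lintegral_firstRefresh_le lam ν hU (measurable_refreshAvg ν hm) hm
    (oneStep_semigroup_le ν hU hlam hf t) z
  rwa [beforeTime_of_le ht, sub_zero] at h

/-- Lower bound of the semigroup by its restriction to the paths which start with a
refreshment. -/
theorem lintegral_refresh_le_semigroup (hU : Continuous (∇ U)) {lam : ℝ} (hlam : 0 < lam)
    [IsProbabilityMeasure ν] {f : Vec d × Vec d → ℝ≥0∞} (hf : Measurable f) (t : ℝ)
    (q : ℝ × Vec d × Vec d) :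
    ∫⁻ e, ∫⁻ b, {b | refreshTime lam e ≤ bounceTime U q.2.1 q.2.2 b}.indicator
      (fun _ => refreshAvg ν (beforeTime t (semigroup U lam ν f))
        (q.1 + e / lam, q.2.1 + (e / lam) • q.2.2)) b ∂(expMeasure 1) ∂(expMeasure 1) ≤
      beforeTime t (semigroup U lam ν f) q := by
  classical
  refine le_trans ?_ (oneStep_semigroup_le ν hU hlam hf t q)
  have hm := measurable_beforeTime t (measurable_semigroup (U := U) lam ν hU hf)
  have hq : Measurable fun w : Mark d => ((q, w) : (ℝ × Vec d × Vec d) × Mark d) :=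
    measurable_prodMk_left
  have h1 := ((measurable_oneStep_integrand lam hU (measurable_refreshAvg ν hm) hm).comp hq :)
  simp only [Function.comp_def] at h1
  rw [oneStep, lintegral_markLaw ν h1]
  refine lintegral_mono_ae ?_
  filter_upwards [ae_pos_expMeasure_one] with e he
  refine lintegral_mono fun b => ?_
  by_cases hR : refreshTime lam e ≤ bounceTime U q.2.1 q.2.2 b
  · have hmem : ∀ g : Vec d, (q.2, ((e, b, g) : Mark d)) ∈ refreshSet U lam := fun g => hR
    have hT : ∀ g : Vec d, stepTime U lam q.2 ((e, b, g) : Mark d) = e / lam := fun g =>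
      stepTime_of_mem (hmem g) (by simp only; positivity)
    rw [Set.indicator_of_mem
      (show b ∈ {b | refreshTime lam e ≤ bounceTime U q.2.1 q.2.2 b} from hR)]
    simp only [hmem, if_true, step_fst_eq, step_snd_fst_eq, hT]
    rw [lintegral_const, measure_univ, mul_one]
  · rw [Set.indicator_of_notMem
      (show b ∉ {b | refreshTime lam e ≤ bounceTime U q.2.1 q.2.2 b} from hR)]
    exact zero_le

end BPS
end

/-! ### Absence of bounces, and recentring of the Gaussian -/

noncomputable section

namespace BPS
variable {d : ℕ}

/-- The supremum of the gradient over a centred ball. -/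
def gradSup (U : Vec d → ℝ) (ϱ : ℝ) : ℝ :=
  sSup ((fun z => ‖∇ U z‖) '' Metric.closedBall (0 : Vec d) ϱ)

theorem bddAbove_gradient {U : Vec d → ℝ} (hU : Continuous (∇ U)) (ϱ : ℝ) :
    BddAbove ((fun z => ‖∇ U z‖) '' Metric.closedBall (0 : Vec d) ϱ) :=
  (isCompact_closedBall _ _).bddAbove_image hU.norm.continuousOn

theorem gradSup_nonneg (U : Vec d → ℝ) (ϱ : ℝ) : 0 ≤ gradSup U ϱ :=
  Real.sSup_nonneg (by rintro _ ⟨z, -, rfl⟩; exact norm_nonneg _)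

theorem monotone_gradSup {U : Vec d → ℝ} (hU : Continuous (∇ U)) : Monotone (gradSup U) := by
  intro a b hab
  refine Real.sSup_le ?_ (gradSup_nonneg U b)
  rintro _ ⟨z, hz, rfl⟩
  exact le_csSup (bddAbove_gradient hU b) ⟨z, Metric.closedBall_subset_closedBall hab hz, rfl⟩

theorem bounceIntegral_le {U : Vec d → ℝ} (hU : Continuous (∇ U)) {x g : Vec d} {ϱ V r τ : ℝ}
    (hx : ‖x‖ ≤ ϱ) (hg : ‖g‖ ≤ V) (hτ : 0 ≤ τ) (hτr : τ ≤ r) :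
    bounceIntegral U x g τ ≤ τ * (V * gradSup U (ϱ + r * V)) := by
  have hV : 0 ≤ V := (norm_nonneg _).trans hg
  have h := intervalIntegral.integral_mono_on (μ := volume) hτ
    (intervalIntegrable_bounceRate hU x g 0 τ)
    (intervalIntegrable_const (c := V * gradSup U (ϱ + r * V))) ?_
  · rw [bounceIntegral]
    refine h.trans (le_of_eq ?_)
    rw [intervalIntegral.integral_const, sub_zero, smul_eq_mul]
  · intro s hs
    refine max_le ?_ (mul_nonneg hV (gradSup_nonneg _ _))
    refine (real_inner_le_norm _ _).trans ?_
    gcongr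
    refine le_csSup (bddAbove_gradient hU _) ⟨x + s • g, ?_, rfl⟩
    rw [mem_closedBall_zero_iff]
    refine (norm_add_le _ _).trans ?_
    rw [norm_smul, Real.norm_of_nonneg hs.1]
    have := hs.2
    gcongr <;> linarith

/-- A large bounce clock prevents any bounce during a time `r`. -/
theorem le_bounceTime_of_gradSup {U : Vec d → ℝ} (hU : Continuous (∇ U)) {x g : Vec d}
    {ϱ V r b : ℝ} (hx : ‖x‖ ≤ ϱ) (hg : ‖g‖ ≤ V) (hb0 : 0 < b)
    (hb : r * V * gradSup U (ϱ + r * V) ≤ b) :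
    ENNReal.ofReal r ≤ bounceTime U x g b := by
  have hV : 0 ≤ V := (norm_nonneg _).trans hg
  refine le_bounceTime fun τ hτ hτr => ?_
  have h := bounceIntegral_le hU hx hg hτ hτr.le
  -- The hypothesis on `b` is not strict, but `le_bounceTime` needs strictness. It comes from `τ <
  -- r` when the rate bound is positive, and from `0 < b` when it is zero.
  rcases (mul_nonneg hV (gradSup_nonneg U (ϱ + r * V))).eq_or_lt with h0 | h0
  · rw [← h0, mul_zero] at h
    exact h.trans_lt hb0
  · rw [mul_assoc] at hb
    exact h.trans_lt (lt_of_lt_of_le (mul_lt_mul_of_pos_right hτr h0) hb)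

/-- The probability that no bounce occurs during a time `r` after a refreshment at time
`e / lam`. -/
def noBounceWeight (U : Vec d → ℝ) (S : Matrix (Fin d) (Fin d) ℝ) (lam RK M r e : ℝ) : ℝ≥0∞ :=
  expMeasure 1 {b | r * velBound S lam RK M r e *
    gradSup U ((1 + e / lam) * RK + r * velBound S lam RK M r e) ≤ b}

theorem measurable_velBound (S : Matrix (Fin d) (Fin d) ℝ) (lam RK M : ℝ) :
    Measurable fun p : ℝ × ℝ => velBound S lam RK M p.1 p.2 := by
  unfold velBound; fun_prop

theorem measurableSet_noBounceWeight {U : Vec d → ℝ} (hU : Continuous (∇ U))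
    (S : Matrix (Fin d) (Fin d) ℝ) (lam RK M : ℝ) :
    MeasurableSet {p : (ℝ × ℝ) × ℝ | p.1.1 * velBound S lam RK M p.1.1 p.1.2 *
      gradSup U ((1 + p.1.2 / lam) * RK + p.1.1 * velBound S lam RK M p.1.1 p.1.2) ≤ p.2} := by
  have hv : Measurable fun p : (ℝ × ℝ) × ℝ => velBound S lam RK M p.1.1 p.1.2 :=
    ((measurable_velBound S lam RK M).comp measurable_fst :)
  have hg : Measurable fun p : (ℝ × ℝ) × ℝ =>
      gradSup U ((1 + p.1.2 / lam) * RK + p.1.1 * velBound S lam RK M p.1.1 p.1.2) :=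
    ((monotone_gradSup hU).measurable.comp (by fun_prop : Measurable fun p : (ℝ × ℝ) × ℝ =>
      (1 + p.1.2 / lam) * RK + p.1.1 * velBound S lam RK M p.1.1 p.1.2) :)
  exact measurableSet_le (by fun_prop) measurable_snd

theorem measurable_noBounceWeight {U : Vec d → ℝ} (hU : Continuous (∇ U))
    (S : Matrix (Fin d) (Fin d) ℝ) (lam RK M : ℝ) :
    Measurable fun p : ℝ × ℝ => noBounceWeight U S lam RK M p.1 p.2 :=
  measurable_measure_prodMk_left (measurableSet_noBounceWeight hU S lam RK M)

theorem noBounceProb_eq {U : Vec d → ℝ} (hU : Continuous (∇ U))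
    (S : Matrix (Fin d) (Fin d) ℝ) (lam RK M r : ℝ) :
    noBounceProb U S lam RK M r = ∫⁻ e, noBounceWeight U S lam RK M r e ∂(expMeasure 1) := by
  have hm : Measurable fun p : ℝ × ℝ => (((r, p.1), p.2) : (ℝ × ℝ) × ℝ) := by fun_prop
  exact Measure.prod_apply (hm (measurableSet_noBounceWeight hU S lam RK M))

/-- A later first refreshment allows a larger distance from the origin, hence a larger velocity
bound and a larger ball for the gradient. This is one of the two monotonicities behind the
association inequality. -/
theorem noBounceWeight_antitoneOn {U : Vec d → ℝ} (hU : Continuous (∇ U))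
    (S : Matrix (Fin d) (Fin d) ℝ) {lam RK M r : ℝ} (hlam : 0 < lam) (hRK : 0 ≤ RK)
    (hM : 0 ≤ M) (hr : 0 < r) :
    AntitoneOn (noBounceWeight U S lam RK M r) (Set.Ici 0) := by
  intro e he e' _ hee'
  have he0 : 0 ≤ e := he
  have hn : 0 ≤ matNorm (CFC.sqrt S) := norm_nonneg _
  have hv0 : 0 ≤ velBound S lam RK M r e := by unfold velBound; positivity
  have hv : velBound S lam RK M r e ≤ velBound S lam RK M r e' := by
    unfold velBound; gcongr
  refine measure_mono fun b hb => ?_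
  rw [Set.mem_ofPred_eq] at hb ⊢
  refine le_trans ?_ hb
  have h0 := gradSup_nonneg U ((1 + e / lam) * RK + r * velBound S lam RK M r e)
  have h1 : gradSup U ((1 + e / lam) * RK + r * velBound S lam RK M r e) ≤
      gradSup U ((1 + e' / lam) * RK + r * velBound S lam RK M r e') := by
    apply monotone_gradSup hU
    gcongr
  have : 0 ≤ r * velBound S lam RK M r e' := mul_nonneg hr.le (hv0.trans hv)
  gcongr

/-- The Gaussian law as an integral against a shifted standard density. -/
theorem lintegral_multivariateGaussian_shift (S : Matrix (Fin d) (Fin d) ℝ) {θ : Vec d → ℝ≥0∞}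
    (hθ : Measurable θ) (h : Vec d) :
    ∫⁻ g, θ g ∂(multivariateGaussian 0 S) = ∫⁻ m, ENNReal.ofReal (gaussDensity (m + h)) *
      θ (Matrix.toEuclideanCLM (𝕜 := ℝ) (CFC.sqrt S) (m + h)) := by
  have hm : Measurable fun x : Vec d =>
      (0 : Vec d) + Matrix.toEuclideanCLM (𝕜 := ℝ) (CFC.sqrt S) x :=
    by fun_prop
  have hθm : Measurable fun x : Vec d =>
      θ ((0 : Vec d) + Matrix.toEuclideanCLM (𝕜 := ℝ) (CFC.sqrt S) x) := (hθ.comp hm :)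
  rw [multivariateGaussian, lintegral_map hθ hm, stdGaussian_eq_withDensity,
    lintegral_withDensity_eq_lintegral_mul _ (by fun_prop) hθm]
  simp only [zero_add, Pi.mul_apply]
  exact (lintegral_add_right_eq_self (fun m => ENNReal.ofReal (gaussDensity m) *
      θ (Matrix.toEuclideanCLM (𝕜 := ℝ) (CFC.sqrt S) m)) h).symm

theorem isUnit_det_sqrt {S : Matrix (Fin d) (Fin d) ℝ} (hS : S.PosDef) :
    IsUnit (CFC.sqrt S).det := by
  have h : CFC.sqrt S * CFC.sqrt S = S := CFC.sqrt_mul_sqrt_self S hS.posSemidef.nonneg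
  have h2 : IsUnit S.det := hS.det_pos.ne'.isUnit
  rw [← h, Matrix.det_mul] at h2
  exact isUnit_of_mul_isUnit_left h2

theorem sqrt_apply_inv {S : Matrix (Fin d) (Fin d) ℝ} (hS : S.PosDef) (x : Vec d) :
    Matrix.toEuclideanCLM (𝕜 := ℝ) (CFC.sqrt S)
      (Matrix.toEuclideanCLM (𝕜 := ℝ) (CFC.sqrt S)⁻¹ x) = x := by
  rw [← mul_apply_eq_comp, ← map_mul, Matrix.mul_nonsing_inv _ (isUnit_det_sqrt hS),
    map_one, one_apply_eq_self]

end BPS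
end

/-! ### Merging two positions at the second refreshment -/

noncomputable section

namespace BPS
variable {d : ℕ} {U : Vec d → ℝ}

/-- The linear map which sends the standard Gaussian law to the centred one with covariance
`S`. -/
abbrev colour (S : Matrix (Fin d) (Fin d) ℝ) : Vec d →L[ℝ] Vec d :=
  Matrix.toEuclideanCLM (𝕜 := ℝ) (CFC.sqrt S)

/-- The last argument of the weight is a clock value: `lam * s` corresponds to a first refreshment
at time `s`. -/
theorem noBounceWeight_le (hU : Continuous (∇ U)) (S : Matrix (Fin d) (Fin d) ℝ)
    {lam RK M s e : ℝ} (hlam : 0 < lam) {x g : Vec d} (hx : ‖x‖ ≤ (1 + s) * RK)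
    (hg : ‖g‖ ≤ velBound S lam RK M (e / lam) (lam * s)) :
    noBounceWeight U S lam RK M (e / lam) (lam * s) ≤
      expMeasure 1 {b | refreshTime lam e ≤ bounceTime U x g b} := by
  have hs : lam * s / lam = s := by field_simp
  refine measure_mono_ae ?_
  filter_upwards [ae_pos_expMeasure_one] with b hb hbs
  change _ ≤ b at hbs
  rw [hs] at hbs
  exact le_bounceTime_of_gradSup hU hx hg hb hbs

/-- Lower bound of the refreshed semigroup by the paths which have a second refreshment after a
time `e / lam` without bounces, with the Gaussian recentred at `h e`. -/
theorem lintegral_second_refresh_le (hU : Continuous (∇ U)) (S : Matrix (Fin d) (Fin d) ℝ)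
    {lam RK M : ℝ} (hlam : 0 < lam) {f : Vec d × Vec d → ℝ≥0∞} (hf : Measurable f)
    (t : ℝ) {s : ℝ} {x : Vec d} (hx : ‖x‖ ≤ (1 + s) * RK) (h : ℝ → Vec d)
    (hh : ∀ e, 0 < e → ‖colour S (h e)‖ ≤ (1 + s) * RK / (e / lam)) :
    ∫⁻ e, (∫⁻ m in Metric.closedBall (0 : Vec d) M,
      noBounceWeight U S lam RK M (e / lam) (lam * s) *
      (ENNReal.ofReal (gaussDensity (m + h e)) *
        refreshAvg (multivariateGaussian 0 S)
          (beforeTime t (semigroup U lam (multivariateGaussian 0 S) f))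
          (s + e / lam, x + (e / lam) • colour S (m + h e)))) ∂(expMeasure 1) ≤
      refreshAvg (multivariateGaussian 0 S)
        (beforeTime t (semigroup U lam (multivariateGaussian 0 S) f)) (s, x) := by
  set ν := multivariateGaussian 0 S with hν
  set F := beforeTime t (semigroup U lam ν f) with hF
  have hFm : Measurable F := measurable_beforeTime t (measurable_semigroup lam ν hU hf)
  have hΦm : Measurable (refreshAvg ν F) := measurable_refreshAvg ν hFm
  set J : Vec d → ℝ → ℝ≥0∞ := fun g e =>
    expMeasure 1 {b | refreshTime lam e ≤ bounceTime U x g b} *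
      refreshAvg ν F (s + e / lam, x + (e / lam) • g) with hJ
  have hset : MeasurableSet {p : (Vec d × ℝ) × ℝ |
      refreshTime lam p.1.2 ≤ bounceTime U x p.1.1 p.2} := by
    refine measurableSet_le ?_ ?_
    · exact ((measurable_refreshTime lam).comp
        (by fun_prop : Measurable fun p : (Vec d × ℝ) × ℝ => p.1.2) :)
    · exact ((measurable_bounceTime hU).comp
        (by fun_prop : Measurable fun p : (Vec d × ℝ) × ℝ => ((x, p.1.1), p.2)) :)
  have hJm : Measurable (Function.uncurry J) := by
    have h1 : Measurable fun p : Vec d × ℝ =>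
        expMeasure 1 {b | refreshTime lam p.2 ≤ bounceTime U x p.1 b} :=
      measurable_measure_prodMk_left hset
    have h2 : Measurable fun p : Vec d × ℝ =>
        refreshAvg ν F (s + p.2 / lam, x + (p.2 / lam) • p.1) :=
      (hΦm.comp (by fun_prop : Measurable fun p : Vec d × ℝ =>
        (s + p.2 / lam, x + (p.2 / lam) • p.1)) :)
    exact h1.mul h2
  have h1 : ∫⁻ g, ∫⁻ e, J g e ∂(expMeasure 1) ∂ν ≤ refreshAvg ν F (s, x) := by
    refine lintegral_mono fun g => le_trans (le_of_eq ?_)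
      (lintegral_refresh_le_semigroup ν hU hlam hf t (s, x, g))
    refine lintegral_congr fun e => ?_
    have hsec : MeasurableSet {b | refreshTime lam e ≤ bounceTime U x g b} :=
      (by fun_prop : Measurable fun b : ℝ => (((g, e), b) : (Vec d × ℝ) × ℝ)) hset
    rw [lintegral_indicator_const hsec, mul_comm]
  refine le_trans ?_ h1
  -- The duration must be fixed before the velocity is drawn, because the recentring `h e` depends
  -- on it.
  rw [lintegral_lintegral_swap hJm.aemeasurable]
  refine lintegral_mono_ae ?_
  filter_upwards [ae_pos_expMeasure_one] with e he
  have hJe : Measurable fun g => J g e :=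
    (hJm.comp (measurable_prodMk_right : Measurable fun g : Vec d => (g, e)) :)
  rw [hν, lintegral_multivariateGaussian_shift S hJe (h e)]
  refine le_trans ?_ (setLIntegral_le_lintegral (Metric.closedBall 0 M) _)
  refine setLIntegral_mono' Metric.isClosed_closedBall.measurableSet fun m hm => ?_
  have hg : ‖colour S (m + h e)‖ ≤ velBound S lam RK M (e / lam) (lam * s) := by
    rw [map_add, velBound]
    refine (norm_add_le _ _).trans (add_le_add ?_ ?_)
    · refine ((colour S).le_opNorm m).trans ?_
      exact mul_le_mul_of_nonneg_left (mem_closedBall_zero_iff.1 hm) (norm_nonneg _)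
    · rw [mul_div_cancel_left₀ s hlam.ne']
      exact hh e he
  rw [mul_left_comm]
  exact mul_le_mul' le_rfl (mul_le_mul' (noBounceWeight_le hU S hlam hx hg) le_rfl)

/-- Half the whitened velocity difference which brings `x` and `x'` together in time `r`. -/
def meetShift (S : Matrix (Fin d) (Fin d) ℝ) (r : ℝ) (x x' : Vec d) : Vec d :=
  (2 * r)⁻¹ • Matrix.toEuclideanCLM (𝕜 := ℝ) (CFC.sqrt S)⁻¹ (x' - x)

/-- The common position reached from the midpoint of `x` and `x'`. -/
def meetPoint (S : Matrix (Fin d) (Fin d) ℝ) (r : ℝ) (x x' m : Vec d) : Vec d :=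
  (1 / 2 : ℝ) • (x + x') + r • colour S m

theorem colour_meetShift {S : Matrix (Fin d) (Fin d) ℝ} (hS : S.PosDef) (r : ℝ) (x x' : Vec d) :
    colour S (meetShift S r x x') = (2 * r)⁻¹ • (x' - x) := by
  rw [meetShift, map_smul, sqrt_apply_inv hS]

theorem meetShift_symm (S : Matrix (Fin d) (Fin d) ℝ) (r : ℝ) (x x' : Vec d) :
    meetShift S r x' x = -meetShift S r x x' := by
  rw [meetShift, meetShift, ← smul_neg, ← map_neg, neg_sub]

theorem meetPoint_eq {S : Matrix (Fin d) (Fin d) ℝ} (hS : S.PosDef) {r : ℝ} (hr : r ≠ 0)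
    (x x' m : Vec d) :
    x + r • colour S (m + meetShift S r x x') = meetPoint S r x x' m := by
  rw [map_add, colour_meetShift hS, meetPoint, smul_add, smul_smul]
  have : r * (2 * r)⁻¹ = 1 / 2 := by field_simp
  rw [this]
  module

theorem meetPoint_symm (S : Matrix (Fin d) (Fin d) ℝ) (r : ℝ) (x x' m : Vec d) :
    meetPoint S r x' x m = meetPoint S r x x' m := by
  rw [meetPoint, meetPoint, add_comm x']

/-- The steering velocity is `(x' - x) / (2 r)`; its bound is the second term of `velBound`. -/
theorem norm_colour_meetShift_le {S : Matrix (Fin d) (Fin d) ℝ} (hS : S.PosDef) {r ϱ : ℝ}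
    (hr : 0 < r) {x x' : Vec d} (hx : ‖x‖ ≤ ϱ) (hx' : ‖x'‖ ≤ ϱ) :
    ‖colour S (meetShift S r x x')‖ ≤ ϱ / r := by
  rw [colour_meetShift hS, norm_smul, norm_inv, Real.norm_of_nonneg (by positivity),
    inv_mul_le_iff₀ (by positivity)]
  calc ‖x' - x‖ ≤ ‖x'‖ + ‖x‖ := norm_sub_le _ _
    _ ≤ ϱ + ϱ := add_le_add hx' hx
    _ = 2 * r * (ϱ / r) := by field_simp; ring

/-- Twice this bound, with `ϱ = (1 + s) * RK` and `r = e / lam`, is the first argument of `α̃` in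
the theorem. -/
theorem norm_meetShift_le {S : Matrix (Fin d) (Fin d) ℝ} {r ϱ : ℝ}
    (hr : 0 < r) {x x' : Vec d} (hx : ‖x‖ ≤ ϱ) (hx' : ‖x'‖ ≤ ϱ) :
    ‖meetShift S r x x'‖ ≤ matNorm (CFC.sqrt S)⁻¹ * ϱ / r := by
  rw [meetShift, norm_smul, norm_inv, Real.norm_of_nonneg (by positivity),
    inv_mul_le_iff₀ (by positivity)]
  calc _ ≤ matNorm (CFC.sqrt S)⁻¹ * ‖x' - x‖ := ContinuousLinearMap.le_opNorm _ _
    _ ≤ matNorm (CFC.sqrt S)⁻¹ * (ϱ + ϱ) := by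
      refine mul_le_mul_of_nonneg_left ?_ (norm_nonneg _)
      exact (norm_sub_le _ _).trans (add_le_add hx' hx)
    _ = 2 * r * (matNorm (CFC.sqrt S)⁻¹ * ϱ / r) := by field_simp; ring

/-- The density of the merging event: no bounce occurs between the two refreshments, and the first
one draws velocities which meet. -/
def meetWeight (U : Vec d → ℝ) (S : Matrix (Fin d) (Fin d) ℝ) (lam RK M s : ℝ) (x x' : Vec d)
    (e : ℝ) (m : Vec d) : ℝ≥0∞ :=
  noBounceWeight U S lam RK M (e / lam) (lam * s) *
    ENNReal.ofReal (min (gaussDensity (m + meetShift S (e / lam) x x'))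
      (gaussDensity (m - meetShift S (e / lam) x x')))

/-- Exchanging the positions reverses the shift. With `meetPoint_symm` this makes the lower bound
for one copy the same as for the other. -/
theorem meetWeight_symm (S : Matrix (Fin d) (Fin d) ℝ) (lam RK M s : ℝ) (x x' : Vec d)
    (e : ℝ) (m : Vec d) :
    meetWeight U S lam RK M s x' x e m = meetWeight U S lam RK M s x x' e m := by
  rw [meetWeight, meetWeight, meetShift_symm, ← sub_eq_add_neg, sub_neg_eq_add, min_comm]

/-- Lower bound of the refreshed semigroup which is symmetric in the two positions `x`, `x'`. -/
theorem lintegral_meetWeight_le (hU : Continuous (∇ U)) {S : Matrix (Fin d) (Fin d) ℝ}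
    (hS : S.PosDef) {lam RK M : ℝ} (hlam : 0 < lam) {f : Vec d × Vec d → ℝ≥0∞}
    (hf : Measurable f) (t : ℝ) {s : ℝ} {x x' : Vec d} (hx : ‖x‖ ≤ (1 + s) * RK)
    (hx' : ‖x'‖ ≤ (1 + s) * RK) :
    ∫⁻ e, (∫⁻ m in Metric.closedBall (0 : Vec d) M, meetWeight U S lam RK M s x x' e m *
        refreshAvg (multivariateGaussian 0 S)
          (beforeTime t (semigroup U lam (multivariateGaussian 0 S) f))
          (s + e / lam, meetPoint S (e / lam) x x' m)) ∂(expMeasure 1) ≤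
      refreshAvg (multivariateGaussian 0 S)
        (beforeTime t (semigroup U lam (multivariateGaussian 0 S) f)) (s, x) := by
  refine le_trans ?_ (lintegral_second_refresh_le hU S (M := M) hlam hf t hx
    (fun e => meetShift S (e / lam) x x')
    fun e he => norm_colour_meetShift_le hS (by positivity) hx hx')
  refine lintegral_mono_ae ?_
  filter_upwards [ae_pos_expMeasure_one] with e he
  refine lintegral_mono fun m => ?_
  have hr : e / lam ≠ 0 := by positivity
  simp only
  rw [meetPoint_eq hS hr, meetWeight, mul_assoc]
  gcongr
  exact min_le_left _ _

end BPS
end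

/-! ### The common minorant as a measure -/

noncomputable section

namespace BPS
variable {d : ℕ} {U : Vec d → ℝ}

/-- The position at the second refreshment, as a function of the time and the positions at the
first one, and of the clock and the standard Gaussian drawn there. -/
def meetState (S : Matrix (Fin d) (Fin d) ℝ) (lam : ℝ)
    (p : (ℝ × Vec d × Vec d) × ℝ × Vec d) : ℝ × Vec d :=
  (p.1.1 + p.2.1 / lam, meetPoint S (p.2.1 / lam) p.1.2.1 p.1.2.2 p.2.2)

theorem measurable_meetState (S : Matrix (Fin d) (Fin d) ℝ) (lam : ℝ) :
    Measurable (meetState (d := d) S lam) := by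
  unfold meetState meetPoint
  fun_prop

theorem measurable_meetWeight (hU : Continuous (∇ U)) (S : Matrix (Fin d) (Fin d) ℝ)
    (lam RK M : ℝ) :
    Measurable fun p : (ℝ × Vec d × Vec d) × ℝ × Vec d =>
      meetWeight U S lam RK M p.1.1 p.1.2.1 p.1.2.2 p.2.1 p.2.2 := by
  have h1 : Measurable fun p : (ℝ × Vec d × Vec d) × ℝ × Vec d =>
      noBounceWeight U S lam RK M (p.2.1 / lam) (lam * p.1.1) :=
    ((measurable_noBounceWeight hU S lam RK M).comp
      (by fun_prop : Measurable fun p : (ℝ × Vec d × Vec d) × ℝ × Vec d =>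
        (p.2.1 / lam, lam * p.1.1)) :)
  have h2 : Measurable fun p : (ℝ × Vec d × Vec d) × ℝ × Vec d =>
      meetShift S (p.2.1 / lam) p.1.2.1 p.1.2.2 := by
    unfold meetShift; fun_prop
  have h3 := continuous_gaussDensity (d := d) |>.measurable
  have h4 : Measurable fun p : (ℝ × Vec d × Vec d) × ℝ × Vec d =>
      gaussDensity (p.2.2 + meetShift S (p.2.1 / lam) p.1.2.1 p.1.2.2) :=
    (h3.comp (by fun_prop : Measurable fun p : (ℝ × Vec d × Vec d) × ℝ × Vec d =>
      p.2.2 + meetShift S (p.2.1 / lam) p.1.2.1 p.1.2.2) :)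
  have h5 : Measurable fun p : (ℝ × Vec d × Vec d) × ℝ × Vec d =>
      gaussDensity (p.2.2 - meetShift S (p.2.1 / lam) p.1.2.1 p.1.2.2) :=
    (h3.comp (by fun_prop : Measurable fun p : (ℝ × Vec d × Vec d) × ℝ × Vec d =>
      p.2.2 - meetShift S (p.2.1 / lam) p.1.2.1 p.1.2.2) :)
  unfold meetWeight
  exact h1.mul (h4.min h5).ennreal_ofReal

/-- The contribution of the merging paths to a function `Φ` of the time and position of the second
refreshment. -/
def meetIntegral (U : Vec d → ℝ) (S : Matrix (Fin d) (Fin d) ℝ) (lam RK M : ℝ)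
    (Φ : ℝ × Vec d → ℝ≥0∞) (p : ℝ × Vec d × Vec d) : ℝ≥0∞ :=
  ∫⁻ e, (∫⁻ m in Metric.closedBall (0 : Vec d) M, meetWeight U S lam RK M p.1 p.2.1 p.2.2 e m *
    Φ (meetState S lam (p, e, m))) ∂(expMeasure 1)

/-- The lower bound, as a function of the target set, is realised as the image of a weighted product
space under the position and velocity at time `t` of the merged path. This is what makes it a
measure. -/
theorem exists_meetMeasure (hU : Continuous (∇ U)) (S : Matrix (Fin d) (Fin d) ℝ)
    (lam RK M t : ℝ) (ν : Measure (Vec d)) [IsProbabilityMeasure ν]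
    (Λ : Measure (ℝ × Vec d × Vec d)) [SFinite Λ] :
    ∃ κ : Measure (Vec d × Vec d), ∀ A, MeasurableSet A →
      κ A = ∫⁻ p, meetIntegral U S lam RK M
        (refreshAvg ν (beforeTime t (semigroup U lam ν (A.indicator 1)))) p ∂Λ := by
  set Γ : Measure (((ℝ × Vec d × Vec d) × ℝ × Vec d) × Vec d × (ℕ → Mark d)) :=
    (Λ.prod ((expMeasure 1).prod (volume.restrict (Metric.closedBall (0 : Vec d) M)))).prod
      (ν.prod (noise ν)) with hΓ
  have hms := measurable_meetState (d := d) S lam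
  -- The indicator keeps only the paths whose second refreshment occurs by time `t`.
  set W : ((ℝ × Vec d × Vec d) × ℝ × Vec d) → ℝ≥0∞ := fun p =>
    meetWeight U S lam RK M p.1.1 p.1.2.1 p.1.2.2 p.2.1 p.2.2 *
      {p : (ℝ × Vec d × Vec d) × ℝ × Vec d | (meetState S lam p).1 ≤ t}.indicator 1 p with hW
  have hWm : Measurable W := (measurable_meetWeight hU S lam RK M).mul
    (measurable_one.indicator (measurableSet_le (measurable_fst.comp hms) measurable_const))
  set Θ : (((ℝ × Vec d × Vec d) × ℝ × Vec d) × Vec d × (ℕ → Mark d)) → Vec d × Vec d := fun p =>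
    state U lam (t - (meetState S lam p.1).1) ((meetState S lam p.1).2, p.2.1) p.2.2 with hΘ
  have hΘm : Measurable Θ := by
    have h1 : Measurable fun p : ((ℝ × Vec d × Vec d) × ℝ × Vec d) × Vec d × (ℕ → Mark d) =>
        meetState S lam p.1 := (hms.comp measurable_fst :)
    have h2 : Measurable fun p : ((ℝ × Vec d × Vec d) × ℝ × Vec d) × Vec d × (ℕ → Mark d) =>
        (meetState S lam p.1).1 := (measurable_fst.comp h1 :)
    have h3 : Measurable fun p : ((ℝ × Vec d × Vec d) × ℝ × Vec d) × Vec d × (ℕ → Mark d) =>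
        (meetState S lam p.1).2 := (measurable_snd.comp h1 :)
    have h4 := (measurable_const (a := t)).sub h2 |>.prodMk
      ((h3.prodMk (measurable_fst.comp measurable_snd)).prodMk
        (measurable_snd.comp measurable_snd))
    exact ((measurable_state hU lam).comp h4 :)
  refine ⟨(Γ.withDensity fun p => W p.1).map Θ, fun A hA => ?_⟩
  have hA1 : Measurable (A.indicator (1 : Vec d × Vec d → ℝ≥0∞)) := measurable_one.indicator hA
  have hAΘ : Measurable fun p => A.indicator (1 : Vec d × Vec d → ℝ≥0∞) (Θ p) :=
    (hA1.comp hΘm :)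
  have hW1 : Measurable fun p : ((ℝ × Vec d × Vec d) × ℝ × Vec d) × Vec d × (ℕ → Mark d) =>
      W p.1 := (hWm.comp measurable_fst :)
  have hΦm : Measurable (refreshAvg ν (beforeTime t (semigroup U lam ν (A.indicator 1)))) :=
    measurable_refreshAvg ν (measurable_beforeTime t (measurable_semigroup lam ν hU hA1))
  have hfull : Measurable fun p : ((ℝ × Vec d × Vec d) × ℝ × Vec d) × Vec d × (ℕ → Mark d) =>
      W p.1 * A.indicator 1 (Θ p) := hW1.mul hAΘ
  rw [← lintegral_indicator_one hA, lintegral_map hA1 hΘm,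
    lintegral_withDensity_eq_lintegral_mul _ hW1 hAΘ]
  simp only [Pi.mul_apply]
  rw [hΓ, lintegral_prod _ hfull.aemeasurable]
  have hinner : ∀ p : (ℝ × Vec d × Vec d) × ℝ × Vec d,
      ∫⁻ y, W p * A.indicator 1 (Θ (p, y)) ∂(ν.prod (noise ν)) =
        meetWeight U S lam RK M p.1.1 p.1.2.1 p.1.2.2 p.2.1 p.2.2 *
          refreshAvg ν (beforeTime t (semigroup U lam ν (A.indicator 1))) (meetState S lam p) := by
    intro p
    have hAp : Measurable fun y => A.indicator (1 : Vec d × Vec d → ℝ≥0∞) (Θ (p, y)) :=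
      (hAΘ.comp measurable_prodMk_left :)
    rw [lintegral_const_mul _ hAp, hW]
    simp only
    rw [mul_assoc]
    congr 1
    by_cases h : (meetState S lam p).1 ≤ t
    · rw [Set.indicator_of_mem
        (show p ∈ {p : (ℝ × Vec d × Vec d) × ℝ × Vec d | (meetState S lam p).1 ≤ t} from h),
        Pi.one_apply, one_mul, lintegral_prod _ hAp.aemeasurable, refreshAvg]
      refine lintegral_congr fun g => ?_
      rw [beforeTime_of_le h]
      rfl
    · rw [Set.indicator_of_notMem
        (show p ∉ {p : (ℝ × Vec d × Vec d) × ℝ × Vec d | (meetState S lam p).1 ≤ t} from h),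
        zero_mul, refreshAvg]
      refine Eq.symm ((lintegral_congr fun g => ?_).trans lintegral_zero)
      exact beforeTime_of_lt (not_le.1 h) _
  rw [lintegral_congr hinner]
  have hm2 : Measurable fun p : (ℝ × Vec d × Vec d) × ℝ × Vec d =>
      meetWeight U S lam RK M p.1.1 p.1.2.1 p.1.2.2 p.2.1 p.2.2 *
        refreshAvg ν (beforeTime t (semigroup U lam ν (A.indicator 1))) (meetState S lam p) :=
    (measurable_meetWeight hU S lam RK M).mul (hΦm.comp hms :)
  rw [lintegral_prod _ hm2.aemeasurable]
  refine lintegral_congr fun p => ?_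
  have hm3 := (hm2.comp (measurable_prodMk_left (x := p)) :)
  exact lintegral_prod _ hm3.aemeasurable

/-- The joint law, at a common first refreshment time, of two independent positions. -/
theorem exists_joint_firstRefresh (ρ ρ' : Measure (ℝ × Vec d)) [IsFiniteMeasure ρ]
    [IsFiniteMeasure ρ'] (h : ρ.fst = ρ'.fst) :
    ∃ Λ : Measure (ℝ × Vec d × Vec d), IsFiniteMeasure Λ ∧ Λ.fst = ρ.fst ∧
      Λ.map (fun p => (p.1, p.2.1)) = ρ ∧ Λ.map (fun p => (p.1, p.2.2)) = ρ' := by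
  -- Given the common time, the positions are drawn independently from the two disintegrations. Only
  -- the marginals of `Λ` matter later.
  refine ⟨ρ.fst ⊗ₘ (ρ.condKernel ×ₖ ρ'.condKernel), inferInstance, Measure.fst_compProd _ _, ?_, ?_⟩
  · have h1 := Measure.compProd_map (μ := ρ.fst) (κ := ρ.condKernel ×ₖ ρ'.condKernel)
      (f := Prod.fst) measurable_fst
    rw [← Kernel.fst_eq, Kernel.fst_prod, ρ.disintegrate ρ.condKernel] at h1
    exact h1.symm
  · have h1 := Measure.compProd_map (μ := ρ.fst) (κ := ρ.condKernel ×ₖ ρ'.condKernel)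
      (f := Prod.snd) measurable_snd
    rw [← Kernel.snd_eq, Kernel.snd_prod, h, ρ'.disintegrate ρ'.condKernel] at h1
    rw [h]
    exact h1.symm

end BPS
end

/-! ### Mass of the minorant -/

noncomputable section

namespace BPS
variable {d : ℕ} {U : Vec d → ℝ}

theorem isProbabilityMeasure_firstRefresh (hU : Continuous (∇ U)) {lam : ℝ} (hlam : 0 < lam)
    (ν : Measure (Vec d)) [IsProbabilityMeasure ν] (z : Vec d × Vec d) :
    IsProbabilityMeasure (firstRefresh U lam ν z) := by
  constructor
  rw [← Measure.fst_univ, firstRefresh_fst ν hU hlam, Measure.map_apply (by fun_prop) .univ,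
    Set.preimage_univ, measure_univ]

theorem ae_norm_firstRefresh_le (hU : Continuous (∇ U)) {lam : ℝ} (hlam : 0 < lam)
    (ν : Measure (Vec d)) [IsProbabilityMeasure ν] {RK : ℝ} {z : Vec d × Vec d}
    (hz : ‖z.1‖ + ‖z.2‖ ≤ RK) :
    ∀ᵐ p ∂(firstRefresh U lam ν z), 0 ≤ p.1 ∧ ‖p.2‖ ≤ (1 + p.1) * RK := by
  filter_upwards [ae_firstRefresh lam ν hU z, ae_time_firstRefresh ν hU hlam z] with p hp hp0
  refine ⟨hp0, hp.trans ?_⟩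
  nlinarith [norm_nonneg z.1, norm_nonneg z.2]

theorem refreshAvg_beforeTime_one (ν : Measure (Vec d)) [IsProbabilityMeasure ν] (lam t : ℝ)
    (p : ℝ × Vec d) :
    refreshAvg ν
      (beforeTime t (semigroup U lam ν ((Set.univ : Set (Vec d × Vec d)).indicator 1))) p =
      (Set.Iic t).indicator 1 p.1 := by
  rw [Set.indicator_univ, refreshAvg]
  by_cases h : p.1 ≤ t
  · rw [Set.indicator_of_mem (Set.mem_Iic.2 h)]
    calc _ = ∫⁻ _, 1 ∂ν := by
          refine lintegral_congr fun g => ?_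
          rw [beforeTime_of_le h, semigroup_one]
      _ = _ := by simp
  · rw [Set.indicator_of_notMem (by simpa using h)]
    exact (lintegral_congr fun g => beforeTime_of_lt (not_le.1 h) _).trans lintegral_zero

/-- The mass of the merging paths, given the time of the first refreshment. -/
theorem le_meetIntegral_one [NeZero d] {S : Matrix (Fin d) (Fin d) ℝ} {lam RK : ℝ} (M : ℝ)
    (hlam : 0 < lam) (hRK : 0 ≤ RK) (t : ℝ) (ν : Measure (Vec d)) [IsProbabilityMeasure ν]
    {p : ℝ × Vec d × Vec d} (hp0 : 0 ≤ p.1) (hp1 : ‖p.2.1‖ ≤ (1 + p.1) * RK)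
    (hp2 : ‖p.2.2‖ ≤ (1 + p.1) * RK) :
    ∫⁻ e, (Set.Iic t).indicator 1 (p.1 + e / lam) *
      (noBounceWeight U S lam RK M (e / lam) (lam * p.1) *
        gaussOverlap d (2 * (lam + lam * p.1) * RK * matNorm (CFC.sqrt S)⁻¹ / e) M)
        ∂(expMeasure 1) ≤
      meetIntegral U S lam RK M (refreshAvg ν (beforeTime t (semigroup U lam ν
        ((Set.univ : Set (Vec d × Vec d)).indicator 1)))) p := by
  refine lintegral_mono_ae ?_
  filter_upwards [ae_pos_expMeasure_one] with e he
  simp only [refreshAvg_beforeTime_one, meetState, meetWeight]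
  have hr : 0 < e / lam := by positivity
  have hm : Measurable fun m : Vec d => ENNReal.ofReal
      (min (gaussDensity (m + meetShift S (e / lam) p.2.1 p.2.2))
        (gaussDensity (m - meetShift S (e / lam) p.2.1 p.2.2))) := by fun_prop
  rw [lintegral_mul_const _ (hm.const_mul _), lintegral_const_mul _ hm,
    lintegral_min_gaussDensity, mul_comm]
  refine mul_le_mul' (mul_le_mul' le_rfl ?_) le_rfl
  have hn : 0 ≤ matNorm (CFC.sqrt S)⁻¹ := norm_nonneg _
  refine gaussOverlap_antitoneOn M (Set.mem_Ici.2 (by positivity))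
    (Set.mem_Ici.2 (by positivity)) ?_
  refine (mul_le_mul_of_nonneg_left (norm_meetShift_le hr hp1 hp2) (by norm_num)).trans
    (le_of_eq ?_)
  field_simp

theorem measurable_gaussOverlap [NeZero d] (M : ℝ) :
    Measurable fun r => gaussOverlap d r M := by
  have h : Measurable fun p : ℝ × Vec d => ENNReal.ofReal (((2 * Real.pi) ^ ((d : ℝ) / 2))⁻¹ *
      Real.exp (-(‖p.2‖ ^ 2 + p.1 * |p.2 0| + p.1 ^ 2 / 4) / 2)) := by fun_prop
  exact h.lintegral_prod_right'

theorem measurable_indicator_Iic_one (t : ℝ) :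
    Measurable ((Set.Iic t).indicator (1 : ℝ → ℝ≥0∞)) :=
  measurable_one.indicator measurableSet_Iic

/-- The exponential clock of `noBounceProb` can be identified with the one of the first
refreshment, by association. -/
theorem couplingMass_le [NeZero d] (hU : Continuous (∇ U)) (S : Matrix (Fin d) (Fin d) ℝ)
    {lam RK M : ℝ} (hlam : 0 < lam) (hRK : 0 ≤ RK) (hM : 0 ≤ M) (t : ℝ) :
    couplingMass U S lam RK M t ≤ ∫⁻ e₁, ∫⁻ e₂, (Set.Iic t).indicator 1 (e₁ / lam + e₂ / lam) *
      (noBounceWeight U S lam RK M (e₂ / lam) e₁ *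
        gaussOverlap d (2 * (lam + e₁) * RK * matNorm (CFC.sqrt S)⁻¹ / e₂) M)
        ∂(expMeasure 1) ∂(expMeasure 1) := by
  have hn : 0 ≤ matNorm (CFC.sqrt S)⁻¹ := norm_nonneg _
  set a : ℝ → ℝ → ℝ≥0∞ := fun e₁ e₂ => (Set.Iic t).indicator 1 (e₁ / lam + e₂ / lam) *
    gaussOverlap d (2 * (lam + e₁) * RK * matNorm (CFC.sqrt S)⁻¹ / e₂) M with ha
  set b : ℝ → ℝ → ℝ≥0∞ := fun e₁ e₂ => noBounceWeight U S lam RK M (e₂ / lam) e₁ with hb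
  have ham : Measurable fun p : ℝ × ℝ => a p.1 p.2 := by
    have h1 : Measurable fun p : ℝ × ℝ =>
        (Set.Iic t).indicator (1 : ℝ → ℝ≥0∞) (p.1 / lam + p.2 / lam) :=
      ((measurable_indicator_Iic_one t).comp
        (by fun_prop : Measurable fun p : ℝ × ℝ => p.1 / lam + p.2 / lam) :)
    have h2 : Measurable fun p : ℝ × ℝ =>
        gaussOverlap d (2 * (lam + p.1) * RK * matNorm (CFC.sqrt S)⁻¹ / p.2) M :=
      ((measurable_gaussOverlap (d := d) M).comp
        (by fun_prop : Measurable fun p : ℝ × ℝ =>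
          2 * (lam + p.1) * RK * matNorm (CFC.sqrt S)⁻¹ / p.2) :)
    exact h1.mul h2
  have hbm : Measurable fun p : ℝ × ℝ => b p.1 p.2 :=
    ((measurable_noBounceWeight hU S lam RK M).comp
      (by fun_prop : Measurable fun p : ℝ × ℝ => (p.2 / lam, p.1)) :)
  have hN : Measurable fun e₂ => ∫⁻ e₁, b e₁ e₂ ∂(expMeasure 1) := hbm.lintegral_prod_left'
  have hpos : ∀ᵐ p ∂((expMeasure 1).prod (expMeasure 1)), 0 < p.1 ∧ 0 < p.2 := by
    filter_upwards [Measure.quasiMeasurePreserving_fst.ae ae_pos_expMeasure_one,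
      Measure.quasiMeasurePreserving_snd.ae ae_pos_expMeasure_one] with p h1 h2 using ⟨h1, h2⟩
  calc couplingMass U S lam RK M t
      ≤ ∫⁻ p, a p.1 p.2 * ∫⁻ e₁, b e₁ p.2 ∂(expMeasure 1)
          ∂((expMeasure 1).prod (expMeasure 1)) := by
        refine lintegral_mono_ae ?_
        filter_upwards [hpos] with p ⟨hp1, hp2⟩
        by_cases h : p.1 + p.2 ∈ Set.Icc 0 (lam * t)
        swap
        · rw [Set.indicator_of_notMem
            (show p ∉ {p : ℝ × ℝ | p.1 + p.2 ∈ Set.Icc 0 (lam * t)} from h)]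
          exact zero_le
        rw [Set.indicator_of_mem (show p ∈ {p : ℝ × ℝ | p.1 + p.2 ∈ Set.Icc 0 (lam * t)} from h),
          noBounceProb_eq hU, ha]
        simp only
        have ht : p.1 / lam + p.2 / lam ∈ Set.Iic t := by
          rw [Set.mem_Iic, ← add_div, div_le_iff₀' hlam]
          exact h.2
        rw [Set.indicator_of_mem ht, Pi.one_apply, one_mul]
        gcongr
        exact alphaTilde_le_gaussOverlap (by positivity) M
    -- With `e₂` fixed, the independent copy of `E₁` hidden in `g` shows as a product of two
    -- integrals over `e₁`.
    _ = ∫⁻ e₂, (∫⁻ e₁, a e₁ e₂ ∂(expMeasure 1)) * (∫⁻ e₁, b e₁ e₂ ∂(expMeasure 1))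
          ∂(expMeasure 1) := by
        have hm : Measurable fun p : ℝ × ℝ => a p.1 p.2 * ∫⁻ e₁, b e₁ p.2 ∂(expMeasure 1) :=
          ham.mul (hN.comp measurable_snd :)
        rw [lintegral_prod_symm _ hm.aemeasurable]
        refine lintegral_congr fun e₂ => ?_
        have ham' : Measurable fun e₁ => a e₁ e₂ :=
          (ham.comp (measurable_prodMk_right (y := e₂)) :)
        exact lintegral_mul_const (∫⁻ e₁, b e₁ e₂ ∂(expMeasure 1)) ham'
    -- Association in `e₁`: a larger first clock makes the deadline harder to meet, increases the
    -- distance in the overlap, and makes bounces harder to exclude.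
    _ ≤ ∫⁻ e₂, ∫⁻ e₁, a e₁ e₂ * b e₁ e₂ ∂(expMeasure 1) ∂(expMeasure 1) := by
        refine lintegral_mono_ae ?_
        filter_upwards [ae_pos_expMeasure_one] with e₂ he₂
        have ham' : Measurable fun e₁ => a e₁ e₂ :=
          (ham.comp (measurable_prodMk_right (y := e₂)) :)
        have hbm' : Measurable fun e₁ => b e₁ e₂ :=
          (hbm.comp (measurable_prodMk_right (y := e₂)) :)
        refine lintegral_mul_lintegral_le_of_antitoneOn _ ham' hbm' (s := Set.Ici 0) ?_ ?_
          (noBounceWeight_antitoneOn hU S hlam hRK hM (by positivity))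
        · filter_upwards [ae_pos_expMeasure_one] with e he using he.le
        · intro e he e' he' hee'
          have he0 : 0 ≤ e := he
          have he0' : 0 ≤ e' := he'
          rw [ha]
          refine mul_le_mul' ?_ ?_
          · by_cases h : e' / lam + e₂ / lam ∈ Set.Iic t
            · have h' : e / lam + e₂ / lam ∈ Set.Iic t := by
                refine le_trans ?_ (Set.mem_Iic.1 h)
                gcongr
              rw [Set.indicator_of_mem h']
              exact Set.indicator_le_self' (fun _ _ => zero_le) _
            · rw [Set.indicator_of_notMem h]
              exact zero_le
          · refine gaussOverlap_antitoneOn M (Set.mem_Ici.2 (by positivity))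
              (Set.mem_Ici.2 (by positivity)) ?_
            gcongr
    _ = _ := by
        rw [lintegral_lintegral_swap]
        · refine lintegral_congr fun e₁ => lintegral_congr fun e₂ => ?_
          rw [ha, hb]
          ring
        · exact ((ham.mul hbm).comp measurable_swap :).aemeasurable

end BPS
end

/-! ### Conclusion -/

theorem lemma12 {d : ℕ} [NeZero d] (U : EuclideanSpace ℝ (Fin d) → ℝ) (hU : ContDiff ℝ 2 U)
    (lam : ℝ) (hlam : 0 < lam) (S : Matrix (Fin d) (Fin d) ℝ) (hS : S.PosDef)
    (t : ℝ) (ht : 0 < t) (RK : ℝ) (hRK : 0 ≤ RK)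
    (K : Set (EuclideanSpace ℝ (Fin d) × EuclideanSpace ℝ (Fin d))) (hK : IsCompact K)
    (hKR : K ⊆ {p | ‖p.1‖ + ‖p.2‖ ≤ RK})
    (z z' : EuclideanSpace ℝ (Fin d) × EuclideanSpace ℝ (Fin d)) (hz : z ∈ K) (hz' : z' ∈ K)
    (M : ℝ) (hM : 0 ≤ M) :
    1 / 2 * tvNorm (BPS.transition U lam (multivariateGaussian 0 S) t z)
        (BPS.transition U lam (multivariateGaussian 0 S) t z') ≤
      1 - BPS.couplingMass U S lam RK M t := by
  have hU1 : Continuous (∇ U) := BPS.continuous_gradient hU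
  set ν := multivariateGaussian (0 : EuclideanSpace ℝ (Fin d)) S with hν
  set ρ := BPS.firstRefresh U lam ν z with hρ
  set ρ' := BPS.firstRefresh U lam ν z' with hρ'
  have hρp : IsProbabilityMeasure ρ := BPS.isProbabilityMeasure_firstRefresh hU1 hlam ν z
  have hρp' : IsProbabilityMeasure ρ' := BPS.isProbabilityMeasure_firstRefresh hU1 hlam ν z'
  have hPz := BPS.isProbabilityMeasure_transition ν hU1 hlam ht.le z
  have hPz' := BPS.isProbabilityMeasure_transition ν hU1 hlam ht.le z'
  have hfst : ρ.fst = (expMeasure 1).map (fun e => e / lam) := BPS.firstRefresh_fst ν hU1 hlam z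
  have hfst' : ρ'.fst = (expMeasure 1).map (fun e => e / lam) := BPS.firstRefresh_fst ν hU1 hlam z'
  obtain ⟨Λ, hΛ, hΛfst, hΛ1, hΛ2⟩ := BPS.exists_joint_firstRefresh ρ ρ' (hfst.trans hfst'.symm)
  obtain ⟨κ, hκ⟩ := BPS.exists_meetMeasure hU1 S lam RK M t ν Λ
  have hm1 : Measurable fun p : ℝ × BPS.Vec d × BPS.Vec d => (p.1, p.2.1) := by fun_prop
  have hm2 : Measurable fun p : ℝ × BPS.Vec d × BPS.Vec d => (p.1, p.2.2) := by fun_prop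
  have hae1 : ∀ᵐ p ∂Λ, 0 ≤ p.1 ∧ ‖p.2.1‖ ≤ (1 + p.1) * RK := by
    have h := BPS.ae_norm_firstRefresh_le hU1 hlam ν (hKR hz)
    rw [← hρ, ← hΛ1] at h
    exact ae_of_ae_map hm1.aemeasurable h
  have hae2 : ∀ᵐ p ∂Λ, 0 ≤ p.1 ∧ ‖p.2.2‖ ≤ (1 + p.1) * RK := by
    have h := BPS.ae_norm_firstRefresh_le hU1 hlam ν (hKR hz')
    rw [← hρ', ← hΛ2] at h
    exact ae_of_ae_map hm2.aemeasurable h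
  have hΦm : ∀ A : Set (BPS.Vec d × BPS.Vec d), MeasurableSet A → Measurable
      (BPS.refreshAvg ν (BPS.beforeTime t (BPS.semigroup U lam ν (A.indicator 1)))) := fun A hA =>
    BPS.measurable_refreshAvg ν (BPS.measurable_beforeTime t
      (BPS.measurable_semigroup lam ν hU1 (measurable_one.indicator hA)))
  have hκz : κ ≤ BPS.transition U lam ν t z := by
    refine Measure.le_iff.2 fun A hA => ?_
    have hA1 : Measurable (A.indicator (1 : BPS.Vec d × BPS.Vec d → ℝ≥0∞)) :=
      measurable_one.indicator hA
    rw [hκ A hA, BPS.transition_apply ν hU1 hlam ht.le z hA]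
    refine le_trans ?_ (BPS.lintegral_firstRefresh_le_semigroup ν hU1 hlam hA1 ht.le z)
    rw [← hρ, ← hΛ1, lintegral_map (hΦm A hA) hm1]
    refine lintegral_mono_ae ?_
    filter_upwards [hae1, hae2] with p hp1 hp2
    exact BPS.lintegral_meetWeight_le hU1 hS hlam hA1 t hp1.2 hp2.2
  have hκz' : κ ≤ BPS.transition U lam ν t z' := by
    refine Measure.le_iff.2 fun A hA => ?_
    have hA1 : Measurable (A.indicator (1 : BPS.Vec d × BPS.Vec d → ℝ≥0∞)) :=
      measurable_one.indicator hA
    rw [hκ A hA, BPS.transition_apply ν hU1 hlam ht.le z' hA]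
    refine le_trans ?_ (BPS.lintegral_firstRefresh_le_semigroup ν hU1 hlam hA1 ht.le z')
    rw [← hρ', ← hΛ2, lintegral_map (hΦm A hA) hm2]
    refine lintegral_mono_ae ?_
    filter_upwards [hae1, hae2] with p hp1 hp2
    -- The bound is applied with the two positions exchanged, and the symmetry of weight and meeting
    -- point returns the same integrand.
    refine le_trans (le_of_eq ?_)
      (BPS.lintegral_meetWeight_le (M := M) hU1 hS hlam hA1 t hp2.2 hp1.2)
    refine lintegral_congr fun e => lintegral_congr fun m => ?_
    rw [BPS.meetWeight_symm, BPS.meetPoint_symm]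
    rfl
  refine (half_tvNorm_le_of_common_minorant _ _ κ hκz hκz').trans (tsub_le_tsub_left ?_ 1)
  refine (BPS.couplingMass_le hU1 S hlam hRK hM t).trans ?_
  rw [hκ _ MeasurableSet.univ]
  have hG : Measurable fun s => ∫⁻ e, (Set.Iic t).indicator (1 : ℝ → ℝ≥0∞) (s + e / lam) *
      (BPS.noBounceWeight U S lam RK M (e / lam) (lam * s) *
        BPS.gaussOverlap d (2 * (lam + lam * s) * RK * BPS.matNorm (CFC.sqrt S)⁻¹ / e) M)
        ∂(expMeasure 1) := by
    have h1 : Measurable fun p : ℝ × ℝ =>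
        (Set.Iic t).indicator (1 : ℝ → ℝ≥0∞) (p.1 + p.2 / lam) :=
      ((BPS.measurable_indicator_Iic_one t).comp
        (by fun_prop : Measurable fun p : ℝ × ℝ => p.1 + p.2 / lam) :)
    have h2 : Measurable fun p : ℝ × ℝ =>
        BPS.gaussOverlap d (2 * (lam + lam * p.1) * RK * BPS.matNorm (CFC.sqrt S)⁻¹ / p.2) M :=
      ((BPS.measurable_gaussOverlap (d := d) M).comp
        (by fun_prop : Measurable fun p : ℝ × ℝ =>
          2 * (lam + lam * p.1) * RK * BPS.matNorm (CFC.sqrt S)⁻¹ / p.2) :)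
    have h3 : Measurable fun p : ℝ × ℝ =>
        BPS.noBounceWeight U S lam RK M (p.2 / lam) (lam * p.1) :=
      ((BPS.measurable_noBounceWeight hU1 S lam RK M).comp
        (by fun_prop : Measurable fun p : ℝ × ℝ => (p.2 / lam, lam * p.1)) :)
    exact (h1.mul (h3.mul h2)).lintegral_prod_right'
  have hdiv : Measurable fun e : ℝ => e / lam := by fun_prop
  calc _ = ∫⁻ p, ∫⁻ e, (Set.Iic t).indicator (1 : ℝ → ℝ≥0∞) (p.1 + e / lam) *
      (BPS.noBounceWeight U S lam RK M (e / lam) (lam * p.1) *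
        BPS.gaussOverlap d (2 * (lam + lam * p.1) * RK * BPS.matNorm (CFC.sqrt S)⁻¹ / e) M)
        ∂(expMeasure 1) ∂Λ := by
        have h := lintegral_map (μ := Λ) hG measurable_fst
        -- The integrand depends on the first refreshment only through its time `s = e₁ / lam`, so
        -- `lam * s` becomes the clock `e₁`.
        rw [← h, ← Measure.fst, hΛfst, hfst, lintegral_map hG hdiv]
        refine lintegral_congr fun e => ?_
        rw [mul_div_cancel₀ e hlam.ne']
    _ ≤ _ := by
        refine lintegral_mono_ae ?_
        filter_upwards [hae1, hae2] with p hp1 hp2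
        exact BPS.le_meetIntegral_one M hlam hRK t ν hp1.1 hp1.2 hp2.2
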